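/- **Definitions.** A permutation $\pi$ of $\{1,\dots,n\}$ is *Baxter* if there are no $i<j<k$ with $\pi(j+1)<\pi(i)<\pi(k)<\pi(j)$ or $\pi(j)<\pi(k)<\pi(i)<\pi(j+1)$. Its *diagram* is the set of points $(i,\pi(i))$, $1\le i\le n$. A *plane bipolar orientation* $O$ is an acyclic orientation of a finite planar map (a connected graph, possibly with multiple edges and with at least one edge, embedded in the plane without edge-crossings, up to continuous deformation) with a unique source (vertex with no ingoing edge) and a unique sink (vertex with no outgoing edge), both on the outer face. Around each vertex other than these two, in clockwise order, one finds a sequence of outgoing edges, then a sequence of ingoing edges. *The map $\Phi$.* Let $\pi$ be a Baxter permutation of $\{1,\dots,n\}$, $n\ge 1$, and put $\pi(0)=0$, $\pi(n+1)=n+1$. Take the black points $(i,\pi(i))$, $1\le i\le n$, and, for each $a\in\{0,\dots,n\}$ with $\pi(a)<\pi(a+1)$, the white point $w_a=(a+\frac12,\ell_a+\frac12)$, where $\ell_a=\max\{\pi(i): 0\le i<a+1,\ \pi(i)<\pi(a+1)\}$. Let $\phi(\pi)$ be the Hasse diagram of this set of points for the product order of $\mathbb R^2$, drawn with straight edges directed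 upwards. It has no edge-crossing, each edge joins a black and a white point, and each black point has indegree and outdegree $1$. Erasing the black points (so that each black point becomes the middle of an edge) gives a plane bipolar orientation with source $w_0$ and sink $w_n$, denoted $\Phi(\pi)$. The map $\Phi$ is a bijection from Baxter permutations of size $n$ to plane bipolar orientations with $n$ edges. *The point set $\Psi(O)$.* Let $O$ be a plane bipolar orientation. Insert a black vertex in the middle of each edge of $O$; the original vertices are white. Let $T_x$ (resp. $T_y$) be obtained by retaining, among the edges ending at each white vertex, only the first (resp. last) one in clockwise order; at the sink, one retains the incoming edge that has the outer face on its right (resp. on its left). Then $T_x$ and $T_y$ are spanning trees rooted at the source of $O$. For each black vertex $v$, let $x(v)$ be the rank of $v$, starting from $1$, among the black vertices in the prefix order of $T_x$ obtained by walking around $T_x$ clockwise, and let $y(v)$ be its rank among the black vertices in the prefix order of $T_y$ obtained by walking around $T_y$ counterclockwise; both walks start at the source, in the outer face of $O$. Let $\Psi(O)$ be the set of points $(x(v),y(v))$. **Theorem.** For every plane bipolar orientation $O$, the set $\Psi(O)$ is the diagram of the Baxter permutation $\Phi^{-1}(O)$. That is, there is a unique Baxter permutation $\pi$ such that $\Phi(\pi)=O$,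 and $\Psi(O)=\{(i,\pi(i))\}$. -/

import Mathlib

/-! ## Plane bipolar orientations

Planar maps are encoded, as usual, by rotation systems of genus 0 with a marked (outer) face.
A directed edge `e` has two darts: `Sum.inl e`, its initial end, attached to the origin of `e`, and
`Sum.inr e`, its final end, attached to the endpoint of `e`. Loops and multiple edges are not
excluded a priori. -/

/-- A directed graph on a closed oriented surface: `rot` maps each dart to the next one in clockwise
order around its vertex. -/
structure OrientedMap (V E : Type*) where
  src : E → V
  tgt : E → V
  rot : Equiv.Perm (E ⊕ E)
  /-- `rot` permutes cyclically the darts around each vertex. -/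
  rot_sameCycle : ∀ d d' : E ⊕ E,
    rot.SameCycle d d' ↔ Sum.elim src tgt d = Sum.elim src tgt d'

namespace OrientedMap

variable {V E : Type*} (M : OrientedMap V E)

/-- The vertex to which a dart is attached. -/
def vert (d : E ⊕ E) : V := Sum.elim M.src M.tgt d

/-- The walk around a face that keeps this face on the right: travel along the edge of the dart `d`,
away from its vertex, then turn right as sharply as possible. -/
def faceNext : Equiv.Perm (E ⊕ E) := (Equiv.sumComm E E).trans M.rot.symm

/-- The faces are the cycles of `faceNext`. -/
def Face : Type _ := Quotient (Equiv.Perm.SameCycle.setoid M.faceNext)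

/-- The face lying on the right of a dart, when one travels away from its vertex. It is also the
face that is found just after this dart, in clockwise order around its vertex. -/
def face (d : E ⊕ E) : M.Face := Quotient.mk (Equiv.Perm.SameCycle.setoid M.faceNext) d

/-- The face on the right of the directed edge `e`. -/
def rightFace (e : E) : M.Face := M.face (Sum.inl e)

/-- The face on the left of the directed edge `e`. -/
def leftFace (e : E) : M.Face := M.face (Sum.inr e)

/-- There is an edge from `u` to `v`. -/
def Arc (u v : V) : Prop := ∃ e, M.src e = u ∧ M.tgt e = v

end OrientedMap

/-- A plane bipolar orientation with vertex set `V` and edge set `E`. (Because of Euler's formula,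
there is at least one edge.) -/
structure PlaneBipolarOrientation (V E : Type*) [Fintype V] [Fintype E]
    extends OrientedMap V E where
  connected : ∀ u v : V, Relation.EqvGen toOrientedMap.Arc u v
  /-- Genus 0, that is, Euler's formula. -/
  euler : Nat.card V + Nat.card toOrientedMap.Face = Nat.card E + 2
  outer : toOrientedMap.Face
  acyclic : ∀ v : V, ¬ Relation.TransGen toOrientedMap.Arc v v
  source : V
  sink : V
  /-- `source` is the unique vertex with no ingoing edge. -/
  source_iff : ∀ v : V, (∀ e, tgt e ≠ v) ↔ v = source
  /-- `sink` is the unique vertex with no outgoing edge. -/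
  sink_iff : ∀ v : V, (∀ e, src e ≠ v) ↔ v = sink
  source_outer : ∃ d, toOrientedMap.vert d = source ∧ toOrientedMap.face d = outer
  sink_outer : ∃ d, toOrientedMap.vert d = sink ∧ toOrientedMap.face d = outer

namespace PlaneBipolarOrientation

variable {V E : Type*} [Fintype V] [Fintype E] (O : PlaneBipolarOrientation V E)

/-! ## The trees `T_x` and `T_y`, and the point set `Ψ(O)`

The bicolored map `O'`, obtained by inserting a black vertex in the middle of each edge of `O`, has
vertex set `V ⊕ E`, with white vertices `Sum.inl v` and black vertices `Sum.inr e`. Its edges are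
`Sum.inl (src e) → Sum.inr e` and `Sum.inr e → Sum.inl (tgt e)`, for `e` in `E`. -/

/-- `e` is the first incoming edge of its endpoint in clockwise order: it is preceded by an outgoing
edge. At the sink, this means the incoming edge that lies on the right border. -/
def IsFirstIncoming (e : E) : Prop :=
  (O.tgt e ≠ O.sink ∧ ∃ e', O.rot (Sum.inl e') = Sum.inr e) ∨
    (O.tgt e = O.sink ∧ O.rightFace e = O.outer)

/-- `e` is the last incoming edge of its endpoint in clockwise order: it is followed by an outgoing
edge. At the sink, this means the incoming edge that lies on the left border. -/
def IsLastIncoming (e : E) : Prop :=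
  (O.tgt e ≠ O.sink ∧ ∃ e', O.rot (Sum.inr e) = Sum.inl e') ∨
    (O.tgt e = O.sink ∧ O.leftFace e = O.outer)

/-- The directed edges of the subgraph of `O'` that retains, among the edges that end at a white
vertex, those that come from an element `e` of `keep`. -/
inductive TreeArc (keep : E → Prop) : V ⊕ E → V ⊕ E → Prop
  | out (e : E) : TreeArc keep (Sum.inl (O.src e)) (Sum.inr e)
  | inc (e : E) (h : keep e) : TreeArc keep (Sum.inr e) (Sum.inl (O.tgt e))

/-- The edges of the tree `T_x`. -/
def TxArc : V ⊕ E → V ⊕ E → Prop := O.TreeArc O.IsFirstIncoming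

/-- The edges of the tree `T_y`. -/
def TyArc : V ⊕ E → V ⊕ E → Prop := O.TreeArc O.IsLastIncoming

/-- `e'` is the outgoing edge that follows immediately the outgoing edge `e`, in clockwise order
around their common origin; at the source, this order starts and ends in the outer face. -/
def NextOutgoing (e e' : E) : Prop :=
  O.rot (Sum.inl e) = Sum.inl e' ∧ (O.src e = O.source → O.rightFace e ≠ O.outer)

/-- `e` and `e'` start at the same vertex, and `e` comes before `e'` in clockwise order. -/
def OutgoingBefore : E → E → Prop := Relation.TransGen O.NextOutgoing

/-- In a plane tree with directed edges `T` (from parent to child), in which `sib` is the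
order on the black children of each white vertex, the black vertex `a` comes strictly before the
black vertex `b` in prefix order: either `a` is a proper ancestor of `b`, or `a` and `b` descend
(in the wide sense) from two siblings `c` and `d`, with `c` before `d`. A black vertex has at most
one child, so that no order between white siblings is needed. -/
def PrefixBefore (T : V ⊕ E → V ⊕ E → Prop) (sib : E → E → Prop) (a b : E) : Prop :=
  Relation.TransGen T (Sum.inr a) (Sum.inr b) ∨
    ∃ c d, sib c d ∧ Relation.ReflTransGen T (Sum.inr c) (Sum.inr a) ∧
      Relation.ReflTransGen T (Sum.inr d) (Sum.inr b)

/-- The label (in `{1, 2, …}`) of the black vertex `e` in the clockwise prefix order of `T_x`. -/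
noncomputable def xLabel (e : E) : ℕ :=
  Set.ncard {a : E | PrefixBefore O.TxArc O.OutgoingBefore a e} + 1

/-- The label (in `{1, 2, …}`) of the black vertex `e` in the counterclockwise prefix order of
`T_y`. -/
noncomputable def yLabel (e : E) : ℕ :=
  Set.ncard {a : E | PrefixBefore O.TyArc (fun c d => O.OutgoingBefore d c) a e} + 1

/-- The set of points `Ψ(O)`. -/
noncomputable def Psi : Set (ℝ × ℝ) :=
  Set.range fun e : E => ((O.xLabel e : ℝ), (O.yLabel e : ℝ))

end PlaneBipolarOrientation

/-! ## Baxter permutations and the bijection `Φ` -/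

/-- There are no `i < j < k` such that `π(j+1) < π(i) < π(k) < π(j)` or
`π(j) < π(k) < π(i) < π(j+1)`. Here `j'` stands for `j+1`. -/
def IsBaxter {n : ℕ} (π : Equiv.Perm (Fin n)) : Prop :=
  ∀ i j j' k : Fin n, i < j → (j' : ℕ) = (j : ℕ) + 1 → j < k →
    ¬ (π j' < π i ∧ π i < π k ∧ π k < π j) ∧ ¬ (π j < π k ∧ π k < π i ∧ π i < π j')

/-- The diagram of a permutation `π` of `{1, …, n}`, that is, the set of points `(i, π(i))`. The
elements of `Fin n` are `0, …, n-1`, hence the shift by one. These points are also the black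
vertices of `φ(π)`. -/
def permDiagram {n : ℕ} (π : Equiv.Perm (Fin n)) : Set (ℝ × ℝ) :=
  Set.range fun i : Fin n => (((i : ℕ) : ℝ) + 1, ((π i : ℕ) : ℝ) + 1)

/-- The permutation `π`, as a permutation of `{1, …, n}`, extended by `π(0) = 0` and
`π(n+1) = n+1`. -/
def permExt {n : ℕ} (π : Equiv.Perm (Fin n)) (i : ℕ) : ℕ :=
  if h : 1 ≤ i ∧ i - 1 < n then (π ⟨i - 1, h.2⟩ : ℕ) + 1 else i

/-- `ℓ_a = max {π(i) : i < a + 1 and π(i) < π(a+1)}`. -/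
def ascentLevel {n : ℕ} (π : Equiv.Perm (Fin n)) (a : ℕ) : ℕ :=
  ((Finset.range (a + 1)).filter fun i => permExt π i < permExt π (a + 1)).sup (permExt π)

/-- The white vertex `w_a = (a + 1/2, ℓ_a + 1/2)`. With the convention `π(0) = 0` and
`π(n+1) = n+1`, this gives `w_0 = (1/2, 1/2)` and `w_n = (n + 1/2, n + 1/2)`. -/
noncomputable def whitePoint {n : ℕ} (π : Equiv.Perm (Fin n)) (a : ℕ) : ℝ × ℝ :=
  ((a : ℝ) + 1 / 2, (ascentLevel π a : ℝ) + 1 / 2)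

/-- The white vertices of `φ(π)`: `w_0`, `w_n`, and one vertex `w_a` per ascent `a` of `π`. -/
def whitePoints {n : ℕ} (π : Equiv.Perm (Fin n)) : Set (ℝ × ℝ) :=
  {p | ∃ a, a ≤ n ∧ permExt π a < permExt π (a + 1) ∧ p = whitePoint π a}

/-- The set of vertices of `φ(π)`. -/
def phiPoints {n : ℕ} (π : Equiv.Perm (Fin n)) : Set (ℝ × ℝ) := permDiagram π ∪ whitePoints π

/-- The edges of the Hasse diagram of a set `S` of points, for the product order: `q` covers `p`
in `S`. -/
def HasseArc (S : Set (ℝ × ℝ)) (p q : ℝ × ℝ) : Prop :=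
  p ∈ S ∧ q ∈ S ∧ p < q ∧ ∀ r ∈ S, ¬ (p < r ∧ r < q)

/-- The Hasse diagram of `S`, drawn with straight edges, has no edge crossing: two distinct edges
meet only at common endpoints. -/
def HasseNoncrossing (S : Set (ℝ × ℝ)) : Prop :=
  ∀ p q p' q', HasseArc S p q → HasseArc S p' q' → (p, q) ≠ (p', q') →
    segment ℝ p q ∩ segment ℝ p' q' ⊆ {p, q} ∩ {p', q'}

/-- The subset of the plane covered by the edges of the Hasse diagram of `S`. -/
def hasseDrawing (S : Set (ℝ × ℝ)) : Set (ℝ × ℝ) :=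
  {x | ∃ p q, HasseArc S p q ∧ x ∈ segment ℝ p q}

/-- The unbounded face of this drawing. -/
def unboundedFace (S : Set (ℝ × ℝ)) : Set (ℝ × ℝ) :=
  {x | x ∉ hasseDrawing S ∧
    ¬ Bornology.IsBounded (connectedComponentIn (hasseDrawing S)ᶜ x)}

/-- The angle, in `(0, 2π]`, by which one has to turn clockwise to go from the direction of the
vector `u` to the direction of the vector `v`. -/
noncomputable def clockwiseAngle (u v : ℝ × ℝ) : ℝ :=
  toIocMod Real.two_pi_pos 0 (Complex.arg ⟨u.1, u.2⟩ - Complex.arg ⟨v.1, v.2⟩)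

/-- The identification of the embedded digraph `φ(π)` (the Hasse diagram of the black and white
points associated with `π`) with the bicolored map `O'`, that is, with the plane bipolar orientation
`O` in which a black vertex has been inserted in the middle of each edge. Equivalently, erasing the
black vertices of `φ(π)` gives `O`, with source `w_0` and sink `w_n`. -/
structure PhiDrawing {n : ℕ} (π : Equiv.Perm (Fin n)) {V E : Type*} [Fintype V] [Fintype E]
    (O : PlaneBipolarOrientation V E) where
  white : V → ℝ × ℝ
  black : E → ℝ × ℝ
  white_bijOn : Set.BijOn white Set.univ (whitePoints π)
  black_bijOn : Set.BijOn black Set.univ (permDiagram π)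
  white_source : white O.source = whitePoint π 0
  white_sink : white O.sink = whitePoint π n
  hasseArc_iff : ∀ p q, HasseArc (phiPoints π) p q ↔
    ∃ e, (p = white (O.src e) ∧ q = black e) ∨ (p = black e ∧ q = white (O.tgt e))
  noncrossing : HasseNoncrossing (phiPoints π)
  /-- Around each white vertex, starting from a dart `d` and turning clockwise, the first dart that
  is met in the drawing is `rot d`. The dart `d` goes from `white (vert d)` to the black point of
  its edge. -/
  rot_clockwise : ∀ d d' : E ⊕ E, O.vert d' = O.vert d →
    clockwiseAngle (Sum.elim black black d - white (O.vert d))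
        (Sum.elim black black (O.rot d) - white (O.vert d)) ≤
      clockwiseAngle (Sum.elim black black d - white (O.vert d))
        (Sum.elim black black d' - white (O.vert d))
  /-- The outer face is drawn as the unbounded face: some (equivalently, every) dart `d` that has
  the outer face on its right has the unbounded face on its right in the drawing. The point
  `m + ε • (v₂, -v₁)` lies on the right of the midpoint `m` of a segment of direction `v`. -/
  outer_unbounded : ∃ d, O.face d = O.outer ∧ ∀ᶠ ε : ℝ in nhdsWithin 0 (Set.Ioi 0),
    midpoint ℝ (white (O.vert d)) (Sum.elim black black d) +
      ε • ((Sum.elim black black d - white (O.vert d)).2,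
        -(Sum.elim black black d - white (O.vert d)).1) ∈ unboundedFace (phiPoints π)

/-- `Φ(π) = O`; plane bipolar orientations are considered up to isomorphism. -/
def IsPhi {n : ℕ} (π : Equiv.Perm (Fin n)) {V E : Type*} [Fintype V] [Fintype E]
    (O : PlaneBipolarOrientation V E) : Prop :=
  Nonempty (PhiDrawing π O)

open Relation

/-! ## Chains -/

/-! Two facts suffice. The tree labels of `O` form a drawing `φ(π)` of `O` with `π` Baxter
(`exists_isBaxter_isPhi`), and in any drawing of `O` as `φ(π)` with `π` Baxter, the coordinates of
the black points are the tree labels (`PhiDrawing.psi_eq`). Since a permutation is determined by its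
diagram, uniqueness follows. The bijectivity of `Φ` is proved along the way rather than assumed.

Genus 0 enters through a count. Each face has a corner between two outgoing darts, and each vertex
other than the poles has a corner from an outgoing to an ingoing dart. By Euler's formula there are
as many such faces and vertices as edges, so each has exactly one such corner; the same holds for
the corners that follow ingoing darts. Hence outgoing and ingoing edges are linearly ordered around
each vertex, and each inner face has two directed borders from a lowest to a topmost corner.
`BipolarCore` keeps only this, and has a mirror symmetry that exchanges `T_x` and `T_y`.

Existence. In the prefix order of `T_x`, a rightmost ingoing edge of a vertex other than the sink is
followed by the leftmost outgoing edge of that vertex; any other ingoing edge `e` with right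
neighbour `e'` is a leaf, followed by the first edge of the right border of the face between `e` and
`e'`. `Labeling` records these rules. They imply that edges ranked between two ingoing (outgoing)
edges of `v` lead to (start from) `v`. Therefore two edges increase in both labels exactly when a
path joins them (`path_of_lt`, `lt_of_path`), ascents correspond to vertices and descents to faces
(`succ_cases`), and the permutation is Baxter. With each vertex placed half a unit beyond the ranks
of its extreme ingoing edges, the product order is reachability, and the Hasse diagram, its
planarity, its angles and its outer face can be read off.

Uniqueness. Let `e`, `f` have consecutive abscissas in a drawing. At an ascent, `e` is the parent of
`f` in `T_x`. At a descent, one climbs from `e`; the Baxter condition keeps the ancestors above `f`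
until one of them is a left sibling of `f`. So increasing abscissa is the prefix order
(`HalfDrawing.label_eq`). This needs the left-to-right order of outgoing edges, which angles give at
inner vertices; at the source, the cut of the cyclic order is found by following the border of the
unbounded face (`exists_outer`). -/

theorem Relation.not_transGen_self_of_terminal {α : Type*} {r : α → α → Prop}
    (hr : Relator.RightUnique r) {m : α} (hm : ∀ b, ¬ r m b) {a : α} (h : ReflTransGen r a m) :
    ¬ TransGen r a a := by
  induction h using ReflTransGen.head_induction_on with
  | refl =>
    intro h
    obtain ⟨b, hb, -⟩ := TransGen.head'_iff.1 h
    exact hm _ hb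
  | head hac _ ih =>
    intro h
    obtain ⟨b, hb, hba⟩ := TransGen.head'_iff.1 h
    obtain rfl := hr hac hb
    exact ih (TransGen.tail' hba hac)

theorem Relation.total_of_terminal {α : Type*} {r : α → α → Prop}
    (hr : Relator.LeftUnique r) {a b m : α} (ha : ReflTransGen r a m) (hb : ReflTransGen r b m) :
    a = b ∨ TransGen r a b ∨ TransGen r b a := by
  have hu : Relator.RightUnique (Function.swap r) := fun _ _ _ h h' => hr h h'
  rcases ReflTransGen.total_of_right_unique hu (reflTransGen_swap.2 ha)
    (reflTransGen_swap.2 hb) with h | h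
  · rcases reflTransGen_iff_eq_or_transGen.1 (reflTransGen_swap.1 h) with h | h
    · exact Or.inl h
    · exact Or.inr (Or.inr h)
  · rcases reflTransGen_iff_eq_or_transGen.1 (reflTransGen_swap.1 h) with h | h
    · exact Or.inl h.symm
    · exact Or.inr (Or.inl h)

theorem Equiv.Perm.SameCycle.exists_exit {α : Type*} [Finite α] {σ : Equiv.Perm α} {P : α → Prop}
    {a b : α} (h : σ.SameCycle a b) (ha : P a) (hb : ¬ P b) :
    ∃ c, σ.SameCycle a c ∧ P c ∧ ¬ P (σ c) := by
  by_contra! hc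
  obtain ⟨n, -, hn⟩ := h.exists_pow_eq'
  have key : ∀ n : ℕ, P ((σ ^ n) a) := by
    intro n
    induction n with
    | zero => simpa using ha
    | succ n ih =>
      rw [pow_succ', Equiv.Perm.mul_apply]
      exact hc _ ⟨n, by simp⟩ ih
  exact hb (hn ▸ key n)

/-- Cuts a cyclic order at `m`: iterating `σ` stays in the range of `i` until `m` is met, so the
cycle unrolls into a chain that ends at `m`. -/
theorem Equiv.Perm.reflTransGen_of_sameCycle {α β : Type*} [Finite α] {σ : Equiv.Perm α}
    {i : β → α} (hi : Function.Injective i) {m : β}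
    (hm : ∀ a, σ.SameCycle (i a) (i m) → a ≠ m → ∃ b, σ (i a) = i b) {a : β}
    (ha : σ.SameCycle (i a) (i m)) :
    ReflTransGen (fun a b => σ (i a) = i b ∧ a ≠ m) a m := by
  obtain ⟨n, -, hn⟩ := ha.exists_pow_eq'
  induction n generalizing a with
  | zero =>
    obtain rfl : a = m := hi (by simpa using hn)
    exact ReflTransGen.refl
  | succ n ih =>
    by_cases ham : a = m
    · rw [ham]
    · obtain ⟨b, hb⟩ := hm a ha ham
      refine ReflTransGen.head ⟨hb, ham⟩ (ih (a := b) ?_ ?_)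
      · rw [← hb]; exact Equiv.Perm.sameCycle_apply_left.2 ha
      · rw [← hb, ← Equiv.Perm.mul_apply, ← pow_succ]; exact hn

/-! ## The core of a bipolar orientation -/

/-- Edges and their left-to-right adjacencies around vertices: `nxo a b` means that the outgoing
edge `b` comes immediately to the right of the outgoing edge `a`, and `nxi` does the same for
ingoing edges. -/
structure BipolarCore (V E : Type*) where
  src : E → V
  tgt : E → V
  s : V
  t : V
  nxo : E → E → Prop
  nxi : E → E → Prop
  acyclic : ∀ v, ¬ TransGen (fun u w => ∃ e, src e = u ∧ tgt e = w) v v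
  s_ne_t : s ≠ t
  tgt_ne : ∀ e, tgt e ≠ s
  src_ne : ∀ e, src e ≠ t
  exists_in : ∀ v, v ≠ s → ∃ e, tgt e = v
  exists_out : ∀ v, v ≠ t → ∃ e, src e = v
  nxo_src : ∀ {a b}, nxo a b → src a = src b
  nxo_right_unique : Relator.RightUnique nxo
  nxo_left_unique : Relator.LeftUnique nxo
  nxo_total : ∀ {a b}, src a = src b → a = b ∨ TransGen nxo a b ∨ TransGen nxo b a
  nxo_irrefl : ∀ a, ¬ TransGen nxo a a
  nxi_tgt : ∀ {a b}, nxi a b → tgt a = tgt b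
  nxi_right_unique : Relator.RightUnique nxi
  nxi_left_unique : Relator.LeftUnique nxi
  nxi_total : ∀ {a b}, tgt a = tgt b → a = b ∨ TransGen nxi a b ∨ TransGen nxi b a
  nxi_irrefl : ∀ a, ¬ TransGen nxi a a
  face_of_nxo : ∀ {c d}, nxo c d → ∃ e e', nxi e e' ∧
    ReflTransGen (fun p q => tgt p = src q ∧ (∀ r, ¬ nxi p r) ∧ (∀ r, ¬ nxo q r)) c e ∧
    ReflTransGen (fun p q => tgt p = src q ∧ (∀ r, ¬ nxi r p) ∧ (∀ r, ¬ nxo r q)) d e'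
  face_of_nxi : ∀ {e e'}, nxi e e' → ∃ c d, nxo c d ∧
    ReflTransGen (fun p q => tgt p = src q ∧ (∀ r, ¬ nxi p r) ∧ (∀ r, ¬ nxo q r)) c e ∧
    ReflTransGen (fun p q => tgt p = src q ∧ (∀ r, ¬ nxi r p) ∧ (∀ r, ¬ nxo r q)) d e'

/-! ### Corners, Euler's formula and the local structure of a bipolar orientation. -/

namespace PlaneBipolarOrientation

variable {V E : Type*} [Fintype V] [Fintype E] (O : PlaneBipolarOrientation V E)

theorem vert_rot (d : E ⊕ E) : O.vert (O.rot d) = O.vert d :=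
  ((O.rot_sameCycle (O.rot d) d).1 (Equiv.Perm.sameCycle_apply_left.2 (Equiv.Perm.SameCycle.refl _ _)))

theorem sameCycle_of_vert {d d' : E ⊕ E} (h : O.vert d = O.vert d') : O.rot.SameCycle d d' :=
  (O.rot_sameCycle d d').2 h

theorem vert_of_sameCycle {d d' : E ⊕ E} (h : O.rot.SameCycle d d') : O.vert d = O.vert d' :=
  (O.rot_sameCycle d d').1 h

theorem face_swap_rot (d : E ⊕ E) : O.face (O.rot d).swap = O.face d := by
  apply Quotient.sound
  have h : O.faceNext (O.rot d).swap = d := by simp [OrientedMap.faceNext]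
  have : Equiv.Perm.SameCycle O.faceNext (O.rot d).swap (O.faceNext (O.rot d).swap) :=
    Equiv.Perm.sameCycle_apply_right.2 (Equiv.Perm.SameCycle.refl _ _)
  rw [h] at this
  exact this

theorem face_inl_of_rot_inl_inl {c d : E} (h : O.rot (Sum.inl c) = Sum.inl d) :
    O.face (Sum.inr d) = O.face (Sum.inl c) := by
  have := O.face_swap_rot (Sum.inl c); rwa [h] at this

theorem face_inl_of_rot_inl_inr {c d : E} (h : O.rot (Sum.inl c) = Sum.inr d) :
    O.face (Sum.inl d) = O.face (Sum.inl c) := by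
  have := O.face_swap_rot (Sum.inl c); rwa [h] at this

theorem face_inr_of_rot_inr_inl {c d : E} (h : O.rot (Sum.inr c) = Sum.inl d) :
    O.face (Sum.inr d) = O.face (Sum.inr c) := by
  have := O.face_swap_rot (Sum.inr c); rwa [h] at this

theorem face_inr_of_rot_inr_inr {c d : E} (h : O.rot (Sum.inr c) = Sum.inr d) :
    O.face (Sum.inl d) = O.face (Sum.inr c) := by
  have := O.face_swap_rot (Sum.inr c); rwa [h] at this

theorem tgt_ne_source (e : E) : O.tgt e ≠ O.source := (O.source_iff O.source).2 rfl e

theorem src_ne_sink (e : E) : O.src e ≠ O.sink := (O.sink_iff O.sink).2 rfl e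

theorem exists_tgt {v : V} (h : v ≠ O.source) : ∃ e, O.tgt e = v := by
  by_contra! hc; exact h ((O.source_iff v).1 hc)

theorem exists_src {v : V} (h : v ≠ O.sink) : ∃ e, O.src e = v := by
  by_contra! hc; exact h ((O.sink_iff v).1 hc)

theorem wf_arc : WellFounded (TransGen O.Arc) := by
  have : IsTrans V (TransGen O.Arc) := ⟨fun _ _ _ => TransGen.trans⟩
  have : Std.Irrefl (TransGen O.Arc) := ⟨O.acyclic⟩
  exact Finite.wellFounded_of_trans_of_irrefl _

theorem wf_arc_swap : WellFounded (Function.swap (TransGen O.Arc)) := by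
  have : IsTrans V (Function.swap (TransGen O.Arc)) := ⟨fun _ _ _ h h' => TransGen.trans h' h⟩
  have : Std.Irrefl (Function.swap (TransGen O.Arc)) := ⟨O.acyclic⟩
  exact Finite.wellFounded_of_trans_of_irrefl _

/-- Following the left border of a face upwards, one reaches its topmost corner. -/
theorem exists_top_corner (e : E) : ∃ f f', O.rot (Sum.inr f') = Sum.inr f ∧
    O.face (Sum.inr f') = O.face (Sum.inl e) ∧
    ReflTransGen (fun p q => O.rot (Sum.inl q) = Sum.inr p) e f := by
  induction hv : O.src e using O.wf_arc_swap.induction generalizing e with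
  | _ v ih =>
    subst hv
    cases h : O.rot.symm (Sum.inr e) with
    | inl q =>
      have h' : O.rot (Sum.inl q) = Sum.inr e := by rw [← h]; simp
      have hsrc : O.src q = O.tgt e := by
        have := O.vert_rot (Sum.inl q); rw [h'] at this; exact this.symm
      obtain ⟨f, f', h1, h2, h3⟩ := ih (O.src q) (TransGen.single ⟨e, rfl, hsrc.symm⟩) q rfl
      exact ⟨f, f', h1, h2.trans (O.face_inl_of_rot_inl_inr h').symm, h3.head h'⟩
    | inr q =>
      have h' : O.rot (Sum.inr q) = Sum.inr e := by rw [← h]; simp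
      exact ⟨e, q, h', (O.face_inr_of_rot_inr_inr h').symm, ReflTransGen.refl⟩

/-- Following the right border of a face downwards, one reaches its lowest corner. -/
theorem exists_bottom_corner (e : E) : ∃ f f', O.rot (Sum.inl f') = Sum.inl f ∧
    O.face (Sum.inl f') = O.face (Sum.inr e) ∧
    ReflTransGen (fun p q => O.rot (Sum.inr p) = Sum.inl q) f e := by
  induction hv : O.src e using O.wf_arc.induction generalizing e with
  | _ v ih =>
    subst hv
    cases h : O.rot.symm (Sum.inl e) with
    | inr q =>
      have h' : O.rot (Sum.inr q) = Sum.inl e := by rw [← h]; simp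
      have htgt : O.tgt q = O.src e := by
        have := O.vert_rot (Sum.inr q); rw [h'] at this; exact this.symm
      obtain ⟨f, f', h1, h2, h3⟩ := ih (O.src q) (TransGen.single ⟨q, rfl, htgt⟩) q rfl
      exact ⟨f, f', h1, h2.trans (O.face_inr_of_rot_inr_inl h').symm, h3.tail h'⟩
    | inl q =>
      have h' : O.rot (Sum.inl q) = Sum.inl e := by rw [← h]; simp
      exact ⟨e, q, h', (O.face_inl_of_rot_inl_inl h').symm, ReflTransGen.refl⟩

theorem exists_source_corner (F : O.Face) :
    ∃ c d, O.rot (Sum.inl c) = Sum.inl d ∧ O.face (Sum.inl c) = F := by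
  have hr : ∀ e, ∃ c d, O.rot (Sum.inl c) = Sum.inl d ∧ O.face (Sum.inl c) = O.face (Sum.inr e) := by
    intro e
    obtain ⟨f, f', h1, h2, -⟩ := O.exists_bottom_corner e
    exact ⟨f', f, h1, h2⟩
  induction F using Quotient.inductionOn with
  | _ d =>
    cases d with
    | inr e => exact hr e
    | inl e =>
      obtain ⟨f, f', -, h2, -⟩ := O.exists_top_corner e
      obtain ⟨c, d, h3, h4⟩ := hr f'
      exact ⟨c, d, h3, h4.trans h2⟩

theorem exists_sink_corner (F : O.Face) :
    ∃ c d, O.rot (Sum.inr c) = Sum.inr d ∧ O.face (Sum.inr c) = F := by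
  obtain ⟨c, d, -, h⟩ := O.exists_source_corner F
  obtain ⟨f, f', h1, h2, -⟩ := O.exists_top_corner c
  exact ⟨f', f, h1, h2.trans h⟩

/-- A vertex that is both poles is isolated, hence by connectedness the only vertex. There are then
no edges and no faces, against Euler's formula. -/
theorem source_ne_sink : O.source ≠ O.sink := by
  intro h
  have hne : ∀ {u v}, O.Arc u v → u ≠ O.source ∧ v ≠ O.source := by
    rintro u v ⟨e, rfl, rfl⟩
    exact ⟨h ▸ O.src_ne_sink e, O.tgt_ne_source e⟩
  have hiff : ∀ {u v}, EqvGen O.Arc u v → (u = O.source ↔ v = O.source) := by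
    intro u v huv
    induction huv with
    | rel _ _ h => exact ⟨fun h' => absurd h' (hne h).1, fun h' => absurd h' (hne h).2⟩
    | refl _ => exact Iff.rfl
    | symm _ _ _ ih => exact ih.symm
    | trans _ _ _ _ _ ih ih' => exact ih.trans ih'
  have hV : ∀ v, v = O.source := fun v => (hiff (O.connected O.source v)).1 rfl
  have : IsEmpty E := ⟨fun e => O.tgt_ne_source e (hV _)⟩
  have : IsEmpty O.Face := ⟨fun F => by
    obtain ⟨c, -⟩ := O.exists_source_corner F
    exact this.false c⟩
  have : Subsingleton V := ⟨fun u v => (hV u).trans (hV v).symm⟩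
  have h1 := O.euler
  have h2 : Nat.card V ≤ 1 := Finite.card_le_one_iff_subsingleton.2 ‹_›
  simp only [Nat.card_of_isEmpty] at h1
  omega

/-- Euler's formula without the two poles: the possible charges are equinumerous with the edges, so
a surjective charging is injective. -/
theorem card_face_sum :
    Nat.card (O.Face ⊕ {v : V // v ≠ O.source ∧ v ≠ O.sink}) = Nat.card E := by
  classical
  have : Finite O.Face := Quotient.finite _
  have h1 := O.euler
  have h2 : Nat.card {v : V // v ≠ O.source ∧ v ≠ O.sink} + 2 = Nat.card V := by
    rw [Nat.card_eq_fintype_card, Nat.card_eq_fintype_card, Fintype.card_subtype]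
    have h3 : (Finset.univ.filter fun v : V => v ≠ O.source ∧ v ≠ O.sink) =
        Finset.univ \ {O.source, O.sink} := by ext v; simp
    rw [h3, Finset.card_sdiff_of_subset (Finset.subset_univ _), Finset.card_pair O.source_ne_sink]
    have := Finset.card_le_card (Finset.subset_univ {O.source, O.sink})
    rw [Finset.card_pair O.source_ne_sink, Finset.card_univ] at this
    rw [Finset.card_univ]
    omega
  rw [Nat.card_sum]
  omega

open Classical in
/-- The face, or the vertex, to which the corner that follows the initial end of `e` is charged. -/
noncomputable def outCharge (e : E) : O.Face ⊕ {v : V // v ≠ O.source ∧ v ≠ O.sink} :=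
  if h : ∃ f, O.rot (Sum.inl e) = Sum.inr f then
    Sum.inr ⟨O.src e, by
      obtain ⟨f, hf⟩ := h
      have := O.vert_rot (Sum.inl e)
      rw [hf] at this
      rw [← show O.tgt f = O.src e from this]
      exact O.tgt_ne_source f, O.src_ne_sink e⟩
  else Sum.inl (O.face (Sum.inl e))

open Classical in
/-- The face, or the vertex, to which the corner that follows the final end of `e` is charged. -/
noncomputable def inCharge (e : E) : O.Face ⊕ {v : V // v ≠ O.source ∧ v ≠ O.sink} :=
  if h : ∃ f, O.rot (Sum.inr e) = Sum.inl f then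
    Sum.inr ⟨O.tgt e, O.tgt_ne_source e, by
      obtain ⟨f, hf⟩ := h
      have := O.vert_rot (Sum.inr e)
      rw [hf] at this
      rw [← show O.src f = O.tgt e from this]
      exact O.src_ne_sink f⟩
  else Sum.inl (O.face (Sum.inr e))

theorem exists_right_corner {v : V} (hs : v ≠ O.source) (ht : v ≠ O.sink) :
    ∃ e f, O.rot (Sum.inl e) = Sum.inr f ∧ O.src e = v := by
  obtain ⟨a, ha⟩ := O.exists_src ht
  obtain ⟨b, hb⟩ := O.exists_tgt hs
  have h : O.rot.SameCycle (Sum.inl a) (Sum.inr b) := O.sameCycle_of_vert (ha.trans hb.symm)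
  obtain ⟨c, h1, h2, h3⟩ := h.exists_exit (P := fun d => d.isLeft = true) rfl (by simp)
  rcases c with c | c
  · cases h4 : O.rot (Sum.inl c) with
    | inl f => simp [h4] at h3
    | inr f => exact ⟨c, f, h4, (O.vert_of_sameCycle h1).symm.trans ha⟩
  · simp at h2

theorem exists_left_corner {v : V} (hs : v ≠ O.source) (ht : v ≠ O.sink) :
    ∃ e f, O.rot (Sum.inr e) = Sum.inl f ∧ O.tgt e = v := by
  obtain ⟨a, ha⟩ := O.exists_src ht
  obtain ⟨b, hb⟩ := O.exists_tgt hs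
  have h : O.rot.SameCycle (Sum.inr b) (Sum.inl a) := O.sameCycle_of_vert (hb.trans ha.symm)
  obtain ⟨c, h1, h2, h3⟩ := h.exists_exit (P := fun d => d.isRight = true) rfl (by simp)
  rcases c with c | c
  · simp at h2
  · cases h4 : O.rot (Sum.inr c) with
    | inr f => simp [h4] at h3
    | inl f => exact ⟨c, f, h4, (O.vert_of_sameCycle h1).symm.trans hb⟩

/-- Surjectivity is what the geometry provides: climbing and descending the borders yields a corner
for each face, and the passage from outgoing to ingoing darts yields one for each inner vertex.
Counting does the rest. -/
theorem outCharge_injective : Function.Injective O.outCharge := by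
  have : Finite O.Face := Quotient.finite _
  refine (Function.Surjective.bijective_of_nat_card_le ?_ O.card_face_sum.ge).1
  rintro (F | ⟨v, hs, ht⟩)
  · obtain ⟨c, d, h, h'⟩ := O.exists_source_corner F
    exact ⟨c, by simp [outCharge, h, h']⟩
  · obtain ⟨e, f, h, h'⟩ := O.exists_right_corner hs ht
    exact ⟨e, by simp [outCharge, h, h']⟩

theorem inCharge_injective : Function.Injective O.inCharge := by
  have : Finite O.Face := Quotient.finite _
  refine (Function.Surjective.bijective_of_nat_card_le ?_ O.card_face_sum.ge).1
  rintro (F | ⟨v, hs, ht⟩)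
  · obtain ⟨c, d, h, h'⟩ := O.exists_sink_corner F
    exact ⟨c, by simp [inCharge, h, h']⟩
  · obtain ⟨e, f, h, h'⟩ := O.exists_left_corner hs ht
    exact ⟨e, by simp [inCharge, h, h']⟩

theorem source_corner_unique {c d c' d' : E} (h : O.rot (Sum.inl c) = Sum.inl d)
    (h' : O.rot (Sum.inl c') = Sum.inl d') (hf : O.face (Sum.inl c) = O.face (Sum.inl c')) :
    c = c' := by
  apply O.outCharge_injective; simp [outCharge, h, h', hf]

theorem sink_corner_unique {c d c' d' : E} (h : O.rot (Sum.inr c) = Sum.inr d)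
    (h' : O.rot (Sum.inr c') = Sum.inr d') (hf : O.face (Sum.inr c) = O.face (Sum.inr c')) :
    c = c' := by
  apply O.inCharge_injective; simp [inCharge, h, h', hf]

theorem right_corner_unique {c d c' d' : E} (h : O.rot (Sum.inl c) = Sum.inr d)
    (h' : O.rot (Sum.inl c') = Sum.inr d') (hv : O.src c = O.src c') : c = c' := by
  apply O.outCharge_injective; simp [outCharge, h, h', hv]

theorem left_corner_unique {c d c' d' : E} (h : O.rot (Sum.inr c) = Sum.inl d)
    (h' : O.rot (Sum.inr c') = Sum.inl d') (hv : O.tgt c = O.tgt c') : c = c' := by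
  apply O.inCharge_injective; simp [inCharge, h, h', hv]

theorem rot_inl_of_src_source {e : E} (h : O.src e = O.source) :
    ∃ f, O.rot (Sum.inl e) = Sum.inl f := by
  cases h' : O.rot (Sum.inl e) with
  | inl f => exact ⟨f, rfl⟩
  | inr f =>
    have := O.vert_rot (Sum.inl e)
    rw [h'] at this
    exact absurd ((this : O.tgt f = O.src e).trans h) (O.tgt_ne_source f)

theorem rot_inr_of_tgt_sink {e : E} (h : O.tgt e = O.sink) :
    ∃ f, O.rot (Sum.inr e) = Sum.inr f := by
  cases h' : O.rot (Sum.inr e) with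
  | inr f => exact ⟨f, rfl⟩
  | inl f =>
    have := O.vert_rot (Sum.inr e)
    rw [h'] at this
    exact absurd ((this : O.src f = O.tgt e).trans h) (O.src_ne_sink f)

theorem exists_outer_source : ∃ e, O.src e = O.source ∧ O.face (Sum.inl e) = O.outer := by
  obtain ⟨d | d, h1, h2⟩ := O.source_outer
  · exact ⟨d, h1, h2⟩
  · exact absurd h1 (O.tgt_ne_source d)

theorem exists_outer_sink : ∃ e, O.tgt e = O.sink ∧ O.face (Sum.inr e) = O.outer := by
  obtain ⟨d | d, h1, h2⟩ := O.sink_outer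
  · exact absurd h1 (O.src_ne_sink d)
  · exact ⟨d, h1, h2⟩

/-- The outer face already has a corner of this kind at the source, and a face has only one. -/
theorem src_of_source_corner_outer {c d : E} (h : O.rot (Sum.inl c) = Sum.inl d)
    (hf : O.face (Sum.inl c) = O.outer) : O.src c = O.source := by
  obtain ⟨e, he, he'⟩ := O.exists_outer_source
  obtain ⟨f, hf'⟩ := O.rot_inl_of_src_source he
  rwa [O.source_corner_unique h hf' (hf.trans he'.symm)]

theorem tgt_of_sink_corner_outer {c d : E} (h : O.rot (Sum.inr c) = Sum.inr d)
    (hf : O.face (Sum.inr c) = O.outer) : O.tgt c = O.sink := by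
  obtain ⟨e, he, he'⟩ := O.exists_outer_sink
  obtain ⟨f, hf'⟩ := O.rot_inr_of_tgt_sink he
  rwa [O.sink_corner_unique h hf' (hf.trans he'.symm)]

/-- `a` and `b` are ingoing edges of the same vertex, and `b` comes immediately to the right of
`a`. -/
def NextIncoming (a b : E) : Prop :=
  O.rot (Sum.inr b) = Sum.inr a ∧ (O.tgt b = O.sink → O.leftFace b ≠ O.outer)

/-- Away from the source, the outer face has no corner between outgoing darts, so the proviso on the
origin can be dropped and all vertices are treated alike. -/
theorem nextOutgoing_iff {a b : E} :
    O.NextOutgoing a b ↔ O.rot (Sum.inl a) = Sum.inl b ∧ O.face (Sum.inl a) ≠ O.outer := by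
  refine and_congr_right fun h => ⟨fun h' hf => ?_, fun h' _ => h'⟩
  exact h' (O.src_of_source_corner_outer h hf) hf

theorem nextIncoming_iff {a b : E} :
    O.NextIncoming a b ↔ O.rot (Sum.inr b) = Sum.inr a ∧ O.face (Sum.inr b) ≠ O.outer := by
  refine and_congr_right fun h => ⟨fun h' hf => ?_, fun h' _ => h'⟩
  exact h' (O.tgt_of_sink_corner_outer h hf) hf

theorem nextOutgoing_right_unique : Relator.RightUnique O.NextOutgoing := fun _ _ _ h h' =>
  Sum.inl_injective (h.1.symm.trans h'.1)

theorem nextOutgoing_left_unique : Relator.LeftUnique O.NextOutgoing := fun _ _ _ h h' =>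
  Sum.inl_injective (O.rot.injective (h.1.trans h'.1.symm))

theorem nextIncoming_right_unique : Relator.RightUnique O.NextIncoming := fun _ _ _ h h' =>
  Sum.inr_injective (O.rot.injective (h.1.trans h'.1.symm))

theorem nextIncoming_left_unique : Relator.LeftUnique O.NextIncoming := fun _ _ _ h h' =>
  Sum.inr_injective (h.1.symm.trans h'.1)

theorem nextOutgoing_src {a b : E} (h : O.NextOutgoing a b) : O.src a = O.src b := by
  have := O.vert_rot (Sum.inl a); rw [h.1] at this; exact this.symm

theorem nextIncoming_tgt {a b : E} (h : O.NextIncoming a b) : O.tgt a = O.tgt b := by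
  have := O.vert_rot (Sum.inr b); rw [h.1] at this; exact this

theorem exists_last_outgoing {v : V} (hv : v ≠ O.sink) : ∃ m, O.src m = v ∧
    (∀ b, ¬ O.NextOutgoing m b) ∧ ∀ a, O.src a = v → ReflTransGen O.NextOutgoing a m := by
  have key : ∀ m, O.src m = v → (∀ b, ¬ O.NextOutgoing m b) →
      (∀ a, O.src a = v → a ≠ m → ∃ b, O.NextOutgoing a b) →
      ∀ a, O.src a = v → ReflTransGen O.NextOutgoing a m := by
    intro m hm h1 h2 a ha
    have h3 := Equiv.Perm.reflTransGen_of_sameCycle (σ := O.rot) (i := (Sum.inl : E → E ⊕ E))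
      Sum.inl_injective (m := m) (fun a ha ham => by
        obtain ⟨b, hb⟩ := h2 a ((O.vert_of_sameCycle ha).trans hm) ham
        exact ⟨b, hb.1⟩) (a := a) (O.sameCycle_of_vert (ha.trans hm.symm))
    clear h1
    induction h3 using ReflTransGen.head_induction_on with
    | refl => exact ReflTransGen.refl
    | @head a c hac _ ih =>
      obtain ⟨b, hb⟩ := h2 a ha hac.2
      obtain rfl : b = c := Sum.inl_injective (hb.1.symm.trans hac.1)
      exact ReflTransGen.head hb (ih ((O.nextOutgoing_src hb).symm.trans ha))
  -- The cut is at the outer corner for the source, and at the corner leading to an ingoing dart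
  -- elsewhere. Uniqueness of that corner makes every other outgoing edge have a successor.
  by_cases hs : v = O.source
  · obtain ⟨m, hm, hm'⟩ := O.exists_outer_source
    refine ⟨m, hm.trans hs.symm, fun b hb => (O.nextOutgoing_iff.1 hb).2 hm',
      key m (hm.trans hs.symm) (fun b hb => (O.nextOutgoing_iff.1 hb).2 hm') fun a ha ham => ?_⟩
    obtain ⟨b, hb⟩ := O.rot_inl_of_src_source (ha.trans hs)
    obtain ⟨b', hb'⟩ := O.rot_inl_of_src_source hm
    exact ⟨b, O.nextOutgoing_iff.2 ⟨hb, fun h => ham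
      (O.source_corner_unique hb hb' (h.trans hm'.symm))⟩⟩
  · obtain ⟨m, f, hf, hm⟩ := O.exists_right_corner hs hv
    have h1 : ∀ b, ¬ O.NextOutgoing m b := fun b hb => by simpa using hf.symm.trans hb.1
    refine ⟨m, hm, h1, key m hm h1 fun a ha ham => ?_⟩
    cases h : O.rot (Sum.inl a) with
    | inl b => exact ⟨b, h, fun h' => absurd (ha.symm.trans h') hs⟩
    | inr b => exact absurd (O.right_corner_unique h hf (ha.trans hm.symm)) ham

theorem exists_first_incoming {v : V} (hv : v ≠ O.source) : ∃ m, O.tgt m = v ∧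
    (∀ b, ¬ O.NextIncoming b m) ∧ ∀ a, O.tgt a = v → ReflTransGen O.NextIncoming m a := by
  have key : ∀ m, O.tgt m = v → 
      (∀ a, O.tgt a = v → a ≠ m → ∃ b, O.NextIncoming b a) →
      ∀ a, O.tgt a = v → ReflTransGen O.NextIncoming m a := by
    intro m hm h2 a ha
    have h3 := Equiv.Perm.reflTransGen_of_sameCycle (σ := O.rot) (i := (Sum.inr : E → E ⊕ E))
      Sum.inr_injective (m := m) (fun a ha ham => by
        obtain ⟨b, hb⟩ := h2 a ((O.vert_of_sameCycle ha).trans hm) ham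
        exact ⟨b, hb.1⟩) (a := a) (O.sameCycle_of_vert (ha.trans hm.symm))
    induction h3 using ReflTransGen.head_induction_on with
    | refl => exact ReflTransGen.refl
    | @head a c hac _ ih =>
      obtain ⟨b, hb⟩ := h2 a ha hac.2
      obtain rfl : b = c := Sum.inr_injective (hb.1.symm.trans hac.1)
      exact ReflTransGen.tail (ih ((O.nextIncoming_tgt hb).trans ha)) hb
  by_cases hs : v = O.sink
  · obtain ⟨m, hm, hm'⟩ := O.exists_outer_sink
    refine ⟨m, hm.trans hs.symm, fun b hb => (O.nextIncoming_iff.1 hb).2 hm',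
      key m (hm.trans hs.symm) fun a ha ham => ?_⟩
    obtain ⟨b, hb⟩ := O.rot_inr_of_tgt_sink (ha.trans hs)
    obtain ⟨b', hb'⟩ := O.rot_inr_of_tgt_sink hm
    exact ⟨b, O.nextIncoming_iff.2 ⟨hb, fun h => ham
      (O.sink_corner_unique hb hb' (h.trans hm'.symm))⟩⟩
  · obtain ⟨m, f, hf, hm⟩ := O.exists_left_corner hv hs
    have h1 : ∀ b, ¬ O.NextIncoming b m := fun b hb => by simpa using hf.symm.trans hb.1
    refine ⟨m, hm, h1, key m hm fun a ha ham => ?_⟩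
    cases h : O.rot (Sum.inr a) with
    | inr b => exact ⟨b, h, fun h' => absurd (ha.symm.trans h') hs⟩
    | inl b => exact absurd (O.left_corner_unique h hf (ha.trans hm.symm)) ham

theorem right_border_of_rot {c e : E}
    (h : ReflTransGen (fun p q => O.rot (Sum.inl q) = Sum.inr p) c e) :
    ReflTransGen (fun p q => O.tgt p = O.src q ∧ (∀ r, ¬ O.NextIncoming p r) ∧
      (∀ r, ¬ O.NextOutgoing q r)) c e := by
  refine ReflTransGen.mono (fun p q hpq => ⟨?_, fun r hr => ?_, fun r hr => ?_⟩) _ _ h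
  · have := O.vert_rot (Sum.inl q); rw [hpq] at this; exact this
  · simpa using O.rot.injective (hpq.trans hr.1.symm)
  · simpa using hpq.symm.trans hr.1

theorem left_border_of_rot {d e : E}
    (h : ReflTransGen (fun p q => O.rot (Sum.inr p) = Sum.inl q) d e) :
    ReflTransGen (fun p q => O.tgt p = O.src q ∧ (∀ r, ¬ O.NextIncoming r p) ∧
      (∀ r, ¬ O.NextOutgoing r q)) d e := by
  refine ReflTransGen.mono (fun p q hpq => ⟨?_, fun r hr => ?_, fun r hr => ?_⟩) _ _ h
  · have := O.vert_rot (Sum.inr p); rw [hpq] at this; exact this.symm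
  · simpa using hpq.symm.trans hr.1
  · simpa using O.rot.injective (hpq.trans hr.1.symm)

/-- The core of a plane bipolar orientation. -/
def core : BipolarCore V E where
  src := O.src
  tgt := O.tgt
  s := O.source
  t := O.sink
  nxo := O.NextOutgoing
  nxi := O.NextIncoming
  acyclic := O.acyclic
  s_ne_t := O.source_ne_sink
  tgt_ne := O.tgt_ne_source
  src_ne := O.src_ne_sink
  exists_in _ h := O.exists_tgt h
  exists_out _ h := O.exists_src h
  nxo_src := O.nextOutgoing_src
  nxo_right_unique := O.nextOutgoing_right_unique
  nxo_left_unique := O.nextOutgoing_left_unique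
  nxo_total {a b} h := by
    obtain ⟨m, -, -, hm⟩ := O.exists_last_outgoing (O.src_ne_sink a)
    exact total_of_terminal O.nextOutgoing_left_unique (hm a rfl) (hm b h.symm)
  nxo_irrefl a := by
    obtain ⟨m, -, hm, hm'⟩ := O.exists_last_outgoing (O.src_ne_sink a)
    exact not_transGen_self_of_terminal O.nextOutgoing_right_unique hm (hm' a rfl)
  nxi_tgt := O.nextIncoming_tgt
  nxi_right_unique := O.nextIncoming_right_unique
  nxi_left_unique := O.nextIncoming_left_unique
  nxi_total {a b} h := by
    obtain ⟨m, -, -, hm⟩ := O.exists_first_incoming (O.tgt_ne_source a)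
    have := total_of_terminal (r := Function.swap O.NextIncoming) 
      (fun _ _ _ h h' => O.nextIncoming_right_unique h h')
      (reflTransGen_swap.2 (hm a rfl)) (reflTransGen_swap.2 (hm b h.symm))
    rcases this with h | h | h
    · exact Or.inl h
    · exact Or.inr (Or.inr (transGen_swap.1 h))
    · exact Or.inr (Or.inl (transGen_swap.1 h))
  nxi_irrefl a := by
    obtain ⟨m, -, hm, hm'⟩ := O.exists_first_incoming (O.tgt_ne_source a)
    rw [← transGen_swap]
    exact not_transGen_self_of_terminal (r := Function.swap O.NextIncoming)
      (fun _ _ _ h h' => O.nextIncoming_left_unique h h') hm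
      (reflTransGen_swap.2 (hm' a rfl))
  face_of_nxo {c d} h := by
    obtain ⟨h, h'⟩ := O.nextOutgoing_iff.1 h
    obtain ⟨e, e', h1, h2, h3⟩ := O.exists_top_corner c
    obtain ⟨d', c', h4, h5, h6⟩ := O.exists_bottom_corner e'
    -- Climbing the left border and then descending the right one stays in the same face, so the
    -- lowest corner reached is the initial one.
    obtain rfl := O.source_corner_unique h h4 (h2.symm.trans h5.symm)
    obtain rfl : d = d' := Sum.inl_injective (h.symm.trans h4)
    exact ⟨e, e', O.nextIncoming_iff.2 ⟨h1, h2 ▸ h'⟩, O.right_border_of_rot h3,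
      O.left_border_of_rot h6⟩
  face_of_nxi {e e'} h := by
    obtain ⟨h, h'⟩ := O.nextIncoming_iff.1 h
    obtain ⟨d, c, h4, h5, h6⟩ := O.exists_bottom_corner e'
    obtain ⟨f, f', h1, h2, h3⟩ := O.exists_top_corner c
    obtain rfl := O.sink_corner_unique h h1 (h5.symm.trans h2.symm)
    obtain rfl : e = f := Sum.inr_injective (h.symm.trans h1)
    exact ⟨c, d, O.nextOutgoing_iff.2 ⟨h4, h5 ▸ h'⟩, O.right_border_of_rot h3,
      O.left_border_of_rot h6⟩

theorem isFirstIncoming_iff (e : E) : O.IsFirstIncoming e ↔ ∀ r, ¬ O.NextIncoming e r := by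
  by_cases ht : O.tgt e = O.sink
  · simp only [IsFirstIncoming, ht, ne_eq, not_true_eq_false, false_and, true_and, false_or]
    constructor
    · intro h r hr
      obtain ⟨h1, h2⟩ := O.nextIncoming_iff.1 hr
      exact h2 ((O.face_inr_of_rot_inr_inr h1).symm.trans h)
    · intro h
      cases h' : O.rot.symm (Sum.inr e) with
      | inl q =>
        have h'' : O.rot (Sum.inl q) = Sum.inr e := by rw [← h']; simp
        have := O.vert_rot (Sum.inl q)
        rw [h''] at this
        exact absurd ((this : O.tgt e = O.src q).symm.trans ht) (O.src_ne_sink q)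
      | inr q =>
        have h'' : O.rot (Sum.inr q) = Sum.inr e := by rw [← h']; simp
        have h3 := h q
        rw [O.nextIncoming_iff] at h3
        by_contra hc
        exact h3 ⟨h'', fun hf => hc ((O.face_inr_of_rot_inr_inr h'').trans hf)⟩
  · simp only [IsFirstIncoming, ht, ne_eq, not_false_eq_true, true_and, false_and, or_false]
    constructor
    · rintro ⟨q, hq⟩ r hr
      simpa using O.rot.injective (hq.trans hr.1.symm)
    · intro h
      cases h' : O.rot.symm (Sum.inr e) with
      | inl q => exact ⟨q, by rw [← h']; simp⟩
      | inr q =>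
        have h'' : O.rot (Sum.inr q) = Sum.inr e := by rw [← h']; simp
        have hv := O.vert_rot (Sum.inr q)
        rw [h''] at hv
        exact absurd ⟨h'', fun hs => absurd ((hv : O.tgt e = O.tgt q).trans hs) ht⟩ (h q)

theorem isLastIncoming_iff (e : E) : O.IsLastIncoming e ↔ ∀ r, ¬ O.NextIncoming r e := by
  by_cases ht : O.tgt e = O.sink
  · simp only [IsLastIncoming, ht, ne_eq, not_true_eq_false, false_and, true_and, false_or]
    constructor
    · intro h r hr
      exact (O.nextIncoming_iff.1 hr).2 h
    · intro h
      obtain ⟨f, hf⟩ := O.rot_inr_of_tgt_sink ht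
      by_contra hc
      exact h f ⟨hf, fun _ => hc⟩
  · simp only [IsLastIncoming, ht, ne_eq, not_false_eq_true, true_and, false_and, or_false]
    constructor
    · rintro ⟨q, hq⟩ r hr
      simpa using hq.symm.trans hr.1
    · intro h
      cases h' : O.rot (Sum.inr e) with
      | inl q => exact ⟨q, rfl⟩
      | inr q => exact absurd ⟨h', fun hs => absurd hs ht⟩ (h q)

end PlaneBipolarOrientation


open Relation

/-! ## Ranks in finite strict total orders -/

section Rank

variable {α : Type*} [Finite α] {r : α → α → Prop}

theorem ncard_rank_lt (ht : ∀ {a b c}, r a b → r b c → r a c) (hi : ∀ a, ¬ r a a) {a b : α}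
    (h : r a b) : Set.ncard {x | r x a} < Set.ncard {x | r x b} := by
  refine Set.ncard_lt_ncard ⟨fun x hx => ht hx h, fun hs => hi a (hs h)⟩ (Set.toFinite _)

theorem ncard_rank_succ (hi : ∀ a, ¬ r a a) {p q : α} (h : ∀ a, r a q ↔ r a p ∨ a = p) :
    Set.ncard {x | r x q} = Set.ncard {x | r x p} + 1 := by
  have : {x | r x q} = insert p {x | r x p} := by
    ext x; simp only [Set.mem_ofPred_eq, h, Set.mem_insert_iff]; tauto
  rw [this, Set.ncard_insert_of_notMem (by simpa using hi p) (Set.toFinite _)]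

theorem ncard_rank_lt_card (hi : ∀ a, ¬ r a a) (a : α) :
    Set.ncard {x | r x a} < Nat.card α := by
  rw [← Set.ncard_univ]
  exact Set.ncard_lt_ncard ⟨Set.subset_univ _, fun h => hi a (h (Set.mem_univ a))⟩ (Set.toFinite _)

theorem exists_ncard_rank_eq (ht : ∀ {a b c}, r a b → r b c → r a c) (hi : ∀ a, ¬ r a a)
    (htot : ∀ a b, a = b ∨ r a b ∨ r b a) {k : ℕ} (hk : k < Nat.card α) :
    ∃ a, Set.ncard {x | r x a} = k := by
  let f : α → Fin (Nat.card α) := fun a => ⟨_, ncard_rank_lt_card hi a⟩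
  have hf : Function.Injective f := by
    intro a b hab
    have hab' : Set.ncard {x | r x a} = Set.ncard {x | r x b} := congrArg Fin.val hab
    rcases htot a b with h | h | h
    · exact h
    · exact absurd hab' (ncard_rank_lt @ht hi h).ne
    · exact absurd hab' (ncard_rank_lt @ht hi h).ne'
  have hb : Function.Bijective f :=
    (Nat.bijective_iff_injective_and_card f).2 ⟨hf, by simp⟩
  obtain ⟨a, ha⟩ := hb.2 ⟨k, hk⟩
  exact ⟨a, congrArg Fin.val ha⟩

end Rank

theorem Relation.exists_terminal {α : Type*} [Finite α] {r : α → α → Prop}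
    (hi : ∀ a, ¬ TransGen r a a) (a : α) : ∃ m, ReflTransGen r a m ∧ ∀ b, ¬ r m b := by
  have : IsTrans α (Function.swap (TransGen r)) := ⟨fun _ _ _ h h' => TransGen.trans h' h⟩
  have : Std.Irrefl (Function.swap (TransGen r)) := ⟨hi⟩
  have wf := Finite.wellFounded_of_trans_of_irrefl (Function.swap (TransGen r))
  induction a using wf.induction with
  | _ a ih =>
    by_cases h : ∃ b, r a b
    · obtain ⟨b, hb⟩ := h
      obtain ⟨m, h1, h2⟩ := ih b (TransGen.single hb)
      exact ⟨m, h1.head hb, h2⟩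
    · push Not at h
      exact ⟨a, ReflTransGen.refl, h⟩

/-! ### The tree `T_x` on edges, its prefix order and its ranks. -/

namespace BipolarCore

variable {V E : Type*} (C : BipolarCore V E)

/-- The image of a core under a reflection that exchanges left and right. -/
def mirror : BipolarCore V E where
  src := C.src
  tgt := C.tgt
  s := C.s
  t := C.t
  nxo a b := C.nxo b a
  nxi a b := C.nxi b a
  acyclic := C.acyclic
  s_ne_t := C.s_ne_t
  tgt_ne := C.tgt_ne
  src_ne := C.src_ne
  exists_in := C.exists_in
  exists_out := C.exists_out
  nxo_src h := (C.nxo_src h).symm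
  nxo_right_unique _ _ _ h h' := C.nxo_left_unique h h'
  nxo_left_unique _ _ _ h h' := C.nxo_right_unique h h'
  nxo_total h := by
    rcases C.nxo_total h with h | h | h
    · exact Or.inl h
    · exact Or.inr (Or.inr (transGen_swap.2 h))
    · exact Or.inr (Or.inl (transGen_swap.2 h))
  nxo_irrefl a h := C.nxo_irrefl a (transGen_swap.1 h)
  nxi_tgt h := (C.nxi_tgt h).symm
  nxi_right_unique _ _ _ h h' := C.nxi_left_unique h h'
  nxi_left_unique _ _ _ h h' := C.nxi_right_unique h h'
  nxi_total h := by
    rcases C.nxi_total h with h | h | h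
    · exact Or.inl h
    · exact Or.inr (Or.inr (transGen_swap.2 h))
    · exact Or.inr (Or.inl (transGen_swap.2 h))
  nxi_irrefl a h := C.nxi_irrefl a (transGen_swap.1 h)
  face_of_nxo h := by
    obtain ⟨e, e', h1, h2, h3⟩ := C.face_of_nxo h
    exact ⟨e', e, h1, h3, h2⟩
  face_of_nxi h := by
    obtain ⟨c, d, h1, h2, h3⟩ := C.face_of_nxi h
    exact ⟨d, c, h1, h3, h2⟩

/-- The rightmost ingoing edges. -/
def IsRI (e : E) : Prop := ∀ r, ¬ C.nxi e r

/-- The leftmost ingoing edges. -/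
def IsLI (e : E) : Prop := ∀ r, ¬ C.nxi r e

/-- The rightmost outgoing edges. -/
def IsRO (e : E) : Prop := ∀ r, ¬ C.nxo e r

/-- The leftmost outgoing edges. -/
def IsLO (e : E) : Prop := ∀ r, ¬ C.nxo r e

/-- `p` and `q` are consecutive edges of the left border of a face. -/
def RightStep (p q : E) : Prop := C.tgt p = C.src q ∧ C.IsRI p ∧ C.IsRO q

/-- `p` and `q` are consecutive edges of the right border of a face. -/
def LeftStep (p q : E) : Prop := C.tgt p = C.src q ∧ C.IsLI p ∧ C.IsLO q

/-- There is an edge from `u` to `v`. -/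
def Arc (u v : V) : Prop := ∃ e, C.src e = u ∧ C.tgt e = v

theorem exists_face_of_nxo {c d : E} (h : C.nxo c d) : ∃ e e', C.nxi e e' ∧
    ReflTransGen C.RightStep c e ∧ ReflTransGen C.LeftStep d e' := C.face_of_nxo h

theorem exists_face_of_nxi {e e' : E} (h : C.nxi e e') : ∃ c d, C.nxo c d ∧
    ReflTransGen C.RightStep c e ∧ ReflTransGen C.LeftStep d e' := C.face_of_nxi h

variable {C}

theorem src_eq_of_transGen_nxo {a b : E} (h : TransGen C.nxo a b) : C.src a = C.src b := by
  induction h with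
  | single h => exact C.nxo_src h
  | tail _ h ih => exact ih.trans (C.nxo_src h)

theorem tgt_eq_of_transGen_nxi {a b : E} (h : TransGen C.nxi a b) : C.tgt a = C.tgt b := by
  induction h with
  | single h => exact C.nxi_tgt h
  | tail _ h ih => exact ih.trans (C.nxi_tgt h)

theorem IsRI.not_transGen {a b : E} (ha : C.IsRI a) : ¬ TransGen C.nxi a b := fun h => by
  obtain ⟨c, hc, -⟩ := TransGen.head'_iff.1 h
  exact ha _ hc

theorem IsLI.not_transGen {a b : E} (ha : C.IsLI a) : ¬ TransGen C.nxi b a := fun h => by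
  obtain ⟨c, -, hc⟩ := TransGen.tail'_iff.1 h
  exact ha _ hc

theorem IsRO.not_transGen {a b : E} (ha : C.IsRO a) : ¬ TransGen C.nxo a b := fun h => by
  obtain ⟨c, hc, -⟩ := TransGen.head'_iff.1 h
  exact ha _ hc

theorem IsLO.not_transGen {a b : E} (ha : C.IsLO a) : ¬ TransGen C.nxo b a := fun h => by
  obtain ⟨c, -, hc⟩ := TransGen.tail'_iff.1 h
  exact ha _ hc

theorem IsRI.eq {a b : E} (ha : C.IsRI a) (hb : C.IsRI b) (h : C.tgt a = C.tgt b) : a = b := by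
  rcases C.nxi_total h with h | h | h
  · exact h
  · exact absurd h ha.not_transGen
  · exact absurd h hb.not_transGen

theorem IsRI.reflTransGen {a m : E} (hm : C.IsRI m) (h : C.tgt a = C.tgt m) :
    ReflTransGen C.nxi a m := by
  rcases C.nxi_total h with h | h | h
  · rw [h]
  · exact h.to_reflTransGen
  · exact absurd h hm.not_transGen

theorem IsLO.reflTransGen {a m : E} (hm : C.IsLO m) (h : C.src a = C.src m) :
    ReflTransGen C.nxo m a := by
  rcases C.nxo_total h with h | h | h
  · rw [h]
  · exact absurd h hm.not_transGen
  · exact h.to_reflTransGen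

variable (C)

/-- The edge `p` is the parent of the edge `e` in the tree `T_x`. -/
def TreeStep (p e : E) : Prop := C.tgt p = C.src e ∧ C.IsRI p

/-- The prefix order of the tree `T_x`. -/
def Pre (a b : E) : Prop := TransGen C.TreeStep a b ∨
  ∃ c d, TransGen C.nxo c d ∧ ReflTransGen C.TreeStep c a ∧ ReflTransGen C.TreeStep d b

variable {C}

theorem transGen_arc_of_treeStep {a b : E} (h : TransGen C.TreeStep a b) :
    TransGen C.Arc (C.src a) (C.src b) := by
  induction h with
  | single h => exact TransGen.single ⟨_, rfl, h.1⟩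
  | tail _ h ih => exact ih.tail ⟨_, rfl, h.1⟩

theorem not_transGen_treeStep_self (a : E) : ¬ TransGen C.TreeStep a a := fun h =>
  C.acyclic _ (transGen_arc_of_treeStep h)

theorem treeStep_left_unique : Relator.LeftUnique C.TreeStep := fun _ _ _ h h' =>
  h.2.eq h'.2 (h.1.trans h'.1.symm)

theorem transGen_treeStep_sibling {a c d : E} (h : TransGen C.TreeStep a c)
    (hs : C.src c = C.src d) : TransGen C.TreeStep a d := by
  obtain ⟨p, h1, h2⟩ := TransGen.tail'_iff.1 h
  exact TransGen.tail' h1 ⟨h2.1.trans hs, h2.2⟩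

theorem ancestors_total {a b c : E} (h : ReflTransGen C.TreeStep a c)
    (h' : ReflTransGen C.TreeStep b c) :
    a = b ∨ TransGen C.TreeStep a b ∨ TransGen C.TreeStep b a :=
  total_of_terminal treeStep_left_unique h h'

/-- Ancestors of a common edge are comparable, and a proper ancestor of an edge is a proper ancestor
of all its siblings. The cases compare the two branches that meet at `b`. -/
theorem Pre.trans {a b c : E} (h : C.Pre a b) (h' : C.Pre b c) : C.Pre a c := by
  rcases h with h | ⟨c1, d1, h1, h2, h3⟩ <;> rcases h' with h' | ⟨c2, d2, h1', h2', h3'⟩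
  · exact Or.inl (h.trans h')
  · rcases ancestors_total h.to_reflTransGen h2' with e | e | e
    · exact Or.inr ⟨c2, d2, h1', e ▸ ReflTransGen.refl, h3'⟩
    · exact Or.inl ((transGen_treeStep_sibling e (src_eq_of_transGen_nxo h1')).trans_left h3')
    · exact Or.inr ⟨c2, d2, h1', e.to_reflTransGen, h3'⟩
  · exact Or.inr ⟨c1, d1, h1, h2, h3.trans h'.to_reflTransGen⟩
  · rcases ancestors_total h3 h2' with e | e | e
    · exact Or.inr ⟨c1, d2, h1.trans (e ▸ h1'), h2, h3'⟩
    · exact Or.inr ⟨c1, d1, h1, h2,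
        ((transGen_treeStep_sibling e (src_eq_of_transGen_nxo h1')).trans_left h3').to_reflTransGen⟩
    · exact Or.inr ⟨c2, d2, h1', ((transGen_treeStep_sibling e
        (src_eq_of_transGen_nxo h1).symm).trans_left h2).to_reflTransGen, h3'⟩

theorem Pre.irrefl (a : E) : ¬ C.Pre a a := by
  rintro (h | ⟨c, d, h1, h2, h3⟩)
  · exact not_transGen_treeStep_self a h
  · have hs := src_eq_of_transGen_nxo h1
    rcases ancestors_total h2 h3 with e | e | e
    · exact C.nxo_irrefl d (e ▸ h1)
    · exact not_transGen_treeStep_self c (transGen_treeStep_sibling e hs.symm)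
    · exact not_transGen_treeStep_self d (transGen_treeStep_sibling e hs)

theorem Pre.asymm {a b : E} (h : C.Pre a b) : ¬ C.Pre b a := fun h' => Pre.irrefl a (h.trans h')

section Finite

variable [Finite E]

theorem exists_RI {v : V} (hv : v ≠ C.s) : ∃ p, C.tgt p = v ∧ C.IsRI p := by
  obtain ⟨e, he⟩ := C.exists_in v hv
  obtain ⟨m, h1, h2⟩ := exists_terminal C.nxi_irrefl e
  refine ⟨m, ?_, h2⟩
  rcases reflTransGen_iff_eq_or_transGen.1 h1 with h | h
  · rw [h, he]
  · rw [← tgt_eq_of_transGen_nxi h, he]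

theorem exists_LI {v : V} (hv : v ≠ C.s) : ∃ p, C.tgt p = v ∧ C.IsLI p :=
  exists_RI (C := C.mirror) hv

theorem exists_RO {v : V} (hv : v ≠ C.t) : ∃ p, C.src p = v ∧ C.IsRO p := by
  obtain ⟨e, he⟩ := C.exists_out v hv
  obtain ⟨m, h1, h2⟩ := exists_terminal C.nxo_irrefl e
  refine ⟨m, ?_, h2⟩
  rcases reflTransGen_iff_eq_or_transGen.1 h1 with h | h
  · rw [h, he]
  · rw [← src_eq_of_transGen_nxo h, he]

theorem exists_LO {v : V} (hv : v ≠ C.t) : ∃ p, C.src p = v ∧ C.IsLO p :=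
  exists_RO (C := C.mirror) hv

theorem wf_treeStep : WellFounded (TransGen C.TreeStep) := by
  have : IsTrans E (TransGen C.TreeStep) := ⟨fun _ _ _ h h' => TransGen.trans h h'⟩
  have : Std.Irrefl (TransGen C.TreeStep) := ⟨not_transGen_treeStep_self⟩
  exact Finite.wellFounded_of_trans_of_irrefl _

theorem wf_treeStep_swap : WellFounded (Function.swap (TransGen C.TreeStep)) := by
  have : IsTrans E (Function.swap (TransGen C.TreeStep)) := ⟨fun _ _ _ h h' => TransGen.trans h' h⟩
  have : Std.Irrefl (Function.swap (TransGen C.TreeStep)) := ⟨not_transGen_treeStep_self⟩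
  exact Finite.wellFounded_of_trans_of_irrefl _

theorem exists_root (a : E) : ∃ r, C.src r = C.s ∧ ReflTransGen C.TreeStep r a := by
  induction a using (wf_treeStep (C := C)).induction with
  | _ a ih =>
    by_cases h : C.src a = C.s
    · exact ⟨a, h, ReflTransGen.refl⟩
    · obtain ⟨p, h1, h2⟩ := exists_RI h
      obtain ⟨r, h3, h4⟩ := ih p (TransGen.single ⟨h1, h2⟩)
      exact ⟨r, h3, h4.tail ⟨h1, h2⟩⟩

theorem Pre.total (a b : E) : a = b ∨ C.Pre a b ∨ C.Pre b a := by
  have sib : ∀ {c d}, C.src c = C.src d → ReflTransGen C.TreeStep c a →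
      ReflTransGen C.TreeStep d b → c = d ∨ C.Pre a b ∨ C.Pre b a := by
    intro c d hs hc hd
    rcases C.nxo_total hs with h | h | h
    · exact Or.inl h
    · exact Or.inr (Or.inl (Or.inr ⟨c, d, h, hc, hd⟩))
    · exact Or.inr (Or.inr (Or.inr ⟨d, c, h, hd, hc⟩))
  -- Descends from a common ancestor `m`: the children of `m` towards `a` and `b` either coincide,
  -- and the descent goes on, or are distinct siblings that decide the order.
  have key : ∀ m, ReflTransGen C.TreeStep m a → ReflTransGen C.TreeStep m b →
      a = b ∨ C.Pre a b ∨ C.Pre b a := by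
    intro m
    induction m using (wf_treeStep_swap (C := C)).induction with
    | _ m ih =>
      intro ha hb
      rcases ReflTransGen.cases_head ha with rfl | ⟨c, h1, h2⟩
      · rcases reflTransGen_iff_eq_or_transGen.1 hb with h | h
        · exact Or.inl h.symm
        · exact Or.inr (Or.inl (Or.inl h))
      · rcases ReflTransGen.cases_head hb with rfl | ⟨d, h1', h2'⟩
        · exact Or.inr (Or.inr (Or.inl (TransGen.head' h1 h2)))
        · rcases sib (h1.1.symm.trans h1'.1) h2 h2' with rfl | h
          · exact ih c (TransGen.single h1) h2 h2'
          · exact Or.inr h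
  obtain ⟨r, hr, hra⟩ := exists_root (C := C) a
  obtain ⟨r', hr', hrb⟩ := exists_root (C := C) b
  rcases sib (hr.trans hr'.symm) hra hrb with rfl | h
  · exact key r hra hrb
  · exact Or.inr h

end Finite

theorem pre_of_nxo {c d : E} (h : C.nxo c d) : C.Pre c d :=
  Or.inr ⟨c, d, TransGen.single h, ReflTransGen.refl, ReflTransGen.refl⟩

/-- `q` is the first child of `p`, so nothing can be visited in between. -/
theorem pre_succ_vertex {p q : E} (hp : C.IsRI p) (hq : C.IsLO q) (h : C.tgt p = C.src q) (a : E) :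
    C.Pre a q ↔ C.Pre a p ∨ a = p := by
  have hpq : C.Pre p q := Or.inl (TransGen.single ⟨h, hp⟩)
  constructor
  · have anc : ∀ {d}, TransGen C.TreeStep d q → ReflTransGen C.TreeStep d p := by
      intro d hd
      obtain ⟨p', h1, h2⟩ := TransGen.tail'_iff.1 hd
      rwa [treeStep_left_unique ⟨h, hp⟩ h2]
    rintro (ha | ⟨c, d, h1, h2, h3⟩)
    · rcases reflTransGen_iff_eq_or_transGen.1 (anc ha) with h' | h'
      · exact Or.inr h'.symm
      · exact Or.inl (Or.inl h')
    · rcases reflTransGen_iff_eq_or_transGen.1 h3 with rfl | h'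
      · exact absurd h1 hq.not_transGen
      · exact Or.inl (Or.inr ⟨c, d, h1, h2, anc h'⟩)
  · rintro (ha | rfl)
    · exact ha.trans hpq
    · exact hpq

theorem rightStep_ancestor {c e : E} (h : ReflTransGen C.RightStep c e) :
    ReflTransGen C.TreeStep c e :=
  ReflTransGen.mono (fun _ _ h => ⟨h.1, h.2.1⟩) _ _ h

/-- The border from `c` to `e` is itself a branch of the tree, and each of its edges after `c` is
the last of its siblings. -/
theorem ancestor_of_rightStep {c e c1 : E} (h : ReflTransGen C.RightStep c e)
    (h1 : ReflTransGen C.TreeStep c1 e) : ReflTransGen C.TreeStep c1 c ∨ C.IsRO c1 := by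
  induction h with
  | refl => exact Or.inl h1
  | tail _ h ih =>
    rcases ReflTransGen.cases_tail h1 with rfl | ⟨p, h2, h3⟩
    · exact Or.inr h.2.2
    · obtain rfl := treeStep_left_unique h3 ⟨h.1, h.2.1⟩
      exact ih h2

/-- Having a right neighbour, `e` is a leaf of the tree; having only last siblings above it up to
`c`, it is the last descendant of `c`. The walk then moves to `d`, the sibling that follows `c`. -/
theorem pre_succ_face [Finite E] {c d e e' : E} (hcd : C.nxo c d) (he : C.nxi e e')
    (hce : ReflTransGen C.RightStep c e) (a : E) : C.Pre a d ↔ C.Pre a e ∨ a = e := by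
  have hed : C.Pre e d := Or.inr ⟨c, d, TransGen.single hcd, rightStep_ancestor hce,
    ReflTransGen.refl⟩
  constructor
  · intro ha
    rcases Pre.total (C := C) a e with h | h | h
    · exact Or.inr h
    · exact Or.inl h
    · exfalso
      rcases h with h | ⟨c1, d1, h1, h2, h3⟩
      · obtain ⟨q, hq, -⟩ := TransGen.head'_iff.1 h
        exact hq.2 _ he
      · rcases ancestor_of_rightStep hce h2 with h | h
        · rcases reflTransGen_iff_eq_or_transGen.1 h with rfl | h
          · obtain ⟨x, hx, hx'⟩ := TransGen.head'_iff.1 h1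
            obtain rfl := C.nxo_right_unique hcd hx
            rcases reflTransGen_iff_eq_or_transGen.1 hx' with rfl | hx'
            · rcases reflTransGen_iff_eq_or_transGen.1 h3 with rfl | h3
              · exact Pre.irrefl _ ha
              · exact ha.asymm (Or.inl h3)
            · exact ha.asymm (Or.inr ⟨_, _, hx', ReflTransGen.refl, h3⟩)
          · exact ha.asymm (Or.inr ⟨c1, d1, h1,
              (transGen_treeStep_sibling h (C.nxo_src hcd)).to_reflTransGen, h3⟩)
        · exact h.not_transGen h1
  · rintro (ha | rfl)
    · exact ha.trans hed
    · exact hed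

/-- The properties of the ranks of edges in the prefix order of `T_x`. -/
structure Labeling (C : BipolarCore V E) (X : E → ℕ) : Prop where
  injective : Function.Injective X
  pos : ∀ e, 1 ≤ X e
  le_card : ∀ e, X e ≤ Nat.card E
  surj : ∀ k, 1 ≤ k → k ≤ Nat.card E → ∃ e, X e = k
  succ_vertex : ∀ {p q}, C.IsRI p → C.IsLO q → C.tgt p = C.src q → X q = X p + 1
  succ_face : ∀ {c d e e'}, C.nxo c d → C.nxi e e' → ReflTransGen C.RightStep c e → X d = X e + 1
  nxo_lt : ∀ {c d}, C.nxo c d → X c < X d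
  first : ∀ {e}, C.IsLO e → C.src e = C.s → X e = 1
  last : ∀ {e}, C.IsRI e → C.tgt e = C.t → X e = Nat.card E

variable (C)

/-- The rank of an edge in the prefix order of `T_x`. -/
noncomputable def label (e : E) : ℕ := Set.ncard {a | C.Pre a e} + 1

theorem labeling_label [Finite E] : C.Labeling C.label := by
  have hlt : ∀ {a b}, C.Pre a b → C.label a < C.label b := fun h =>
    Nat.succ_lt_succ (ncard_rank_lt Pre.trans Pre.irrefl h)
  have hsv : ∀ {p q}, C.IsRI p → C.IsLO q → C.tgt p = C.src q → C.label q = C.label p + 1 :=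
    fun hp hq h => congrArg (· + 1) (ncard_rank_succ Pre.irrefl (pre_succ_vertex hp hq h))
  have hsf : ∀ {c d e e'}, C.nxo c d → C.nxi e e' → ReflTransGen C.RightStep c e →
      C.label d = C.label e + 1 :=
    fun hcd he hce => congrArg (· + 1) (ncard_rank_succ Pre.irrefl (pre_succ_face hcd he hce))
  have hle : ∀ e, C.label e ≤ Nat.card E := fun e => ncard_rank_lt_card Pre.irrefl e
  have hinj : Function.Injective C.label := by
    intro a b hab
    rcases Pre.total (C := C) a b with h | h | h
    · exact h
    · exact absurd hab (hlt h).ne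
    · exact absurd hab (hlt h).ne'
  have hsurj : ∀ k, 1 ≤ k → k ≤ Nat.card E → ∃ e, C.label e = k := by
    intro k h1 h2
    obtain ⟨a, ha⟩ := exists_ncard_rank_eq (k := k - 1) (r := C.Pre) Pre.trans Pre.irrefl
      Pre.total (by omega)
    exact ⟨a, by rw [label, ha]; omega⟩
  refine ⟨hinj, fun e => Nat.succ_pos _, hle, hsurj, hsv, hsf, fun h => hlt (pre_of_nxo h), ?_, ?_⟩
  · intro e he hs
    have : {a | C.Pre a e} = ∅ := by
      ext a
      simp only [Set.mem_ofPred_eq, Set.mem_empty_iff_false, iff_false]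
      have hanc : ∀ {d}, ¬ TransGen C.TreeStep d e := fun hd => by
        obtain ⟨p, -, hp⟩ := TransGen.tail'_iff.1 hd
        exact C.tgt_ne p (hp.1.trans hs)
      rintro (ha | ⟨c, d, h1, -, h3⟩)
      · exact hanc ha
      · rcases reflTransGen_iff_eq_or_transGen.1 h3 with rfl | h'
        · exact he.not_transGen h1
        · exact hanc h'
    rw [label, this, Set.ncard_empty]
  · intro e he ht
    have hcard : 1 ≤ Nat.card E := (Nat.succ_pos _).trans_le (hle e)
    obtain ⟨m, hm⟩ := hsurj _ hcard le_rfl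
    -- The edge of maximal rank can use neither successor rule: it is therefore a rightmost ingoing
    -- edge, and its endpoint has no outgoing edge.
    have hmRI : C.IsRI m := by
      intro m' hm'
      obtain ⟨c, d, h1, h2, -⟩ := C.exists_face_of_nxi hm'
      have := hsf h1 hm' h2
      have := hle d
      omega
    have hmt : C.tgt m = C.t := by
      by_contra hmt
      obtain ⟨q, h1, h2⟩ := exists_LO hmt
      have := hsv hmRI h2 h1.symm
      have := hle q
      omega
    rw [he.eq hmRI (ht.trans hmt.symm), hm]

end BipolarCore

/-! ### The labels of the bicolored trees as ranks in the core and its mirror. -/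

namespace PlaneBipolarOrientation

variable {V E : Type*} [Fintype V] [Fintype E] (O : PlaneBipolarOrientation V E)

theorem transGen_treeArc_iff {K : E → Prop} {a b : E} :
    TransGen (O.TreeArc K) (Sum.inr a) (Sum.inr b) ↔
      TransGen (fun p e => O.tgt p = O.src e ∧ K p) a b := by
  constructor
  -- The statement must also cover paths that end at a white vertex, which are halfway through a
  -- tree step.
  · have key : ∀ z, TransGen (O.TreeArc K) (Sum.inr a) z →
        Sum.elim (fun v => ∃ p, ReflTransGen (fun p e => O.tgt p = O.src e ∧ K p) a p ∧ K p ∧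
          O.tgt p = v) (fun b => TransGen (fun p e => O.tgt p = O.src e ∧ K p) a b) z := by
      intro z hz
      induction hz with
      | single h =>
        cases h with
        | inc _ h => exact ⟨a, ReflTransGen.refl, h, rfl⟩
      | tail _ h ih =>
        cases h with
        | out e =>
          obtain ⟨p, h1, h2, h3⟩ := ih
          exact TransGen.tail' h1 ⟨h3, h2⟩
        | inc e h => exact ⟨e, TransGen.to_reflTransGen ih, h, rfl⟩
    exact key _
  · have two : ∀ {p e}, O.tgt p = O.src e ∧ K p →
        TransGen (O.TreeArc K) (Sum.inr p) (Sum.inr e) := by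
      intro p e h
      refine TransGen.tail (TransGen.single (TreeArc.inc p h.2)) ?_
      rw [h.1]
      exact TreeArc.out e
    intro h
    induction h with
    | single h => exact two h
    | tail _ h ih => exact ih.trans (two h)

theorem reflTransGen_treeArc_iff {K : E → Prop} {a b : E} :
    ReflTransGen (O.TreeArc K) (Sum.inr a) (Sum.inr b) ↔
      ReflTransGen (fun p e => O.tgt p = O.src e ∧ K p) a b := by
  rw [reflTransGen_iff_eq_or_transGen, reflTransGen_iff_eq_or_transGen, transGen_treeArc_iff]
  simp

theorem prefixBefore_tx_iff {a b : E} :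
    PrefixBefore O.TxArc O.OutgoingBefore a b ↔ O.core.Pre a b := by
  have : O.IsFirstIncoming = O.core.IsRI := funext fun e => propext (O.isFirstIncoming_iff e)
  simp only [PrefixBefore, TxArc, transGen_treeArc_iff, reflTransGen_treeArc_iff, this]
  rfl

theorem prefixBefore_ty_iff {a b : E} :
    PrefixBefore O.TyArc (fun c d => O.OutgoingBefore d c) a b ↔ O.core.mirror.Pre a b := by
  have : O.IsLastIncoming = O.core.mirror.IsRI := funext fun e => propext (O.isLastIncoming_iff e)
  have h2 : (fun c d => O.OutgoingBefore d c) = TransGen O.core.mirror.nxo := by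
    funext c d
    exact propext transGen_swap.symm
  rw [h2]
  simp only [PrefixBefore, TyArc, transGen_treeArc_iff, reflTransGen_treeArc_iff, this]
  rfl

theorem xLabel_eq : O.xLabel = O.core.label := by
  funext e; simp only [xLabel, prefixBefore_tx_iff, BipolarCore.label]

theorem yLabel_eq : O.yLabel = O.core.mirror.label := by
  funext e; simp only [yLabel, prefixBefore_ty_iff, BipolarCore.label]

end PlaneBipolarOrientation


open Relation

/-! ### Paths, ascents and descents seen through the two labelings. -/

namespace BipolarCore

variable {V E : Type*} {C : BipolarCore V E}

theorem wf_arc [Finite V] : WellFounded (TransGen C.Arc) := by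
  have : IsTrans V (TransGen C.Arc) := ⟨fun _ _ _ => TransGen.trans⟩
  have : Std.Irrefl (TransGen C.Arc) := ⟨C.acyclic⟩
  exact Finite.wellFounded_of_trans_of_irrefl _

theorem wf_arc_swap [Finite V] : WellFounded (Function.swap (TransGen C.Arc)) := by
  have : IsTrans V (Function.swap (TransGen C.Arc)) := ⟨fun _ _ _ h h' => TransGen.trans h' h⟩
  have : Std.Irrefl (Function.swap (TransGen C.Arc)) := ⟨C.acyclic⟩
  exact Finite.wellFounded_of_trans_of_irrefl _

theorem arc_of_eq {e : E} {v : V} (h : v = C.src e) : C.Arc v (C.tgt e) := ⟨e, h.symm, rfl⟩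

namespace Labeling

variable {X : E → ℕ}

theorem le_of_reflTransGen_nxo (hX : C.Labeling X) {a b : E} (h : ReflTransGen C.nxo a b) :
    X a ≤ X b := by
  induction h with
  | refl => exact le_rfl
  | tail _ h ih => exact ih.trans (hX.nxo_lt h).le

theorem LO_le (hX : C.Labeling X) {l f : E} (hl : C.IsLO l) (h : C.src l = C.src f) :
    X l ≤ X f := hX.le_of_reflTransGen_nxo (hl.reflTransGen h.symm)

variable [Finite V] [Finite E]

/-- The right border of the face between `e` and `e'` starts at `d`, ranked just after `e`, and ends
at `e'`. Ranks do not decrease along it: at each inner vertex of the border, induction bounds the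
ingoing border edge by the rightmost ingoing edge, whose successor is the outgoing border edge. -/
theorem nxi_lt (hX : C.Labeling X) {e e' : E} (h : C.nxi e e') : X e < X e' := by
  induction hv : C.tgt e' using (wf_arc (C := C)).induction generalizing e e' with
  | _ v ih =>
    obtain ⟨c, d, h1, h2, h3⟩ := C.exists_face_of_nxi h
    have hd := hX.succ_face h1 h h2
    have chain : ∀ {a b}, ReflTransGen C.nxi a b → TransGen C.Arc (C.tgt b) v → X a ≤ X b := by
      intro a b hab hb
      induction hab with
      | refl => exact le_rfl
      | tail _ hbc ih' => exact (ih' (C.nxi_tgt hbc ▸ hb)).trans (ih _ hb hbc rfl).le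
    have key : ∀ p, ReflTransGen C.LeftStep d p → ReflTransGen C.Arc (C.tgt p) v → X d ≤ X p := by
      intro p hp
      induction hp with
      | refl => exact fun _ => le_rfl
      | @tail p q _ hpq ih' =>
        intro hqv
        have hqv' : TransGen C.Arc (C.tgt p) v := TransGen.head' (arc_of_eq hpq.1) hqv
        refine (ih' hqv'.to_reflTransGen).trans ?_
        obtain ⟨r, hr, hr'⟩ := exists_RI (C.tgt_ne p)
        have hpr := hr'.reflTransGen hr.symm
        have hle : X p ≤ X r := chain hpr (hr ▸ hqv')
        rw [hX.succ_vertex hr' hpq.2.2 (hr.trans hpq.1)]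
        omega
    have := key e' h3 (hv ▸ ReflTransGen.refl)
    omega

theorem le_of_reflTransGen_nxi (hX : C.Labeling X) {a b : E} (h : ReflTransGen C.nxi a b) :
    X a ≤ X b := by
  induction h with
  | refl => exact le_rfl
  | tail _ h ih => exact ih.trans (hX.nxi_lt h).le

theorem le_RI (hX : C.Labeling X) {r f : E} (hr : C.IsRI r) (h : C.tgt f = C.tgt r) :
    X f ≤ X r := hX.le_of_reflTransGen_nxi (hr.reflTransGen h)

/-- At a vertex, all ingoing ranks are at most that of the rightmost ingoing edge, and outgoing
ranks start just after it. -/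
theorem lt_of_tgt_eq_src (hX : C.Labeling X) {e f : E} (h : C.tgt e = C.src f) : X e < X f := by
  obtain ⟨r, hr, hr'⟩ := exists_RI (C.tgt_ne e)
  obtain ⟨l, hl, hl'⟩ := exists_LO (C.src_ne f)
  have h1 := hX.le_RI hr' hr.symm
  have h2 := hX.LO_le hl' hl
  have h3 := hX.succ_vertex hr' hl' (by rw [hr, h, hl])
  omega

theorem lt_of_path (hX : C.Labeling X) {e f : E} (h : ReflTransGen C.Arc (C.tgt e) (C.src f)) :
    X e < X f := by
  generalize hw : C.src f = w at h
  induction h generalizing f with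
  | refl => exact hX.lt_of_tgt_eq_src hw.symm
  | tail _ h ih =>
    obtain ⟨g, hg, hg'⟩ := h
    exact (ih hg).trans (hX.lt_of_tgt_eq_src (hg'.trans hw.symm))

theorem le_RI_of_path (hX : C.Labeling X) {e r : E} (hr : C.IsRI r)
    (h : ReflTransGen C.Arc (C.tgt e) (C.tgt r)) : X e ≤ X r := by
  rcases ReflTransGen.cases_tail h with h | ⟨w, h1, g, h2, h3⟩
  · exact hX.le_RI hr h.symm
  · subst h2
    exact (hX.lt_of_path h1).le.trans (hX.le_RI hr h3)

theorem lt_LO_of_path (hX : C.Labeling X) {e l : E} (hl : C.IsLO l)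
    (h : ReflTransGen C.Arc (C.src l) (C.src e)) : X l ≤ X e := by
  rcases ReflTransGen.cases_head h with h | ⟨w, ⟨g, h2, h3⟩, h1⟩
  · exact hX.LO_le hl h
  · subst h3
    exact (hX.LO_le hl h2.symm).trans (hX.lt_of_path h1).le

/-- Edges ranked between two ingoing edges of `v` lead to `v`. -/
theorem path_of_between_in (hX : C.Labeling X) {e e' z : E} (h : C.tgt e = C.tgt e')
    (h1 : X e ≤ X z) (h2 : X z ≤ X e') : ReflTransGen C.Arc (C.tgt z) (C.tgt e') := by
  induction hv : C.tgt e' using (wf_arc (C := C)).induction generalizing e e' with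
  | _ v ih =>
    -- For adjacent ingoing edges, follow the right border of their face. Between consecutive border
    -- edges `p`, `q`, the ranks missed are those after `X p` up to `X r = X q - 1`, with `r` the
    -- rightmost edge entering the vertex of the border; induction applies at this lower vertex.
    have one : ∀ {a b}, C.nxi a b → C.tgt b = v → X a ≤ X z → X z ≤ X b →
        ReflTransGen C.Arc (C.tgt z) v := by
      intro a b hab hb h1 h2
      obtain ⟨c, d, hcd, hca, hdb⟩ := C.exists_face_of_nxi hab
      have hd := hX.succ_face hcd hab hca
      rcases h1.eq_or_lt with h1 | h1
      · rw [← hX.injective h1, C.nxi_tgt hab, hb]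
      have key : ∀ p, ReflTransGen C.LeftStep d p → ReflTransGen C.Arc (C.tgt p) v →
          X z ≤ X p → ReflTransGen C.Arc (C.tgt z) v := by
        intro p hp
        induction hp with
        | refl =>
          intro h3 h4
          rwa [hX.injective (show X z = X d by omega)]
        | @tail p q _ hpq ih' =>
          intro h3 h4
          have h5 := TransGen.head' (arc_of_eq hpq.1) h3
          by_cases h6 : X z ≤ X p
          · exact ih' h5.to_reflTransGen h6
          · rcases h4.eq_or_lt with h4 | h4
            · rwa [hX.injective h4]
            · obtain ⟨r, hr, hr'⟩ := exists_RI (C.tgt_ne p)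
              have h7 := hX.succ_vertex hr' hpq.2.2 (hr.trans hpq.1)
              exact (ih _ h5 (e := p) (e' := r) hr.symm (by omega) (by omega) hr).trans
                h5.to_reflTransGen
      exact key b hdb (hb ▸ ReflTransGen.refl) h2
    have hee' : ReflTransGen C.nxi e e' := by
      rcases C.nxi_total h with h | h | h
      · rw [h]
      · exact h.to_reflTransGen
      · have := hX.le_of_reflTransGen_nxi h.to_reflTransGen
        rw [hX.injective (show X e = X e' by omega)]
    clear h
    induction hee' with
    | refl => rw [hX.injective (le_antisymm h2 h1), hv]
    | @tail a b _ hab ih' =>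
      by_cases h3 : X z ≤ X a
      · exact ih' h3 ((C.nxi_tgt hab).trans hv)
      · exact one hab hv (by omega) h2

/-- Edges ranked between two outgoing edges of `v` can be reached from `v`. -/
theorem path_of_between_out (hX : C.Labeling X) {e e' z : E} (h : C.src e = C.src e')
    (h1 : X e ≤ X z) (h2 : X z ≤ X e') : ReflTransGen C.Arc (C.src e) (C.src z) := by
  induction hv : C.src e using (wf_arc_swap (C := C)).induction generalizing e e' with
  | _ v ih =>
    -- The dual walk follows the left border upwards from `a`; a missed rank lies between the
    -- leftmost outgoing edge of a border vertex and the outgoing border edge there.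
    have one : ∀ {a b}, C.nxo a b → C.src a = v → X a ≤ X z → X z ≤ X b →
        ReflTransGen C.Arc v (C.src z) := by
      intro a b hab hb h1 h2
      obtain ⟨c, d, hcd, hac, hbd⟩ := C.exists_face_of_nxo hab
      have hd := hX.succ_face hab hcd hac
      rcases h2.eq_or_lt with h2 | h2
      · rw [hX.injective h2, ← C.nxo_src hab, hb]
      have key : ∀ p, ReflTransGen C.RightStep a p → X z ≤ X p →
          ReflTransGen C.Arc v (C.src p) ∧ ReflTransGen C.Arc v (C.src z) := by
        intro p hp
        have hvp : ∀ {p}, ReflTransGen C.RightStep a p → ReflTransGen C.Arc v (C.src p) := by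
          intro p hp
          induction hp with
          | refl => rw [hb]
          | tail _ h ih => exact ih.tail ⟨_, rfl, h.1⟩
        refine fun h => ⟨hvp hp, ?_⟩
        induction hp with
        | refl => rw [hX.injective (le_antisymm h h1), hb]
        | @tail p q hap hpq ih' =>
          by_cases h6 : X z ≤ X p
          · exact ih' h6
          · rcases h.eq_or_lt with h4 | h4
            · rw [hX.injective h4, ← hpq.1]; exact (hvp hap).tail ⟨_, rfl, rfl⟩
            · obtain ⟨l, hl, hl'⟩ := exists_LO (C.src_ne q)
              have h7 := hX.succ_vertex hpq.2.1 hl' (hpq.1.trans hl.symm)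
              have h5 : TransGen C.Arc v (C.src q) :=
                TransGen.tail' (hvp hap) ⟨p, rfl, hpq.1⟩
              exact h5.to_reflTransGen.trans
                (ih _ h5 (e := l) (e' := q) hl (by omega) (by omega) hl)
      exact (key c hac (by omega)).2
    have hee' : ReflTransGen C.nxo e e' := by
      rcases C.nxo_total h with h | h | h
      · rw [h]
      · exact h.to_reflTransGen
      · have := hX.le_of_reflTransGen_nxo h.to_reflTransGen
        rw [hX.injective (show X e = X e' by omega)]
    have hsrc : ∀ {a}, ReflTransGen C.nxo e a → C.src a = v := by
      intro a ha
      induction ha with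
      | refl => exact hv
      | tail _ h ih => exact (C.nxo_src h).symm.trans ih
    clear h
    induction hee' with
    | refl => rw [hX.injective (le_antisymm h2 h1), hv]
    | @tail a b hea hab ih' =>
      by_cases h3 : X z ≤ X a
      · exact ih' h3
      · exact one hab (hsrc hea) (by omega) h2

variable {Y : E → ℕ}

/-- The two labels together detect reachability. Induction on the distance in `X`: `e` is replaced
by an edge closer to `f`, either the leftmost one leaving its endpoint or its right neighbour `e'`.
-/
theorem path_of_lt (hX : C.Labeling X) (hY : C.mirror.Labeling Y) {e f : E}
    (hx : X e < X f) (hy : Y e < Y f) : ReflTransGen C.Arc (C.tgt e) (C.src f) := by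
  induction hk : X f - X e using Nat.strong_induction_on generalizing e with
  | _ k ih =>
    by_cases he : C.IsRI e
    · have ht : C.tgt e ≠ C.t := fun ht => by
        have := hX.last he ht
        have := hX.le_card f
        omega
      obtain ⟨g, hg, hg'⟩ := exists_LO ht
      have h1 := hX.succ_vertex he hg' hg.symm
      rcases lt_trichotomy (Y g) (Y f) with h2 | h2 | h2
      · rcases (show X g ≤ X f by omega).eq_or_lt with h3 | h3
        · rw [← hX.injective h3, hg]
        · exact (ih _ (by omega) h3 h2 rfl).head (arc_of_eq hg.symm)
      · rw [← hY.injective h2, hg]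
      -- Now `Y e < Y f < Y g`, and this interval is cut at the vertex: up to `Y l`, edges lead to
      -- it, which would give `X f ≤ X e`; from `Y r = Y l + 1` on, they start from it.
      · obtain ⟨l, hl, hl'⟩ := exists_LI (C.tgt_ne e)
        obtain ⟨r, hr, hr'⟩ := exists_RO ht
        have h3 : Y r = Y l + 1 := hY.succ_vertex hl' hr' (hl.trans hr.symm)
        by_cases h4 : Y f ≤ Y l
        · have h5 := hY.path_of_between_in (e := e) (e' := l) hl.symm hy.le h4
          have h6 := hX.le_RI_of_path he (e := f) (hl ▸ h5)
          omega
        · have h5 := hY.path_of_between_out (e := r) (e' := g) (z := f) (hr.trans hg.symm)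
            (by omega) h2.le
          exact hr ▸ h5
    · obtain ⟨e', he'⟩ : ∃ e', C.nxi e e' := by simpa [IsRI] using he
      obtain ⟨c, d, hcd, hce, hde⟩ := C.exists_face_of_nxi he'
      have hd := hX.succ_face hcd he' hce
      have hYe : Y e' < Y e := hY.nxi_lt he'
      -- The border from `d` to `e'` cannot jump over `f` in `X`: otherwise `f` would be ranked
      -- between `p` and `r`, hence lead to the endpoint of `p`, and `Y f ≤ Y p` since `p` is
      -- leftmost there. But `Y p < Y e' < Y e < Y f`.
      have key : ∀ p, ReflTransGen C.LeftStep d p → Y p ≤ Y e' → X e < X p ∧ X p < X f := by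
        intro p hp
        induction hp with
        | refl =>
          intro h
          have : d ≠ f := fun h' => by subst h'; omega
          have : X d ≠ X f := fun h => this (hX.injective h)
          omega
        | @tail p q _ hpq ih' =>
          intro h
          have h1 : Y p < Y q := hY.lt_of_tgt_eq_src hpq.1
          obtain ⟨h2, h3⟩ := ih' (by omega)
          have h4 := hX.lt_of_tgt_eq_src hpq.1
          refine ⟨by omega, ?_⟩
          by_contra h5
          obtain ⟨r, hr, hr'⟩ := exists_RI (C.tgt_ne p)
          have h6 := hX.succ_vertex hr' hpq.2.2 (hr.trans hpq.1)
          have h7 : X f ≠ X q := fun h => by rw [hX.injective h] at hy; omega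
          have h8 := hX.path_of_between_in (e := p) (e' := r) (z := f) hr.symm (by omega) (by omega)
          have h9 : Y f ≤ Y p := hY.le_RI_of_path hpq.2.1 (e := f) (hr ▸ h8)
          omega
      obtain ⟨h1, h2⟩ := key e' hde le_rfl
      rw [C.nxi_tgt he']
      exact ih _ (by omega) h2 (by omega) rfl

/-- A `Y`-rank after `Y p` and at most `Y q`, for consecutive border edges `p`, `q`, belongs to an
edge reachable from the vertex between them, hence ranked after `p` in `X`. -/
theorem le_of_between_right_border (hX : C.Labeling X) (hY : C.mirror.Labeling Y) {d p z : E}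
    (hp : ReflTransGen C.LeftStep d p) (h1 : Y d ≤ Y z) (h2 : Y z ≤ Y p) : X d ≤ X z := by
  have hdp : ∀ {p}, ReflTransGen C.LeftStep d p → X d ≤ X p := by
    intro p hp
    induction hp with
    | refl => exact le_rfl
    | tail _ h ih => exact ih.trans (hX.lt_of_tgt_eq_src h.1).le
  induction hp with
  | refl => rw [hY.injective (le_antisymm h2 h1)]
  | @tail p q hdp' hpq ih =>
    by_cases h3 : Y z ≤ Y p
    · exact ih h3
    · obtain ⟨r, hr, hr'⟩ := exists_RO (C.src_ne q)
      have h4 : Y r = Y p + 1 := hY.succ_vertex hpq.2.1 hr' (hpq.1.trans hr.symm)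
      have h5 := hY.path_of_between_out (e := r) (e' := q) (z := z) hr (by omega) h2
      have h6 : X p < X z := hX.lt_of_path (by rw [hpq.1, ← hr]; exact h5)
      exact (hdp hdp').trans h6.le

/-- Here a `Y`-rank strictly between consecutive border edges belongs to an edge that leads to the
vertex between them. -/
theorem le_of_between_left_border (hX : C.Labeling X) (hY : C.mirror.Labeling Y) {c p z : E}
    (hp : ReflTransGen C.RightStep c p) (h1 : Y c ≤ Y z) (h2 : Y z ≤ Y p) : X z ≤ X p := by
  induction hp with
  | refl => rw [hY.injective (le_antisymm h2 h1)]
  | @tail p q _ hpq ih =>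
    have hlt := hX.lt_of_tgt_eq_src hpq.1
    by_cases h3 : Y z ≤ Y p
    · exact (ih h3).trans hlt.le
    · rcases h2.eq_or_lt with h2 | h2
      · rw [hY.injective h2]
      · obtain ⟨l, hl, hl'⟩ := exists_LI (C.tgt_ne p)
        have h4 : Y q = Y l + 1 := hY.succ_vertex hl' hpq.2.2 (hl.trans hpq.1)
        have h5 := hY.path_of_between_in (e := p) (e' := l) (z := z) hl.symm (by omega) (by omega)
        exact (hX.lt_of_path (by rw [← hpq.1, ← hl]; exact h5)).le

/-- The dichotomy between ascents and descents. -/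
theorem succ_cases (hX : C.Labeling X) (hY : C.mirror.Labeling Y) {e g : E} (h : X g = X e + 1) :
    (C.IsRI e ∧ C.IsLO g ∧ C.tgt e = C.src g ∧ Y e < Y g) ∨
      ∃ c e', C.nxi e e' ∧ C.nxo c g ∧ ReflTransGen C.RightStep c e ∧
        ReflTransGen C.LeftStep g e' ∧ Y c = Y e' + 1 ∧ Y g < Y e := by
  by_cases he : C.IsRI e
  · left
    have ht : C.tgt e ≠ C.t := fun ht => by
      have := hX.last he ht
      have := hX.le_card g
      omega
    obtain ⟨g', hg, hg'⟩ := exists_LO ht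
    have h1 := hX.succ_vertex he hg' hg.symm
    obtain rfl := hX.injective (h1.trans h.symm)
    exact ⟨he, hg', hg.symm, hY.lt_of_tgt_eq_src hg.symm⟩
  · right
    obtain ⟨e', he'⟩ : ∃ e', C.nxi e e' := by simpa [IsRI] using he
    obtain ⟨c, d, hcd, hce, hde⟩ := C.exists_face_of_nxi he'
    have hd := hX.succ_face hcd he' hce
    obtain rfl := hX.injective (hd.trans h.symm)
    have hYe : Y e' < Y e := hY.nxi_lt he'
    have h2 : Y d ≤ Y e' := by
      clear hYe he'
      induction hde with
      | refl => exact le_rfl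
      | tail _ h ih => exact ih.trans (hY.lt_of_tgt_eq_src h.1).le
    exact ⟨c, e', he', hcd, hce, hde, hY.succ_face hcd he' hde, by omega⟩

/-- The values from `Y e` to `Y g` split at `Y l`: below, edges that lead to the vertex, on the left
in `X`; above, edges that start from it, on the right. -/
theorem between_vertex (hX : C.Labeling X) (hY : C.mirror.Labeling Y) {e g l z : E}
    (he : C.IsRI e) (hg : C.IsLO g) (hl : C.IsLI l) (heg : C.tgt e = C.src g)
    (hel : C.tgt l = C.tgt e) :
    (Y e ≤ Y z → Y z ≤ Y l → X z ≤ X e) ∧ (Y l < Y z → Y z ≤ Y g → X g ≤ X z) := by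
  constructor
  · intro h1 h2
    have := hY.path_of_between_in (e := e) (e' := l) (z := z) hel.symm h1 h2
    exact hX.le_RI_of_path he (hel ▸ this)
  · intro h1 h2
    obtain ⟨r, hr, hr'⟩ := exists_RO (C.src_ne g)
    have h4 : Y r = Y l + 1 := hY.succ_vertex hl hr' ((hel.trans heg).trans hr.symm)
    have := hY.path_of_between_out (e := r) (e' := g) (z := z) hr (by omega) h2
    exact hX.lt_LO_of_path hg (hr ▸ this)

/-- Each step from `j` to `j'` has a threshold in `Y` that separates, among the intermediate values,
those on the left from those on the right: `Y l` at a vertex, `Y e'` at a face. A forbidden pattern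
would have them on the wrong sides. -/
theorem baxter (hX : C.Labeling X) (hY : C.mirror.Labeling Y) {i j j' k : E}
    (hij : X i < X j) (hj : X j' = X j + 1) (hjk : X j < X k) :
    ¬ (Y j' < Y i ∧ Y i < Y k ∧ Y k < Y j) ∧ ¬ (Y j < Y k ∧ Y k < Y i ∧ Y i < Y j') := by
  rcases hX.succ_cases hY hj with ⟨h1, h2, h3, h4⟩ | ⟨c, e', h1, h2, h3, h4, h5, h6⟩
  · refine ⟨by omega, ?_⟩
    rintro ⟨h5, h6, h7⟩
    obtain ⟨l, hl, hl'⟩ := exists_LI (C.tgt_ne j)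
    have hk := (hX.between_vertex hY h1 h2 hl' h3 hl (z := k)).1 h5.le
    have hi := (hX.between_vertex hY h1 h2 hl' h3 hl (z := i)).2
    by_cases h8 : Y k ≤ Y l
    · have := hk h8; omega
    · have := hi (by omega) h7.le; omega
  · refine ⟨?_, by omega⟩
    rintro ⟨h7, h8, h9⟩
    have hi := hX.le_of_between_right_border hY h4 (z := i) h7.le
    have hk := hX.le_of_between_left_border hY h3 (z := k)
    by_cases h10 : Y i ≤ Y e'
    · have := hi h10; omega
    · have := hk (by omega) h9.le; omega

end Labeling

/-! ### Coordinates of the vertices, and the product order as reachability. -/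

section Level

variable [Finite E] (C)

/-- The rank of the rightmost ingoing edge of a vertex, or 0 for the source. -/
noncomputable def level (X : E → ℕ) (v : V) : ℕ :=
  open Classical in if h : v = C.s then 0 else X (exists_RI h).choose

variable {C} {X : E → ℕ}

theorem level_s : C.level X C.s = 0 := by simp [level]

theorem IsRI.level {r : E} (hr : C.IsRI r) : C.level X (C.tgt r) = X r := by
  rw [BipolarCore.level, dif_neg (C.tgt_ne r)]
  have h := (exists_RI (C.tgt_ne r)).choose_spec
  rw [h.2.eq hr h.1]

theorem IsLI.level {r : E} (hr : C.IsLI r) : C.mirror.level X (C.tgt r) = X r :=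
  IsRI.level (C := C.mirror) hr

namespace Labeling

theorem level_t (hX : C.Labeling X) : C.level X C.t = Nat.card E := by
  obtain ⟨r, hr, hr'⟩ := exists_RI C.s_ne_t.symm
  rw [← hr, hr'.level, hX.last hr' hr]

theorem level_le_card (hX : C.Labeling X) (v : V) : C.level X v ≤ Nat.card E := by
  by_cases hv : v = C.s
  · rw [hv, level_s]; exact Nat.zero_le _
  · obtain ⟨r, rfl, hr'⟩ := exists_RI hv
    rw [hr'.level]; exact hX.le_card r

theorem level_LO (hX : C.Labeling X) {l : E} (hl : C.IsLO l) : X l = C.level X (C.src l) + 1 := by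
  by_cases hv : C.src l = C.s
  · rw [hX.first hl hv, hv, level_s]
  · obtain ⟨r, hr, hr'⟩ := exists_RI hv
    rw [hX.succ_vertex hr' hl hr, ← hr, hr'.level]

theorem level_injective (hX : C.Labeling X) : Function.Injective (C.level X) := by
  have hpos : ∀ {v}, v ≠ C.s → 1 ≤ C.level X v := by
    intro v hv
    obtain ⟨r, rfl, hr'⟩ := exists_RI hv
    rw [hr'.level]; exact hX.pos r
  intro u v h
  by_cases hu : u = C.s <;> by_cases hv : v = C.s
  · rw [hu, hv]
  · have := hpos hv; rw [hu, level_s] at h; omega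
  · have := hpos hu; rw [hv, level_s] at h; omega
  · obtain ⟨r, rfl, hr⟩ := exists_RI hu
    obtain ⟨r', rfl, hr'⟩ := exists_RI hv
    rw [hr.level, hr'.level] at h
    rw [hX.injective h]

theorem level_src_lt (hX : C.Labeling X) (e : E) : C.level X (C.src e) < X e := by
  obtain ⟨l, hl, hl'⟩ := exists_LO (C.src_ne e)
  have h1 := hX.level_LO hl'
  have h2 := hX.LO_le hl' hl
  rw [hl] at h1
  omega

variable [Finite V] {Y : E → ℕ}

theorem le_level_tgt (hX : C.Labeling X) (e : E) : X e ≤ C.level X (C.tgt e) := by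
  obtain ⟨r, hr, hr'⟩ := exists_RI (C.tgt_ne e)
  rw [← hr, hr'.level]
  exact hX.le_RI hr' hr.symm

theorem path_src_of_level_lt (hX : C.Labeling X) (hY : C.mirror.Labeling Y) {v : V} {e : E}
    (hx : C.level X v < X e) (hy : C.mirror.level Y v < Y e) :
    ReflTransGen C.Arc v (C.src e) := by
  have ht : v ≠ C.t := by
    rintro rfl
    rw [hX.level_t] at hx
    have := hX.le_card e
    omega
  obtain ⟨l, rfl, hl'⟩ := exists_LO ht
  obtain ⟨r, hr, hr'⟩ := exists_RO ht
  have h1 := hX.level_LO hl'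
  have h2 : Y r = C.mirror.level Y (C.src r) + 1 := hY.level_LO hr'
  rw [hr] at h2
  rcases lt_trichotomy (Y l) (Y e) with h3 | h3 | h3
  · rcases (show X l ≤ X e by omega).eq_or_lt with h4 | h4
    · rw [hX.injective h4]
    · exact (hX.path_of_lt hY h4 h3).head ⟨l, rfl, rfl⟩
  · rw [hY.injective h3]
  · have := hY.path_of_between_out (e := r) (e' := l) (z := e) hr (by omega) h3.le
    exact hr ▸ this

theorem path_tgt_of_le_level (hX : C.Labeling X) (hY : C.mirror.Labeling Y) {v : V} {e : E}
    (hx : X e ≤ C.level X v) (hy : Y e ≤ C.mirror.level Y v) :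
    ReflTransGen C.Arc (C.tgt e) v := by
  have hs : v ≠ C.s := by
    rintro rfl
    rw [level_s] at hx
    have := hX.pos e
    omega
  obtain ⟨r, rfl, hr'⟩ := exists_RI hs
  obtain ⟨l, hl, hl'⟩ := exists_LI hs
  rw [hr'.level] at hx
  rw [← hl, hl'.level] at hy
  rcases lt_trichotomy (Y e) (Y r) with h3 | h3 | h3
  · rcases hx.eq_or_lt with h4 | h4
    · rw [hX.injective h4]
    · exact (hX.path_of_lt hY h4 h3).tail ⟨r, rfl, rfl⟩
  · rw [hY.injective h3]
  · have := hY.path_of_between_in (e := r) (e' := l) (z := e) hl.symm h3.le hy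
    exact hl ▸ this

theorem path_of_level_le (hX : C.Labeling X) (hY : C.mirror.Labeling Y) {u v : V}
    (hx : C.level X u ≤ C.level X v) (hy : C.mirror.level Y u ≤ C.mirror.level Y v) :
    ReflTransGen C.Arc u v := by
  rcases hx.eq_or_lt with h | h
  · rw [hX.level_injective h]
  have hs : v ≠ C.s := by rintro rfl; rw [level_s] at h; omega
  obtain ⟨r, rfl, hr'⟩ := exists_RI hs
  obtain ⟨l, hl, hl'⟩ := exists_LI hs
  rw [hr'.level] at h
  rw [← hl, hl'.level] at hy
  by_cases h1 : C.mirror.level Y u < Y r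
  · exact (hX.path_src_of_level_lt hY h h1).tail ⟨r, rfl, rfl⟩
  · have hu : u ≠ C.s := by
      rintro rfl
      have h2 : C.mirror.level Y C.s = 0 := level_s (C := C.mirror)
      have := hY.pos r
      omega
    obtain ⟨m, rfl, hm⟩ := exists_LI hu
    rw [hm.level] at h1 hy
    have := hY.path_of_between_in (e := r) (e' := l) (z := m) hl.symm (by omega) hy
    exact hl ▸ this

end Labeling

end Level

end BipolarCore


open Relation

/-! ## Angles -/

theorem clockwiseAngle_of_lt {u v : ℝ × ℝ}
    (h : Complex.arg ⟨v.1, v.2⟩ < Complex.arg ⟨u.1, u.2⟩) :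
    clockwiseAngle u v = Complex.arg ⟨u.1, u.2⟩ - Complex.arg ⟨v.1, v.2⟩ := by
  rw [clockwiseAngle, toIocMod_eq_self]
  have h1 := Complex.arg_le_pi ⟨u.1, u.2⟩
  have h2 := Complex.neg_pi_lt_arg ⟨v.1, v.2⟩
  constructor <;> linarith

theorem clockwiseAngle_of_le {u v : ℝ × ℝ}
    (h : Complex.arg ⟨u.1, u.2⟩ ≤ Complex.arg ⟨v.1, v.2⟩) :
    clockwiseAngle u v = Complex.arg ⟨u.1, u.2⟩ - Complex.arg ⟨v.1, v.2⟩ + 2 * Real.pi := by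
  rw [clockwiseAngle, ← toIocMod_add_right, toIocMod_eq_self]
  have h1 := Complex.arg_le_pi ⟨v.1, v.2⟩
  have h2 := Complex.neg_pi_lt_arg ⟨u.1, u.2⟩
  constructor <;> linarith

/-- The next vector in clockwise order is the next one in decreasing order of the arguments. -/
theorem clockwiseAngle_le_of_next {u v w : ℝ × ℝ}
    (h : Complex.arg ⟨v.1, v.2⟩ < Complex.arg ⟨u.1, u.2⟩ ∧
        (Complex.arg ⟨w.1, w.2⟩ < Complex.arg ⟨u.1, u.2⟩ →
          Complex.arg ⟨w.1, w.2⟩ ≤ Complex.arg ⟨v.1, v.2⟩) ∨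
      Complex.arg ⟨u.1, u.2⟩ ≤ Complex.arg ⟨w.1, w.2⟩ ∧
        Complex.arg ⟨w.1, w.2⟩ ≤ Complex.arg ⟨v.1, v.2⟩) :
    clockwiseAngle u v ≤ clockwiseAngle u w := by
  have h1 := Complex.arg_le_pi ⟨w.1, w.2⟩
  have h2 := Complex.neg_pi_lt_arg ⟨v.1, v.2⟩
  rcases h with ⟨h, h'⟩ | ⟨h, h'⟩
  · rw [clockwiseAngle_of_lt h]
    rcases lt_or_ge (Complex.arg ⟨w.1, w.2⟩) (Complex.arg ⟨u.1, u.2⟩) with h3 | h3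
    · rw [clockwiseAngle_of_lt h3]; linarith [h' h3]
    · rw [clockwiseAngle_of_le h3]; linarith
  · rw [clockwiseAngle_of_le h, clockwiseAngle_of_le (h.trans h')]
    linarith

theorem lt_of_clockwiseAngle_le {u v w : ℝ × ℝ}
    (h : clockwiseAngle u v ≤ clockwiseAngle u w)
    (hw : Complex.arg ⟨w.1, w.2⟩ < Complex.arg ⟨u.1, u.2⟩) :
    Complex.arg ⟨v.1, v.2⟩ < Complex.arg ⟨u.1, u.2⟩ := by
  by_contra! hv
  rw [clockwiseAngle_of_lt hw, clockwiseAngle_of_le hv] at h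
  have h1 := Complex.arg_le_pi ⟨v.1, v.2⟩
  have h2 := Complex.neg_pi_lt_arg ⟨w.1, w.2⟩
  linarith

theorem arg_quadrant_one {u : ℝ × ℝ} (h1 : 0 < u.1) (h2 : 0 < u.2) :
    0 < Complex.arg ⟨u.1, u.2⟩ ∧ Complex.arg ⟨u.1, u.2⟩ < Real.pi / 2 := by
  have h3 : |Complex.arg ⟨u.1, u.2⟩| < Real.pi / 2 :=
    Complex.abs_arg_lt_pi_div_two_iff.2 (Or.inl h1)
  have h4 : 0 ≤ Complex.arg ⟨u.1, u.2⟩ := Complex.arg_nonneg_iff.2 h2.le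
  refine ⟨h4.lt_of_ne fun h => ?_, (abs_lt.1 h3).2⟩
  have := (Complex.arg_eq_zero_iff.1 h.symm).2
  exact h2.ne' this

theorem arg_quadrant_three {u : ℝ × ℝ} (h2 : u.2 < 0) :
    Complex.arg ⟨u.1, u.2⟩ = Complex.arg ⟨(-u).1, (-u).2⟩ - Real.pi := by
  have := Complex.arg_neg_eq_arg_sub_pi_of_im_pos (x := ⟨(-u).1, (-u).2⟩) (by simpa using h2)
  rw [← this]
  congr 1
  apply Complex.ext <;> simp

theorem arg_lt_of_quadrant_one {u v : ℝ × ℝ} (h1 : 0 < u.1) (h2 : 0 < v.2) (h3 : u.1 < v.1)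
    (h4 : v.2 < u.2) : Complex.arg ⟨v.1, v.2⟩ < Complex.arg ⟨u.1, u.2⟩ := by
  by_contra! h
  obtain ⟨h5, h6⟩ := arg_quadrant_one h1 (h2.trans h4)
  obtain ⟨h7, h8⟩ := arg_quadrant_one (h1.trans h3) h2
  have h9 := Real.strictMonoOn_tan.monotoneOn (a := Complex.arg ⟨u.1, u.2⟩)
    (b := Complex.arg ⟨v.1, v.2⟩) ⟨by linarith, h6⟩ ⟨by linarith, h8⟩ h
  rw [Complex.tan_arg, Complex.tan_arg, div_le_div_iff₀ h1 (h1.trans h3)] at h9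
  simp only at h9
  nlinarith [mul_lt_mul_of_pos_right h3 (h2.trans h4), mul_lt_mul_of_pos_left h4 h1]

/-! ## Hasse diagrams in the plane -/

section Hasse

variable {S : Set (ℝ × ℝ)}

theorem exists_hasseArc_below (hS : S.Finite) {p q : ℝ × ℝ} (hp : p ∈ S) (hq : q ∈ S)
    (h : p < q) : ∃ r, HasseArc S r q ∧ p ≤ r := by
  have hfin : {r ∈ S | p ≤ r ∧ r < q}.Finite := hS.subset fun _ h => h.1
  obtain ⟨r, hr⟩ := hfin.exists_maximal ⟨p, hp, le_rfl, h⟩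
  refine ⟨r, ⟨hr.prop.1, hq, hr.prop.2.2, fun z hz hz' => ?_⟩, hr.prop.2.1⟩
  exact hr.not_gt ⟨hz, hr.prop.2.1.trans hz'.1.le, hz'.2⟩ hz'.1

theorem exists_hasseArc_above (hS : S.Finite) {p q : ℝ × ℝ} (hp : p ∈ S) (hq : q ∈ S)
    (h : p < q) : ∃ r, HasseArc S p r ∧ r ≤ q := by
  have hfin : {r ∈ S | p < r ∧ r ≤ q}.Finite := hS.subset fun _ h => h.1
  obtain ⟨r, hr⟩ := hfin.exists_minimal ⟨q, hq, h, le_rfl⟩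
  refine ⟨r, ⟨hp, hr.prop.1, hr.prop.2.1, fun z hz hz' => ?_⟩, hr.prop.2.2⟩
  exact hr.not_lt ⟨hz, hz'.1, hz'.2.le.trans hr.prop.2.2⟩ hz'.2

theorem mem_Icc_of_mem_segment {p q z : ℝ × ℝ} (h : p ≤ q) (hz : z ∈ segment ℝ p q) :
    p ≤ z ∧ z ≤ q := by
  have := segment_subset_Icc h hz
  exact ⟨this.1, this.2⟩

/-- Of two incomparable endpoints, one is further right and the other higher. At a common point
other than `p`, the two coordinates would order the parameters `t` and `t'` in opposite ways. -/
theorem eq_left_of_mem_segments {p q q' z : ℝ × ℝ} (h : p ≤ q) (h' : p ≤ q') (hqq : ¬ q ≤ q')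
    (hqq' : ¬ q' ≤ q) (hz : z ∈ segment ℝ p q) (hz' : z ∈ segment ℝ p q') : z = p := by
  rw [segment_eq_image'] at hz hz'
  obtain ⟨t, ⟨ht0, ht1⟩, rfl⟩ := hz
  obtain ⟨t', ⟨ht0', ht1'⟩, he⟩ := hz'
  have e1 : t' * (q'.1 - p.1) = t * (q.1 - p.1) := by simpa using congrArg Prod.fst he
  have e2 : t' * (q'.2 - p.2) = t * (q.2 - p.2) := by simpa using congrArg Prod.snd he
  have key : t = 0 := by
    rw [Prod.le_def] at h h' hqq hqq'
    by_contra hne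
    have htpos : 0 < t := lt_of_le_of_ne ht0 (Ne.symm hne)
    rcases lt_or_ge q'.1 q.1 with h1 | h1
    · have h2 : q.2 < q'.2 := by by_contra! h2; exact hqq' ⟨h1.le, h2⟩
      have h3 : t < t' := by
        by_contra! h3
        nlinarith [mul_le_mul_of_nonneg_right h3 (sub_nonneg.2 h'.1)]
      nlinarith [mul_lt_mul_of_pos_right h3 (show 0 < q'.2 - p.2 by linarith [h.2])]
    · have h2 : q'.2 < q.2 := by by_contra! h2; exact hqq ⟨h1, h2⟩
      have h3 : t < t' := by
        by_contra! h3
        nlinarith [mul_le_mul_of_nonneg_right h3 (sub_nonneg.2 h'.2)]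
      have h4 : q.1 ≤ q'.1 := h1
      rcases h.1.eq_or_lt with h5 | h5
      · have : q'.1 - p.1 = 0 := by
          have h6 : t' * (q'.1 - p.1) = 0 := by rw [e1, h5]; ring
          exact (mul_eq_zero.1 h6).resolve_left (by linarith)
        exact hqq' ⟨by linarith, h2.le⟩
      · nlinarith [mul_lt_mul_of_pos_right h3 (show 0 < q'.1 - p.1 by linarith)]
  simp [key]

theorem eq_right_of_mem_segments {p p' q z : ℝ × ℝ} (h : p ≤ q) (h' : p' ≤ q) (hpp : ¬ p ≤ p')
    (hpp' : ¬ p' ≤ p) (hz : z ∈ segment ℝ p q) (hz' : z ∈ segment ℝ p' q) : z = q := by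
  have neg : ∀ {a b z : ℝ × ℝ}, z ∈ segment ℝ a b → -z ∈ segment ℝ (-b) (-a) := by
    rintro a b z ⟨s, t, hs, ht, hst, rfl⟩
    exact ⟨t, s, ht, hs, by rw [add_comm, hst], by simp [add_comm]⟩
  have := eq_left_of_mem_segments (neg_le_neg h) (neg_le_neg h') (by simpa using hpp')
    (by simpa using hpp) (neg hz) (neg hz')
  exact neg_injective this

end Hasse


open Relation

/-! ## Coordinates -/

/-- The argument of the vector from the centre of the cell `[a, a+1] × [b, b+1]` to `(x, y)`. -/
noncomputable def cellArg (a b x y : ℕ) : ℝ :=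
  Complex.arg ⟨(x : ℝ) - ((a : ℝ) + 1 / 2), (y : ℝ) - ((b : ℝ) + 1 / 2)⟩

theorem half_lt_cast {a x : ℕ} (h : a < x) : (a : ℝ) + 1 / 2 < x := by
  have : (a : ℝ) + 1 ≤ x := by exact_mod_cast h
  linarith

theorem cast_lt_half {a x : ℕ} (h : x ≤ a) : (x : ℝ) < (a : ℝ) + 1 / 2 := by
  have : (x : ℝ) ≤ a := by exact_mod_cast h
  linarith

theorem half_le_cast_iff {a x : ℕ} : (a : ℝ) + 1 / 2 ≤ x ↔ a < x := by
  refine ⟨fun h => ?_, fun h => (half_lt_cast h).le⟩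
  by_contra! h'
  exact absurd h (not_le.2 (cast_lt_half h'))

theorem cast_le_half_iff {a x : ℕ} : (x : ℝ) ≤ (a : ℝ) + 1 / 2 ↔ x ≤ a := by
  refine ⟨fun h => ?_, fun h => (cast_lt_half h).le⟩
  by_contra! h'
  exact absurd h (not_le.2 (half_lt_cast h'))

section CellArg

variable {a b x y x' y' : ℕ}

theorem cellArg_out (hx : a < x) (hy : b < y) :
    0 < cellArg a b x y ∧ cellArg a b x y < Real.pi / 2 :=
  arg_quadrant_one (u := (_, _)) (sub_pos.2 (half_lt_cast hx)) (sub_pos.2 (half_lt_cast hy))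

theorem cellArg_out_lt (hx : a < x) (hxx : x < x') (hy : b < y') (hyy : y' < y) :
    cellArg a b x' y' < cellArg a b x y := by
  refine arg_lt_of_quadrant_one (u := (_, _)) (v := (_, _)) (sub_pos.2 (half_lt_cast hx))
    (sub_pos.2 (half_lt_cast hy)) ?_ ?_
  · exact sub_lt_sub_right (by exact_mod_cast hxx) _
  · exact sub_lt_sub_right (by exact_mod_cast hyy) _

theorem cellArg_in (hx : x ≤ a) (hy : y ≤ b) :
    -Real.pi < cellArg a b x y ∧ cellArg a b x y < -(Real.pi / 2) := by
  have h2 := sub_neg.2 (cast_lt_half hy)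
  have h1 := sub_neg.2 (cast_lt_half hx)
  have h3 := arg_quadrant_three (u := (((x : ℝ) - ((a : ℝ) + 1 / 2)), ((y : ℝ) - ((b : ℝ) + 1 / 2))))
    h2
  have h4 := arg_quadrant_one (u := -(((x : ℝ) - ((a : ℝ) + 1 / 2)), ((y : ℝ) - ((b : ℝ) + 1 / 2))))
    (by simpa using h1) (by simpa using h2)
  have h5 : cellArg a b x y = _ := h3
  rw [h5]
  constructor <;> linarith [h4.1, h4.2]

theorem cellArg_in_lt (hxx : x < x') (hx : x' ≤ a) (hyy : y' < y) (hy : y ≤ b) :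
    cellArg a b x y < cellArg a b x' y' := by
  have h2 := sub_neg.2 (cast_lt_half hy)
  have h1 := sub_neg.2 (cast_lt_half hx)
  have h2' := sub_neg.2 (cast_lt_half (hyy.le.trans hy))
  have hxx' : (x : ℝ) < x' := by exact_mod_cast hxx
  have hyy' : (y' : ℝ) < y := by exact_mod_cast hyy
  have h3 := arg_quadrant_three (u := (((x : ℝ) - ((a : ℝ) + 1 / 2)), ((y : ℝ) - ((b : ℝ) + 1 / 2))))
    h2
  have h4 := arg_quadrant_three
    (u := (((x' : ℝ) - ((a : ℝ) + 1 / 2)), ((y' : ℝ) - ((b : ℝ) + 1 / 2)))) h2'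
  have h5 : cellArg a b x y = _ := h3
  have h6 : cellArg a b x' y' = _ := h4
  rw [h5, h6]
  refine sub_lt_sub_right (arg_lt_of_quadrant_one ?_ ?_ ?_ ?_) _ <;>
    simp only [Prod.fst_neg, Prod.snd_neg] <;> linarith

end CellArg

section PermExt

variable {n : ℕ} (π : Equiv.Perm (Fin n))

theorem permExt_zero : permExt π 0 = 0 := by simp [permExt]

theorem permExt_last : permExt π (n + 1) = n + 1 := by simp [permExt]

theorem permExt_succ (i : Fin n) : permExt π (i + 1) = π i + 1 := by
  simp [permExt]

theorem permDiagram_eq : permDiagram π =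
    {p | ∃ i, 1 ≤ i ∧ i ≤ n ∧ p = ((i : ℝ), (permExt π i : ℝ))} := by
  ext p
  constructor
  · rintro ⟨i, rfl⟩
    refine ⟨i + 1, by omega, by omega, ?_⟩
    rw [permExt_succ]; push_cast; rfl
  · rintro ⟨i, h1, h2, rfl⟩
    refine ⟨⟨i - 1, by omega⟩, ?_⟩
    have h3 := permExt_succ π ⟨i - 1, by omega⟩
    simp only [Nat.sub_add_cancel h1] at h3
    rw [h3]
    push_cast [Nat.cast_sub h1]
    simp

theorem ascentLevel_eq {a b : ℕ} (h1 : ∃ i ≤ a, permExt π i = b) (h2 : b < permExt π (a + 1))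
    (h3 : ∀ i ≤ a, permExt π i < permExt π (a + 1) → permExt π i ≤ b) : ascentLevel π a = b := by
  obtain ⟨i, hi, rfl⟩ := h1
  apply le_antisymm
  · refine Finset.sup_le fun j hj => ?_
    simp only [Finset.mem_filter, Finset.mem_range] at hj
    exact h3 j (by omega) hj.2
  · exact Finset.le_sup (f := permExt π)
      (Finset.mem_filter.2 ⟨Finset.mem_range.2 (by omega), h2⟩)

end PermExt

/-! ### Embeddings whose product order is reachability, and their Hasse diagrams. -/

namespace PlaneBipolarOrientation

variable {V E : Type*} [Fintype V] [Fintype E] (O : PlaneBipolarOrientation V E)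

/-- The last case is the outer corner of the source, where the clockwise order wraps from the
rightmost to the leftmost outgoing edge. -/
theorem rot_inl_cases (c : E) : (∃ d, O.core.nxo c d ∧ O.rot (Sum.inl c) = Sum.inl d) ∨
    O.core.IsRO c ∧ ((∃ r, O.rot (Sum.inl c) = Sum.inr r ∧ O.core.IsRI r) ∨
      (O.src c = O.source ∧ O.face (Sum.inl c) = O.outer ∧
        ∃ l, O.rot (Sum.inl c) = Sum.inl l ∧ O.core.IsLO l)) := by
  cases h : O.rot (Sum.inl c) with
  | inl d =>
    by_cases hf : O.face (Sum.inl c) = O.outer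
    · refine Or.inr ⟨fun r hr => (O.nextOutgoing_iff.1 hr).2 hf,
        Or.inr ⟨O.src_of_source_corner_outer h hf, hf, d, rfl, fun r hr => ?_⟩⟩
      obtain ⟨h1, h2⟩ := O.nextOutgoing_iff.1 hr
      rw [Sum.inl_injective (O.rot.injective (h1.trans h.symm))] at h2
      exact h2 hf
    · exact Or.inl ⟨d, O.nextOutgoing_iff.2 ⟨h, hf⟩, rfl⟩
  | inr r =>
    refine Or.inr ⟨fun d hd => by simpa using h.symm.trans hd.1, Or.inl ⟨r, rfl, fun r' hr' => ?_⟩⟩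
    simpa using O.rot.injective (h.trans hr'.1.symm)

theorem rot_inr_cases (e : E) : (∃ e', O.core.nxi e' e ∧ O.rot (Sum.inr e) = Sum.inr e') ∨
    O.core.IsLI e ∧ ((∃ l, O.rot (Sum.inr e) = Sum.inl l ∧ O.core.IsLO l) ∨
      (O.tgt e = O.sink ∧ ∃ r, O.rot (Sum.inr e) = Sum.inr r ∧ O.core.IsRI r)) := by
  cases h : O.rot (Sum.inr e) with
  | inr d =>
    by_cases hf : O.face (Sum.inr e) = O.outer
    · refine Or.inr ⟨fun r hr => (O.nextIncoming_iff.1 hr).2 hf,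
        Or.inr ⟨O.tgt_of_sink_corner_outer h hf, d, rfl, fun r hr => ?_⟩⟩
      obtain ⟨h1, h2⟩ := O.nextIncoming_iff.1 hr
      rw [Sum.inr_injective (O.rot.injective (h1.trans h.symm))] at h2
      exact h2 hf
    · exact Or.inl ⟨d, O.nextIncoming_iff.2 ⟨h, hf⟩, rfl⟩
  | inl l =>
    refine Or.inr ⟨fun d hd => by simpa using h.symm.trans hd.1, Or.inl ⟨l, rfl, fun r' hr' => ?_⟩⟩
    simpa using O.rot.injective (h.trans hr'.1.symm)

/-- The arcs of the bicolored map. -/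
def BicoloredArc : V ⊕ E → V ⊕ E → Prop := O.TreeArc fun _ => True

theorem reflTransGen_bicoloredArc_inl {u v : V} (h : ReflTransGen O.core.Arc u v) :
    ReflTransGen O.BicoloredArc (Sum.inl u) (Sum.inl v) := by
  induction h with
  | refl => exact ReflTransGen.refl
  | tail _ h ih =>
    obtain ⟨e, rfl, rfl⟩ := h
    exact (ih.tail (TreeArc.out e)).tail (TreeArc.inc e trivial)

section Embedding

variable {O} {pos : V ⊕ E → ℝ × ℝ} (hpos : Function.Injective pos)
  (hle : ∀ a b, pos a ≤ pos b ↔ ReflTransGen O.BicoloredArc a b)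

include hpos hle

/-- Every arc has a black end, of indegree and outdegree 1, so no vertex fits between its two ends:
the acyclic digraph is its own transitive reduction. -/
theorem hasseArc_range_iff (p q : ℝ × ℝ) : HasseArc (Set.range pos) p q ↔
    ∃ a b, O.BicoloredArc a b ∧ p = pos a ∧ q = pos b := by
  have hanti : ∀ {a b}, ReflTransGen O.BicoloredArc a b → ReflTransGen O.BicoloredArc b a →
      a = b := fun h h' => hpos (le_antisymm ((hle _ _).2 h) ((hle _ _).2 h'))
  have hne : ∀ {a b}, O.BicoloredArc a b → a ≠ b := by
    intro a b h
    cases h <;> simp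
  constructor
  · rintro ⟨⟨a, rfl⟩, ⟨b, rfl⟩, hlt, hcov⟩
    rcases ReflTransGen.cases_head ((hle _ _).1 hlt.le) with rfl | ⟨c, h1, h2⟩
    · exact absurd hlt (lt_irrefl _)
    · refine ⟨a, b, ?_, rfl, rfl⟩
      by_cases hcb : c = b
      · exact hcb ▸ h1
      · exact absurd ⟨lt_of_le_of_ne ((hle _ _).2 (ReflTransGen.single h1))
          (fun h => hne h1 (hpos h)), lt_of_le_of_ne ((hle _ _).2 h2) (fun h => hcb (hpos h))⟩
          (hcov _ ⟨c, rfl⟩)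
  · rintro ⟨a, b, hab, rfl, rfl⟩
    refine ⟨⟨a, rfl⟩, ⟨b, rfl⟩, lt_of_le_of_ne ((hle _ _).2 (ReflTransGen.single hab))
      (fun h => hne hab (hpos h)), ?_⟩
    rintro _ ⟨r, rfl⟩ ⟨h1, h2⟩
    have h1' := (hle _ _).1 h1.le
    have h2' := (hle _ _).1 h2.le
    cases hab with
    | out e =>
      rcases ReflTransGen.cases_tail h2' with h | ⟨c, h3, h4⟩
      · rw [h] at h2; exact lt_irrefl _ h2
      · cases h4
        rw [hanti h1' h3] at h1
        exact lt_irrefl _ h1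
    | inc e _ =>
      rcases ReflTransGen.cases_head h1' with h | ⟨c, h3, h4⟩
      · rw [h] at h1; exact lt_irrefl _ h1
      · cases h3
        rw [hanti h2' h4] at h2
        exact lt_irrefl _ h2

/-- A common point puts the lower end of each arc below the upper end of the other. The degrees of
black vertices then force a shared end; two distinct arcs of the same kind have incomparable
opposite ends, so they meet only at the shared one. -/
theorem hasseNoncrossing_range : HasseNoncrossing (Set.range pos) := by
  have hanti : ∀ {a b}, ReflTransGen O.BicoloredArc a b → ReflTransGen O.BicoloredArc b a →
      a = b := fun h h' => hpos (le_antisymm ((hle _ _).2 h) ((hle _ _).2 h'))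
  have hsl : ∀ {a b}, O.BicoloredArc a b → pos a ≤ pos b := fun h =>
    (hle _ _).2 (ReflTransGen.single h)
  have tail : ∀ {a e}, ReflTransGen O.BicoloredArc a (Sum.inr e) →
      a = Sum.inr e ∨ ReflTransGen O.BicoloredArc a (Sum.inl (O.src e)) := by
    intro a e h
    rcases ReflTransGen.cases_tail h with h | ⟨c, h3, h4⟩
    · exact Or.inl h.symm
    · cases h4; exact Or.inr h3
  have head : ∀ {a e}, ReflTransGen O.BicoloredArc (Sum.inr e) a →
      a = Sum.inr e ∨ ReflTransGen O.BicoloredArc (Sum.inl (O.tgt e)) a := by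
    intro a e h
    rcases ReflTransGen.cases_head h with h | ⟨c, h3, h4⟩
    · exact Or.inl h.symm
    · cases h3; exact Or.inr h4
  have mixed : ∀ e f z, z ∈ segment ℝ (pos (Sum.inl (O.src e))) (pos (Sum.inr e)) →
      z ∈ segment ℝ (pos (Sum.inr f)) (pos (Sum.inl (O.tgt f))) →
      z ∈ ({pos (Sum.inl (O.src e)), pos (Sum.inr e)} ∩
        {pos (Sum.inr f), pos (Sum.inl (O.tgt f))} : Set (ℝ × ℝ)) := by
    intro e f z hz hz'
    obtain ⟨h1, h2⟩ := mem_Icc_of_mem_segment (hsl (TreeArc.out e)) hz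
    obtain ⟨h3, h4⟩ := mem_Icc_of_mem_segment (hsl (TreeArc.inc f trivial)) hz'
    have h5 := (hle _ _).1 (h1.trans h4)
    have h6 := (hle _ _).1 (h3.trans h2)
    rcases tail h6 with h | h
    · have hz : z = pos (Sum.inr e) := le_antisymm h2 (h ▸ h3)
      rw [h] at *
      simp [hz]
    · rcases head h with h | h
      · simp at h
      · rw [← hanti h5 h] at h4 ⊢
        simp [le_antisymm h4 h1]
  intro p q p' q' hpq hpq' hne z ⟨hz, hz'⟩
  obtain ⟨a, b, hab, rfl, rfl⟩ := (hasseArc_range_iff hpos hle _ _).1 hpq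
  obtain ⟨a', b', hab', rfl, rfl⟩ := (hasseArc_range_iff hpos hle _ _).1 hpq'
  obtain ⟨h1, h2⟩ := mem_Icc_of_mem_segment hpq.2.2.1.le hz
  obtain ⟨h3, h4⟩ := mem_Icc_of_mem_segment hpq'.2.2.1.le hz'
  have h5 := (hle _ _).1 (h1.trans h4)
  have h6 := (hle _ _).1 (h3.trans h2)
  cases hab with
  | out e =>
    cases hab' with
    | inc f _ => exact mixed e f z hz hz'
    | out f =>
      have ha : Sum.inl (O.src e) = (Sum.inl (O.src f) : V ⊕ E) := by
        rcases tail h5 with h | h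
        · simp at h
        · rcases tail h6 with h' | h'
          · simp at h'
          · exact hanti h h'
      rw [← ha] at hz' hne hpq' ⊢
      have hno : ∀ {e f : E}, O.src e = O.src f → pos (Sum.inr e) ≤ pos (Sum.inr f) → e = f := by
        intro e f hs h
        rcases tail ((hle _ _).1 h) with h | h
        · simpa using h
        · have := hanti h (hs ▸ ReflTransGen.single (TreeArc.out e))
          simp at this
      have hef : e ≠ f := fun h => hne (by rw [h])
      have hsf : O.src e = O.src f := by simpa using ha
      have := eq_left_of_mem_segments hpq.2.2.1.le hpq'.2.2.1.le (fun h => hef (hno hsf h))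
        (fun h => hef (hno hsf.symm h).symm) hz hz'
      simp [this]
  | inc e _ =>
    cases hab' with
    | out f => exact (mixed f e z hz' hz).symm
    | inc f _ =>
      have ha : Sum.inl (O.tgt e) = (Sum.inl (O.tgt f) : V ⊕ E) := by
        rcases head h5 with h | h
        · simp at h
        · rcases head h6 with h' | h'
          · simp at h'
          · exact hanti h h'
      rw [← ha] at hz' hne hpq' ⊢
      have hno : ∀ {e f : E}, O.tgt e = O.tgt f → pos (Sum.inr e) ≤ pos (Sum.inr f) → f = e := by
        intro e f hs h
        rcases head ((hle _ _).1 h) with h | h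
        · simpa using h
        · have := hanti h (hs ▸ ReflTransGen.single (TreeArc.inc f trivial))
          simp at this
      have hef : e ≠ f := fun h => hne (by rw [h])
      have hsf : O.tgt e = O.tgt f := by simpa using ha
      have := eq_right_of_mem_segments hpq.2.2.1.le hpq'.2.2.1.le (fun h => hef (hno hsf h).symm)
        (fun h => hef (hno hsf.symm h)) hz hz'
      simp [this]

end Embedding

end PlaneBipolarOrientation


open Relation

theorem Sum.elim_same_apply {α β : Type*} (d : α ⊕ α) (f : α → β) :
    Sum.elim f f d = f (Sum.elim id id d) := by
  cases d <;> rfl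

/-! ### Existence: the tree labels draw the orientation. -/

namespace PlaneBipolarOrientation

variable {V E : Type*} [Fintype V] [Fintype E] {O : PlaneBipolarOrientation V E} {X Y : E → ℕ}

section Existence

/-- The points that represent the vertices of the bicolored map. -/
noncomputable def labelPoint (O : PlaneBipolarOrientation V E) (X Y : E → ℕ) :
    V ⊕ E → ℝ × ℝ :=
  Sum.elim (fun v => ((O.core.level X v : ℝ) + 1 / 2, (O.core.mirror.level Y v : ℝ) + 1 / 2))
    (fun e => ((X e : ℝ), (Y e : ℝ)))

/-- The shift by one half turns comparisons between white and black points into `<` or `≤` between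
integers, as the path lemmas for levels require. -/
theorem labelPoint_le_iff (hX : O.core.Labeling X) (hY : O.core.mirror.Labeling Y)
    (a b : V ⊕ E) : O.labelPoint X Y a ≤ O.labelPoint X Y b ↔
      ReflTransGen O.BicoloredArc a b := by
  constructor
  · intro h
    rcases a with u | e <;> rcases b with v | f <;>
      simp only [labelPoint, Sum.elim_inl, Sum.elim_inr, Prod.mk_le_mk, half_le_cast_iff,
        cast_le_half_iff, add_le_add_iff_right, Nat.cast_le] at h
    · exact reflTransGen_bicoloredArc_inl O (hX.path_of_level_le hY h.1 h.2)
    · exact (reflTransGen_bicoloredArc_inl O (hX.path_src_of_level_lt hY h.1 h.2)).tail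
        (TreeArc.out f)
    · exact (reflTransGen_bicoloredArc_inl O (hX.path_tgt_of_le_level hY h.1 h.2)).head
        (TreeArc.inc e trivial)
    · rcases h.1.eq_or_lt with h1 | h1
      · rw [hX.injective h1]
      · have h2 : Y e < Y f := h.2.lt_of_ne fun h2 => by rw [hY.injective h2] at h1; omega
        exact ((reflTransGen_bicoloredArc_inl O (hX.path_of_lt hY h1 h2)).tail
          (TreeArc.out f)).head (TreeArc.inc e trivial)
  · intro h
    induction h with
    | refl => exact le_rfl
    | tail _ h ih =>
      refine ih.trans ?_
      cases h with
      | out e =>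
        simp only [labelPoint, Sum.elim_inl, Sum.elim_inr, Prod.mk_le_mk, half_le_cast_iff]
        exact ⟨hX.level_src_lt e, hY.level_src_lt e⟩
      | inc e _ =>
        simp only [labelPoint, Sum.elim_inl, Sum.elim_inr, Prod.mk_le_mk, cast_le_half_iff]
        exact ⟨hX.le_level_tgt e, hY.le_level_tgt e⟩

theorem labelPoint_injective (hX : O.core.Labeling X) :
    Function.Injective (O.labelPoint X Y) := by
  have mixed : ∀ v e, O.labelPoint X Y (Sum.inl v) ≠ O.labelPoint X Y (Sum.inr e) := by
    intro v e h
    have h1 : (O.core.level X v : ℝ) + 1 / 2 = X e := congrArg Prod.fst h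
    rcases lt_or_ge (O.core.level X v) (X e) with h2 | h2
    · exact (half_lt_cast h2).ne h1
    · exact (cast_lt_half h2).ne' h1
  intro a b h
  rcases a with u | e <;> rcases b with v | f
  · have h1 : (O.core.level X u : ℝ) + 1 / 2 = (O.core.level X v : ℝ) + 1 / 2 := congrArg Prod.fst h
    exact congrArg _ (hX.level_injective (by exact_mod_cast add_right_cancel h1))
  · exact absurd h (mixed u f)
  · exact absurd h.symm (mixed v e)
  · have h1 : (X e : ℝ) = X f := congrArg Prod.fst h
    exact congrArg _ (hX.injective (by exact_mod_cast h1))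

variable {n : ℕ} {π : Equiv.Perm (Fin n)}

/-- At an inner vertex, the ascent goes from the rightmost ingoing edge `r` to the leftmost outgoing
edge `g`. The maximum that defines the ordinate is reached at the leftmost ingoing edge `l`, because
the values in `(Y l, Y g]` occur only from the abscissa of `g` on. -/
theorem ascent_of_level (hX : O.core.Labeling X) (hY : O.core.mirror.Labeling Y)
    (hn : Nat.card E = n) (hπ : ∀ e, permExt π (X e) = Y e) (v : V) :
    permExt π (O.core.level X v) < permExt π (O.core.level X v + 1) ∧
      ascentLevel π (O.core.level X v) = O.core.mirror.level Y v := by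
  by_cases hs : v = O.source
  · subst hs
    have h1 : O.core.level X O.source = 0 := BipolarCore.level_s (C := O.core)
    have h2 : O.core.mirror.level Y O.source = 0 := BipolarCore.level_s (C := O.core.mirror)
    obtain ⟨l, hl, hl'⟩ := BipolarCore.exists_LO (C := O.core) O.source_ne_sink
    have h3 : X l = 1 := hX.first hl' hl
    have h4 := hY.pos l
    have h5 := hπ l
    rw [h3] at h5
    rw [h1, h2, permExt_zero]
    simp only [zero_add]
    refine ⟨by omega, ascentLevel_eq π ⟨0, le_rfl, permExt_zero π⟩ ?_ fun i hi _ => ?_⟩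
    · simp only [zero_add]; omega
    · rw [Nat.le_zero.1 hi, permExt_zero]
  · obtain ⟨r, rfl, hr⟩ := BipolarCore.exists_RI (C := O.core) hs
    obtain ⟨l, hl, hl'⟩ := BipolarCore.exists_LI (C := O.core) hs
    have h1 : O.core.mirror.level Y (O.core.tgt r) = Y l := by rw [← hl]; exact hl'.level
    have hlr : Y r ≤ Y l := hY.le_RI hl' hl.symm
    have hlr' : X l ≤ X r := hX.le_RI hr hl
    rw [hr.level, h1, hπ]
    by_cases ht : O.core.tgt r = O.sink
    · have h2 : X r = n := hn ▸ hX.last hr ht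
      have h3 : Y l = n := hn ▸ hY.last hl' (hl.trans ht)
      rw [h2, permExt_last]
      refine ⟨by omega, ascentLevel_eq π ⟨X l, by omega, hπ l⟩ ?_ fun i hi hi' => ?_⟩
      · rw [permExt_last]; omega
      · rw [permExt_last] at hi'; omega
    · obtain ⟨g, hg, hg'⟩ := BipolarCore.exists_LO (C := O.core) ht
      have h2 := hX.succ_vertex hr hg' hg.symm
      have h3 : Y l < Y g := hY.lt_of_tgt_eq_src (hl.trans hg.symm)
      rw [← h2, hπ]
      refine ⟨by omega, ascentLevel_eq π ⟨X l, by omega, hπ l⟩ ?_ fun i hi hi' => ?_⟩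
      · rw [← h2, hπ]; exact h3
      · rw [← h2, hπ] at hi'
        by_contra! hlt
        by_cases hi0 : i = 0
        · rw [hi0, permExt_zero] at hlt; omega
        · obtain ⟨z, rfl⟩ := hX.surj i (by omega) (hi.trans (hX.le_card r))
          rw [hπ] at hlt hi'
          have := (hX.between_vertex hY hr hg' hl' hg.symm hl (z := z)).2 hlt hi'.le
          omega

theorem exists_level_of_ascent (hX : O.core.Labeling X) (hY : O.core.mirror.Labeling Y)
    (hn : Nat.card E = n) (hπ : ∀ e, permExt π (X e) = Y e) {a : ℕ} (ha : a ≤ n)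
    (h : permExt π a < permExt π (a + 1)) : ∃ v, O.core.level X v = a := by
  by_cases h0 : a = 0
  · exact ⟨O.source, h0 ▸ BipolarCore.level_s (C := O.core)⟩
  by_cases hn' : a = n
  · exact ⟨O.sink, by rw [hn', ← hn]; exact hX.level_t⟩
  obtain ⟨e, rfl⟩ := hX.surj a (by omega) (by omega)
  obtain ⟨g, hg⟩ := hX.surj (X e + 1) (by omega) (by omega)
  rw [← hg, hπ, hπ] at h
  rcases hX.succ_cases hY hg with ⟨h1, -⟩ | ⟨_, _, -, -, -, -, -, h1⟩
  · exact ⟨_, h1.level⟩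
  · omega

theorem bijOn_whitePoints (hX : O.core.Labeling X) (hY : O.core.mirror.Labeling Y)
    (hn : Nat.card E = n) (hπ : ∀ e, permExt π (X e) = Y e) :
    Set.BijOn (fun v => O.labelPoint X Y (Sum.inl v)) Set.univ (whitePoints π) := by
  refine ⟨fun v _ => ?_, fun u _ v _ h => Sum.inl_injective (labelPoint_injective hX h), ?_⟩
  · obtain ⟨h1, h2⟩ := ascent_of_level hX hY hn hπ v
    exact ⟨O.core.level X v, hn ▸ hX.level_le_card v, h1, by rw [whitePoint, h2]; rfl⟩
  · rintro _ ⟨a, ha, h, rfl⟩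
    obtain ⟨v, rfl⟩ := exists_level_of_ascent hX hY hn hπ ha h
    refine ⟨v, Set.mem_univ _, ?_⟩
    rw [whitePoint, (ascent_of_level hX hY hn hπ v).2]; rfl

theorem bijOn_permDiagram (hX : O.core.Labeling X)
    (hn : Nat.card E = n) (hπ : ∀ e, permExt π (X e) = Y e) :
    Set.BijOn (fun e => O.labelPoint X Y (Sum.inr e)) Set.univ (permDiagram π) := by
  rw [permDiagram_eq]
  refine ⟨fun e _ => ⟨X e, hX.pos e, hn ▸ hX.le_card e, ?_⟩,
    fun e _ f _ h => Sum.inr_injective (labelPoint_injective hX h), ?_⟩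
  · rw [hπ]; rfl
  · rintro _ ⟨i, h1, h2, rfl⟩
    obtain ⟨e, rfl⟩ := hX.surj i h1 (hn ▸ h2)
    exact ⟨e, Set.mem_univ _, by rw [hπ]; rfl⟩

theorem phiPoints_eq_range (hX : O.core.Labeling X) (hY : O.core.mirror.Labeling Y)
    (hn : Nat.card E = n) (hπ : ∀ e, permExt π (X e) = Y e) :
    phiPoints π = Set.range (O.labelPoint X Y) := by
  rw [phiPoints, ← (bijOn_whitePoints hX hY hn hπ).image_eq,
    ← (bijOn_permDiagram hX hn hπ).image_eq, Set.image_univ, Set.image_univ, Set.union_comm]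
  ext p
  simp only [Set.mem_union, Set.mem_range, Sum.exists]

theorem src_le_iff (hX : O.core.Labeling X) (hY : O.core.mirror.Labeling Y) {e f : E}
    (h : O.core.src e = O.core.src f) (hlt : X e < X f) :
    TransGen O.core.nxo e f ∧ Y f < Y e := by
  have h1 : TransGen O.core.nxo e f := by
    rcases O.core.nxo_total h with h | h | h
    · rw [h] at hlt; omega
    · exact h
    · have := hX.le_of_reflTransGen_nxo h.to_reflTransGen; omega
  have h2 : Y f ≤ Y e := hY.le_of_reflTransGen_nxo (reflTransGen_swap.2 h1.to_reflTransGen)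
  exact ⟨h1, h2.lt_of_ne fun h => by rw [hY.injective h] at hlt; omega⟩

theorem tgt_le_iff (hX : O.core.Labeling X) (hY : O.core.mirror.Labeling Y) {e f : E}
    (h : O.core.tgt e = O.core.tgt f) (hlt : X e < X f) :
    TransGen O.core.nxi e f ∧ Y f < Y e := by
  have h1 : TransGen O.core.nxi e f := by
    rcases O.core.nxi_total h with h | h | h
    · rw [h] at hlt; omega
    · exact h
    · have := hX.le_of_reflTransGen_nxi h.to_reflTransGen; omega
  have h2 : Y f ≤ Y e := hY.le_of_reflTransGen_nxi (reflTransGen_swap.2 h1.to_reflTransGen)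
  exact ⟨h1, h2.lt_of_ne fun h => by rw [hY.injective h] at hlt; omega⟩

/-- The argument of the direction of a dart. -/
noncomputable def dartArg (O : PlaneBipolarOrientation V E) (X Y : E → ℕ) (v : V) (e : E) : ℝ :=
  cellArg (O.core.level X v) (O.core.mirror.level Y v) (X e) (Y e)

theorem dartArg_out_le (hX : O.core.Labeling X) (hY : O.core.mirror.Labeling Y) {e f : E}
    (h : O.core.src e = O.core.src f) (hle : X e ≤ X f) :
    O.dartArg X Y (O.core.src e) f ≤ O.dartArg X Y (O.core.src e) e := by
  rcases hle.eq_or_lt with h1 | h1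
  · rw [hX.injective h1]
  · refine (cellArg_out_lt (hX.level_src_lt e) h1 ?_ (src_le_iff hX hY h h1).2).le
    rw [h]
    exact hY.level_src_lt f

theorem dartArg_out_lt (hX : O.core.Labeling X) (hY : O.core.mirror.Labeling Y) {e f : E}
    (h : O.core.src e = O.core.src f) (hle : X e < X f) :
    O.dartArg X Y (O.core.src e) f < O.dartArg X Y (O.core.src e) e := by
  refine cellArg_out_lt (hX.level_src_lt e) hle ?_ (src_le_iff hX hY h hle).2
  rw [h]
  exact hY.level_src_lt f

theorem dartArg_in_lt (hX : O.core.Labeling X) (hY : O.core.mirror.Labeling Y) {e f : E}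
    (h : O.core.tgt e = O.core.tgt f) (hle : X e < X f) :
    O.dartArg X Y (O.core.tgt e) e < O.dartArg X Y (O.core.tgt e) f := by
  refine cellArg_in_lt hle ?_ (tgt_le_iff hX hY h hle).2 (hY.le_level_tgt e)
  rw [h]
  exact hX.le_level_tgt f

theorem dartArg_in_le (hX : O.core.Labeling X) (hY : O.core.mirror.Labeling Y) {e f : E}
    (h : O.core.tgt e = O.core.tgt f) (hle : X e ≤ X f) :
    O.dartArg X Y (O.core.tgt e) e ≤ O.dartArg X Y (O.core.tgt e) f := by
  rcases hle.eq_or_lt with h1 | h1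
  · rw [hX.injective h1]
  · exact (dartArg_in_lt hX hY h h1).le

theorem dartArg_in_lt_out (hX : O.core.Labeling X) (hY : O.core.mirror.Labeling Y) {e f : E}
    {v : V} (he : O.core.tgt e = v) (hf : O.core.src f = v) :
    O.dartArg X Y v e < O.dartArg X Y v f := by
  have h1 : O.dartArg X Y v e < -(Real.pi / 2) := by
    subst he; exact (cellArg_in (hX.le_level_tgt e) (hY.le_level_tgt e)).2
  have h2 : 0 < O.dartArg X Y v f := by
    subst hf; exact (cellArg_out (hX.level_src_lt f) (hY.level_src_lt f)).1
  linarith [Real.pi_pos]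

/-- Outgoing darts have arguments in `(0, π/2)`, decreasing from left to right; ingoing ones have
arguments in `(-π, -π/2)`, increasing from left to right. So `rot` decreases the argument, except
when it wraps from the least to the greatest one, which is the second alternative. -/
theorem rot_clockwise_aux (hX : O.core.Labeling X) (hY : O.core.mirror.Labeling Y)
    {d d' : E ⊕ E} (h : O.vert d' = O.vert d) :
    O.dartArg X Y (O.vert d) (Sum.elim id id (O.rot d)) <
        O.dartArg X Y (O.vert d) (Sum.elim id id d) ∧
      (O.dartArg X Y (O.vert d) (Sum.elim id id d') < O.dartArg X Y (O.vert d) (Sum.elim id id d) →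
        O.dartArg X Y (O.vert d) (Sum.elim id id d') ≤
          O.dartArg X Y (O.vert d) (Sum.elim id id (O.rot d))) ∨
    O.dartArg X Y (O.vert d) (Sum.elim id id d) ≤ O.dartArg X Y (O.vert d) (Sum.elim id id d') ∧
      O.dartArg X Y (O.vert d) (Sum.elim id id d') ≤
        O.dartArg X Y (O.vert d) (Sum.elim id id (O.rot d)) := by
  have hv : O.vert (O.rot d) = O.vert d := O.vert_rot d
  rcases d with c | e
  · change O.vert d' = O.core.src c at h
    rcases O.rot_inl_cases c with ⟨g, hg, hr⟩ | ⟨hc, ⟨r, hr, hr'⟩ | ⟨hs, -, l, hr, hl⟩⟩ <;>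
      rw [hr] at hv ⊢ <;> simp only [Sum.elim_inl, Sum.elim_inr, id]
    · change O.core.src g = O.core.src c at hv
      left
      refine ⟨dartArg_out_lt hX hY hv.symm (hX.nxo_lt hg), ?_⟩
      rcases d' with f | f
      · change O.core.src f = O.core.src c at h
        intro h1
        have h2 : X c < X f := by
          by_contra! h2
          have := dartArg_out_le hX hY h h2
          rw [h] at this
          exact absurd h1 (not_lt.2 this)
        obtain ⟨x, hx, hx'⟩ := TransGen.head'_iff.1 (src_le_iff hX hY h.symm h2).1
        obtain rfl := O.core.nxo_right_unique hg hx
        have := dartArg_out_le hX hY (hv.trans h.symm) (hX.le_of_reflTransGen_nxo hx')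
        rw [hv] at this
        exact this
      · exact fun _ => (dartArg_in_lt_out hX hY h hv).le
    · change O.core.tgt r = O.core.src c at hv
      left
      refine ⟨dartArg_in_lt_out hX hY hv rfl, ?_⟩
      rcases d' with f | f
      · change O.core.src f = O.core.src c at h
        intro h1
        have h2 : X f ≤ X c := by
          by_contra! h2
          exact hc.not_transGen (src_le_iff hX hY h.symm h2).1
        have := dartArg_out_le hX hY h h2
        rw [h] at this
        exact absurd h1 (not_lt.2 this)
      · change O.core.tgt f = O.core.src c at h
        intro _
        have := dartArg_in_le hX hY (h.trans hv.symm) (hX.le_RI hr' (h.trans hv.symm))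
        rw [h] at this
        exact this
    · change O.core.src l = O.core.src c at hv
      right
      rcases d' with f | f
      · change O.core.src f = O.core.src c at h
        have h2 : X f ≤ X c := by
          by_contra! h2
          exact hc.not_transGen (src_le_iff hX hY h.symm h2).1
        have h3 := dartArg_out_le hX hY h h2
        have h4 := dartArg_out_le hX hY (hv.trans h.symm) (hX.LO_le hl (hv.trans h.symm))
        rw [h] at h3
        rw [hv] at h4
        exact ⟨h3, h4⟩
      · exact absurd (h.trans hs) (O.tgt_ne_source f)
  · change O.vert d' = O.core.tgt e at h
    rcases O.rot_inr_cases e with ⟨g, hg, hr⟩ | ⟨hc, ⟨l, hr, hl⟩ | ⟨hs, r, hr, hr'⟩⟩ <;>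
      rw [hr] at hv ⊢ <;> simp only [Sum.elim_inl, Sum.elim_inr, id]
    · change O.core.tgt g = O.core.tgt e at hv
      left
      have h0 := dartArg_in_lt hX hY hv (hX.nxi_lt hg)
      rw [hv] at h0
      refine ⟨h0, fun h1 => ?_⟩
      rcases d' with f | f
      · exact absurd h1 (not_lt.2 (dartArg_in_lt_out hX hY rfl h).le)
      · change O.core.tgt f = O.core.tgt e at h
        have h2 : X f < X e := by
          by_contra! h2
          exact absurd h1 (not_lt.2 (dartArg_in_le hX hY h.symm h2))
        obtain ⟨x, hx', hx⟩ := TransGen.tail'_iff.1 (tgt_le_iff hX hY h h2).1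
        obtain rfl := O.core.nxi_left_unique hg hx
        have := dartArg_in_le hX hY (h.trans hv.symm) (hX.le_of_reflTransGen_nxi hx')
        rw [h] at this
        exact this
    · change O.core.src l = O.core.tgt e at hv
      right
      rcases d' with f | f
      · change O.core.src f = O.core.tgt e at h
        have h4 := dartArg_out_le hX hY (hv.trans h.symm) (hX.LO_le hl (hv.trans h.symm))
        rw [hv] at h4
        exact ⟨(dartArg_in_lt_out hX hY rfl h).le, h4⟩
      · change O.core.tgt f = O.core.tgt e at h
        refine ⟨dartArg_in_le hX hY h.symm ?_, (dartArg_in_lt_out hX hY h hv).le⟩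
        by_contra! h2
        exact hc.not_transGen (tgt_le_iff hX hY h h2).1
    · change O.core.tgt r = O.core.tgt e at hv
      right
      rcases d' with f | f
      · exact absurd (h.trans hs) (O.src_ne_sink f)
      · change O.core.tgt f = O.core.tgt e at h
        have h3 := dartArg_in_le hX hY (h.trans hv.symm) (hX.le_RI hr' (h.trans hv.symm))
        rw [h] at h3
        refine ⟨dartArg_in_le hX hY h.symm ?_, h3⟩
        by_contra! h2
        exact hc.not_transGen (tgt_le_iff hX hY h h2).1

/-- The open ray is connected, unbounded and avoids the drawing, so it lies in the component of each
of its points. -/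
theorem mem_unboundedFace_of_ray {S : Set (ℝ × ℝ)} {m w : ℝ × ℝ} (hw : w.1 ≠ 0)
    (h : ∀ s : ℝ, 0 < s → m + s • w ∉ hasseDrawing S) {ε : ℝ} (hε : 0 < ε) :
    m + ε • w ∈ unboundedFace S := by
  refine ⟨h ε hε, fun hb => ?_⟩
  let R : Set (ℝ × ℝ) := (fun s : ℝ => m + s • w) '' Set.Ioi 0
  have hR : IsPreconnected R := isPreconnected_Ioi.image _ (by fun_prop)
  have hsub : R ⊆ connectedComponentIn (hasseDrawing S)ᶜ (m + ε • w) := by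
    refine hR.subset_connectedComponentIn ⟨ε, hε, rfl⟩ ?_
    rintro _ ⟨s, hs, rfl⟩
    exact h s hs
  obtain ⟨B, hB⟩ := (hb.subset hsub).exists_norm_le
  have h1 : ∀ s : ℝ, 0 < s → |m.1 + s * w.1| ≤ B := fun s hs =>
    (norm_fst_le _).trans (hB _ ⟨s, hs, rfl⟩)
  have hw' : 0 < |w.1| := abs_pos.2 hw
  have hB0 : 0 ≤ B := (abs_nonneg _).trans (h1 1 one_pos)
  have hs : 0 < (B + |m.1| + 1) / |w.1| := by positivity
  have h2 := h1 _ hs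
  have h3 : |(B + |m.1| + 1) / |w.1| * w.1| = B + |m.1| + 1 := by
    rw [abs_mul, abs_div, abs_abs, div_mul_cancel₀ _ hw'.ne', abs_of_pos (by positivity)]
  have h4 := abs_sub_abs_le_abs_sub ((B + |m.1| + 1) / |w.1| * w.1) (-m.1)
  rw [sub_neg_eq_add, abs_neg, h3, add_comm (_ * _)] at h4
  linarith

/-- Nothing is drawn below the rightmost edge that leaves the source. -/
theorem ray_not_mem_drawing (hX : O.core.Labeling X) (hY : O.core.mirror.Labeling Y)
    {c : E} (hc : O.core.IsRO c) (hs : O.core.src c = O.source) {s : ℝ} (hpos : 0 < s) :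
    midpoint ℝ (O.labelPoint X Y (Sum.inl (O.core.src c))) (O.labelPoint X Y (Sum.inr c)) +
      s • ((O.labelPoint X Y (Sum.inr c) - O.labelPoint X Y (Sum.inl (O.core.src c))).2,
        -(O.labelPoint X Y (Sum.inr c) - O.labelPoint X Y (Sum.inl (O.core.src c))).1) ∉
      hasseDrawing (Set.range (O.labelPoint X Y)) := by
  have hYc : Y c = 1 := hY.first hc hs
  have hXc := hX.pos c
  have hw : O.labelPoint X Y (Sum.inl (O.core.src c)) = (1 / 2, 1 / 2) := by
    have h1 : O.core.level X O.source = 0 := BipolarCore.level_s (C := O.core)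
    have h2 : O.core.mirror.level Y O.source = 0 := BipolarCore.level_s (C := O.core.mirror)
    simp [labelPoint, hs, h1, h2]
  have hb : O.labelPoint X Y (Sum.inr c) = ((X c : ℝ), 1) := by simp [labelPoint, hYc]
  rintro ⟨p, q, hpq, hz⟩
  obtain ⟨a, b, hab, rfl, rfl⟩ :=
    (hasseArc_range_iff (labelPoint_injective hX) (labelPoint_le_iff hX hY) _ _).1 hpq
  obtain ⟨h1, -⟩ := mem_Icc_of_mem_segment hpq.2.2.1.le hz
  have hXc' : (1 : ℝ) ≤ X c := by exact_mod_cast hXc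
  have h2 := h1.2
  rw [hw, hb] at h2 hz
  simp only [midpoint_eq_smul_add, Prod.mk_add_mk, Prod.smul_mk, smul_eq_mul, Prod.mk_sub_mk,
    invOf_eq_inv] at h2 hz
  -- The ray starts at ordinate `3/4` and goes down, while every vertex other than the source has
  -- ordinate at least 1: only arcs leaving the source remain.
  have ha : (O.labelPoint X Y a).2 < 1 := by nlinarith
  cases hab with
  | inc f _ =>
    have : (1 : ℝ) ≤ Y f := by exact_mod_cast hY.pos f
    exact absurd ha (not_lt.2 this)
  | out f =>
    have h3 : (O.core.mirror.level Y (O.core.src f) : ℝ) + 1 / 2 < 1 := ha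
    have h4 : O.core.mirror.level Y (O.core.src f) = 0 := by
      by_contra h
      have : (1 : ℝ) ≤ O.core.mirror.level Y (O.core.src f) := by
        exact_mod_cast Nat.one_le_iff_ne_zero.2 h
      linarith
    have h5 : O.core.src f = O.source := hY.level_injective
      (h4.trans (BipolarCore.level_s (C := O.core.mirror)).symm)
    have h6 : X f ≤ X c := by
      by_contra! h2
      exact hc.not_transGen (src_le_iff hX hY (hs.trans h5.symm) h2).1
    have h6' : (X f : ℝ) ≤ X c := by exact_mod_cast h6
    have h7 : (1 : ℝ) ≤ Y f := by exact_mod_cast hY.pos f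
    have h7' : (1 : ℝ) ≤ X f := by exact_mod_cast hX.pos f
    have hw' : O.labelPoint X Y (Sum.inl (O.src f)) = (1 / 2, 1 / 2) := by
      rw [← hw]; exact congrArg (fun v => O.labelPoint X Y (Sum.inl v)) (h5.trans hs.symm)
    have hb' : O.labelPoint X Y (Sum.inr f) = ((X f : ℝ), (Y f : ℝ)) := rfl
    rw [hw', hb', segment_eq_image'] at hz
    obtain ⟨t, ⟨ht0, ht1⟩, he⟩ := hz
    simp only [Prod.mk_sub_mk, Prod.smul_mk, smul_eq_mul, Prod.mk_add_mk, Prod.mk.injEq] at he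
    obtain ⟨e1, e2⟩ := he
    -- Cross product with the direction of `c`: the segment to `f` is on or above the line through
    -- `c`, since `X f ≤ X c` and `Y f ≥ 1`, whereas the ray is strictly below it.
    nlinarith [mul_nonneg ht0 (mul_nonneg (show (0 : ℝ) ≤ X c - 1 / 2 by linarith)
        (show (0 : ℝ) ≤ Y f - 1 by linarith)), mul_nonneg ht0 (sub_nonneg.2 h6'),
      mul_pos hpos (mul_pos (show (0 : ℝ) < X c - 1 / 2 by linarith)
        (show (0 : ℝ) < X c - 1 / 2 by linarith))]

theorem isPhi_of_labelings (hX : O.core.Labeling X) (hY : O.core.mirror.Labeling Y)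
    (hn : Nat.card E = n) (hπ : ∀ e, permExt π (X e) = Y e) : IsPhi π O := by
  have hS := phiPoints_eq_range hX hY hn hπ
  have hinj := labelPoint_injective (Y := Y) hX
  have hle := labelPoint_le_iff hX hY
  refine ⟨{
    white := fun v => O.labelPoint X Y (Sum.inl v)
    black := fun e => O.labelPoint X Y (Sum.inr e)
    white_bijOn := bijOn_whitePoints hX hY hn hπ
    black_bijOn := bijOn_permDiagram hX hn hπ
    white_source := ?_
    white_sink := ?_
    hasseArc_iff := ?_
    noncrossing := hS ▸ hasseNoncrossing_range hinj hle
    rot_clockwise := ?_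
    outer_unbounded := ?_ }⟩
  · have h1 := (ascent_of_level hX hY hn hπ O.source).2
    have h2 : O.core.level X O.source = 0 := BipolarCore.level_s (C := O.core)
    rw [h2] at h1
    simp only [whitePoint, labelPoint, Sum.elim_inl, h1, h2]
  · have h1 := (ascent_of_level hX hY hn hπ O.sink).2
    have h2 : O.core.level X O.sink = n := hn ▸ hX.level_t
    rw [h2] at h1
    simp only [whitePoint, labelPoint, Sum.elim_inl, h1, h2]
  · intro p q
    rw [hS, hasseArc_range_iff hinj hle]
    constructor
    · rintro ⟨a, b, h, rfl, rfl⟩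
      cases h with
      | out e => exact ⟨e, Or.inl ⟨rfl, rfl⟩⟩
      | inc e _ => exact ⟨e, Or.inr ⟨rfl, rfl⟩⟩
    · rintro ⟨e, ⟨rfl, rfl⟩ | ⟨rfl, rfl⟩⟩
      · exact ⟨_, _, TreeArc.out e, rfl, rfl⟩
      · exact ⟨_, _, TreeArc.inc e trivial, rfl, rfl⟩
  · intro d d' h
    apply clockwiseAngle_le_of_next
    simp only [Sum.elim_same_apply _ (fun e => O.labelPoint X Y (Sum.inr e))]
    exact rot_clockwise_aux hX hY h
  · obtain ⟨c, hs, hc⟩ := BipolarCore.exists_RO (C := O.core) O.source_ne_sink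
    refine ⟨Sum.inl c, ?_, ?_⟩
    · by_contra hf
      obtain ⟨g, hg⟩ := O.rot_inl_of_src_source hs
      exact hc g (O.nextOutgoing_iff.2 ⟨hg, hf⟩)
    · filter_upwards [self_mem_nhdsWithin] with ε hε
      rw [hS]
      refine mem_unboundedFace_of_ray ?_ (fun s h => ray_not_mem_drawing hX hY hc hs h) hε
      have h1 : O.labelPoint X Y (Sum.inr c) - O.labelPoint X Y (Sum.inl (O.core.src c)) =
        ((X c : ℝ) - ((O.core.level X (O.core.src c) : ℝ) + 1 / 2),
          (Y c : ℝ) - ((O.core.mirror.level Y (O.core.src c) : ℝ) + 1 / 2)) := rfl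
      have h2 := half_lt_cast (hY.level_src_lt c)
      change (O.labelPoint X Y (Sum.inr c) - O.labelPoint X Y (Sum.inl (O.core.src c))).2 ≠ 0
      rw [h1]
      exact (sub_pos.2 h2).ne'

end Existence

/-- There is a Baxter permutation whose image is a given plane bipolar orientation. -/
theorem exists_isBaxter_isPhi (O : PlaneBipolarOrientation V E) :
    ∃ π : Equiv.Perm (Fin (Fintype.card E)), IsBaxter π ∧ IsPhi π O := by
  have hX := O.core.labeling_label
  have hY := O.core.mirror.labeling_label
  set X := O.core.label
  set Y := O.core.mirror.label
  have hcard : Nat.card E = Fintype.card E := Nat.card_eq_fintype_card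
  have bij : ∀ {C : BipolarCore V E} {X : E → ℕ} (hX : C.Labeling X), Function.Bijective
      (fun e => (⟨X e - 1, by have := hX.pos e; have := hX.le_card e; omega⟩ :
        Fin (Fintype.card E))) := by
    intro C X hX
    rw [Fintype.bijective_iff_injective_and_card]
    refine ⟨fun a b h => hX.injective ?_, by simp⟩
    have h1 : X a - 1 = X b - 1 := congrArg Fin.val h
    have := hX.pos a
    have := hX.pos b
    omega
  let eX := Equiv.ofBijective _ (bij hX)
  let eY := Equiv.ofBijective _ (bij hY)
  let π : Equiv.Perm (Fin (Fintype.card E)) := eX.symm.trans eY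
  have hπe : ∀ e, (π (eX e) : ℕ) + 1 = Y e := by
    intro e
    have h1 : π (eX e) = eY e := by simp [π]
    rw [h1]
    have := hY.pos e
    change Y e - 1 + 1 = Y e
    omega
  have heX : ∀ e, (eX e : ℕ) + 1 = X e := by
    intro e
    have := hX.pos e
    change X e - 1 + 1 = X e
    omega
  refine ⟨π, ?_, isPhi_of_labelings hX hY hcard fun e => ?_⟩
  · intro i j j' k hij hj hjk
    obtain ⟨i, rfl⟩ := eX.surjective i
    obtain ⟨j, rfl⟩ := eX.surjective j
    obtain ⟨j', rfl⟩ := eX.surjective j'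
    obtain ⟨k, rfl⟩ := eX.surjective k
    rw [Fin.lt_def] at hij hjk
    have h1 := heX i
    have h2 := heX j
    have h3 := heX j'
    have h4 := heX k
    have h1' := hπe i
    have h2' := hπe j
    have h3' := hπe j'
    have h4' := hπe k
    have := hX.baxter hY (i := i) (j := j) (j' := j') (k := k) (by omega) (by omega) (by omega)
    simp only [Fin.lt_def]
    omega
  · rw [← heX, permExt_succ, hπe]

end PlaneBipolarOrientation


open Relation

/-! ## Drawings of Hasse diagrams and their unbounded faces -/

/-- A finite set of points whose Hasse diagram is an increasing network from `w₀` to `w₁`. -/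
structure IsNetwork (S : Set (ℝ × ℝ)) (w₀ w₁ : ℝ × ℝ) : Prop where
  finite : S.Finite
  lt : ∀ {p q}, HasseArc S p q → p.1 < q.1 ∧ p.2 < q.2
  below : ∀ {p}, p ∈ S → p ≠ w₀ → ∃ r, HasseArc S r p
  above : ∀ {p}, p ∈ S → p ≠ w₁ → ∃ r, HasseArc S p r
  mem_left : w₀ ∈ S
  mem_right : w₁ ∈ S
  left_lt : ∀ {p}, p ∈ S → p ≠ w₀ → w₀.1 < p.1
  lt_right : ∀ {p}, p ∈ S → p ≠ w₁ → p.1 < w₁.1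
  ne : w₀ ≠ w₁

/-- The point `z` lies strictly between two points of the drawing of the same abscissa. -/
def IsBetween (S : Set (ℝ × ℝ)) (z : ℝ × ℝ) : Prop :=
  (∃ y, y < z.2 ∧ (z.1, y) ∈ hasseDrawing S) ∧ ∃ y, z.2 < y ∧ (z.1, y) ∈ hasseDrawing S

theorem isCompact_segment_prod (p q : ℝ × ℝ) : IsCompact (segment ℝ p q) := by
  rw [segment_eq_image']
  exact isCompact_Icc.image (by fun_prop)

theorem isCompact_hasseDrawing {S : Set (ℝ × ℝ)} (hS : S.Finite) : IsCompact (hasseDrawing S) := by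
  have hfin : {r : (ℝ × ℝ) × (ℝ × ℝ) | HasseArc S r.1 r.2}.Finite :=
    (hS.prod hS).subset fun r hr => ⟨hr.1, hr.2.1⟩
  have : hasseDrawing S = ⋃ r ∈ {r : (ℝ × ℝ) × (ℝ × ℝ) | HasseArc S r.1 r.2},
      segment ℝ r.1 r.2 := by
    ext z
    simp [hasseDrawing]
  rw [this]
  exact hfin.isCompact_biUnion fun r _ => isCompact_segment_prod _ _

theorem mk_mem_segment {p q : ℝ × ℝ} (h : p.1 < q.1) {x : ℝ} (h1 : p.1 ≤ x) (h2 : x ≤ q.1) :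
    (x, p.2 + (x - p.1) / (q.1 - p.1) * (q.2 - p.2)) ∈ segment ℝ p q := by
  have hpos : 0 < q.1 - p.1 := sub_pos.2 h
  rw [segment_eq_image']
  refine ⟨(x - p.1) / (q.1 - p.1), ⟨div_nonneg (by linarith) hpos.le, ?_⟩, ?_⟩
  · rw [div_le_one hpos]; linarith
  · ext
    · simp [div_mul_cancel₀ _ hpos.ne']
    · simp

theorem eq_right_of_fst_eq {p q z : ℝ × ℝ} (h : p.1 < q.1) (hz : z ∈ segment ℝ p q)
    (hx : z.1 = q.1) : z = q := by
  rw [segment_eq_image'] at hz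
  obtain ⟨t, -, rfl⟩ := hz
  have h1 : p.1 + t * (q.1 - p.1) = q.1 := hx
  have : t = 1 := by
    have h2 : (t - 1) * (q.1 - p.1) = 0 := by linarith
    rcases mul_eq_zero.1 h2 with h3 | h3 <;> linarith
  simp [this]

theorem eq_left_of_fst_eq {p q z : ℝ × ℝ} (h : p.1 < q.1) (hz : z ∈ segment ℝ p q)
    (hx : z.1 = p.1) : z = p := by
  rw [segment_eq_image'] at hz
  obtain ⟨t, -, rfl⟩ := hz
  have h1 : p.1 + t * (q.1 - p.1) = p.1 := hx
  have : t = 0 := by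
    have h2 : t * (q.1 - p.1) = 0 := by linarith
    rcases mul_eq_zero.1 h2 with h3 | h3 <;> linarith
  simp [this]

theorem hasseArc_neg_iff {S : Set (ℝ × ℝ)} {p q : ℝ × ℝ} :
    HasseArc {z | -z ∈ S} p q ↔ HasseArc S (-q) (-p) := by
  constructor
  · rintro ⟨h1, h2, h3, h4⟩
    refine ⟨h2, h1, neg_lt_neg h3, fun r hr hr' => h4 (-r) (by simpa using hr) ?_⟩
    exact ⟨lt_neg_of_lt_neg hr'.2, neg_lt_of_neg_lt hr'.1⟩
  · rintro ⟨h1, h2, h3, h4⟩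
    refine ⟨h2, h1, by simpa using h3, fun r hr hr' => h4 (-r) hr ?_⟩
    exact ⟨neg_lt_neg hr'.2, neg_lt_neg hr'.1⟩

theorem neg_mem_segment {p q z : ℝ × ℝ} (h : z ∈ segment ℝ p q) : -z ∈ segment ℝ (-q) (-p) := by
  obtain ⟨s, t, hs, ht, hst, rfl⟩ := h
  exact ⟨t, s, ht, hs, by rw [add_comm, hst], by simp [add_comm]⟩

theorem neg_mem_hasseDrawing {S : Set (ℝ × ℝ)} {z : ℝ × ℝ} (h : z ∈ hasseDrawing {z | -z ∈ S}) :
    -z ∈ hasseDrawing S := by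
  obtain ⟨p, q, h1, h2⟩ := h
  exact ⟨-q, -p, hasseArc_neg_iff.1 h1, neg_mem_segment h2⟩

theorem IsBetween.neg {S : Set (ℝ × ℝ)} {z : ℝ × ℝ} (h : IsBetween {z | -z ∈ S} z) :
    IsBetween S (-z) := by
  obtain ⟨⟨y, h1, h2⟩, ⟨y', h3, h4⟩⟩ := h
  exact ⟨⟨-y', neg_lt_neg h3, neg_mem_hasseDrawing h4⟩, ⟨-y, neg_lt_neg h1, neg_mem_hasseDrawing h2⟩⟩

namespace IsNetwork

variable {S : Set (ℝ × ℝ)} {w₀ w₁ : ℝ × ℝ}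

theorem neg (h : IsNetwork S w₀ w₁) : IsNetwork {z | -z ∈ S} (-w₁) (-w₀) where
  finite := h.finite.preimage neg_injective.injOn
  lt hpq := by
    have := h.lt (hasseArc_neg_iff.1 hpq)
    exact ⟨neg_lt_neg_iff.1 this.1, neg_lt_neg_iff.1 this.2⟩
  below {p} hp hne := by
    obtain ⟨r, hr⟩ := h.above hp fun h => hne (by rw [← h, neg_neg])
    exact ⟨-r, hasseArc_neg_iff.2 (by rwa [neg_neg])⟩
  above {p} hp hne := by
    obtain ⟨r, hr⟩ := h.below hp fun h => hne (by rw [← h, neg_neg])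
    exact ⟨-r, hasseArc_neg_iff.2 (by rwa [neg_neg])⟩
  mem_left := by simpa using h.mem_right
  mem_right := by simpa using h.mem_left
  left_lt {p} hp hne := by
    have := h.lt_right hp fun h => hne (by rw [← h, neg_neg])
    exact neg_lt_of_neg_lt this
  lt_right {p} hp hne := by
    have := h.left_lt hp fun h => hne (by rw [← h, neg_neg])
    exact lt_neg_of_lt_neg this
  ne h' := h.ne (neg_injective h').symm

/-- Near a point of the drawing other than `w₁`, the drawing extends to the right. -/
theorem eventually_right (h : IsNetwork S w₀ w₁) {q : ℝ × ℝ} (hq : q ∈ hasseDrawing S)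
    (hq1 : q.1 < w₁.1) {ε : ℝ} (hε : 0 < ε) :
    ∀ᶠ x in nhdsWithin q.1 (Set.Ici q.1), ∃ y, |y - q.2| < ε ∧ (x, y) ∈ hasseDrawing S := by
  -- If `q` is the upper end of its segment, an arc that leaves `q` is used instead.
  have key : ∃ p p', HasseArc S p p' ∧ q ∈ segment ℝ p p' ∧ q.1 < p'.1 := by
    obtain ⟨p, p', hpp, hqs⟩ := hq
    have h1 := (mem_Icc_of_mem_segment hpp.2.2.1.le hqs).2.1
    rcases h1.eq_or_lt with h2 | h2
    · obtain rfl := eq_right_of_fst_eq (h.lt hpp).1 hqs h2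
      obtain ⟨r, hr⟩ := h.above hpp.2.1 (fun h => hq1.ne (by rw [h]))
      exact ⟨q, r, hr, left_mem_segment _ _ _, (h.lt hr).1⟩
    · exact ⟨p, p', hpp, hqs, h2⟩
  obtain ⟨p, p', hpp, hqs, hlt⟩ := key
  have hcont : Filter.Tendsto (fun x : ℝ => (x - q.1) / (p'.1 - q.1) * (p'.2 - q.2))
      (nhds q.1) (nhds 0) := by
    have : Continuous fun x : ℝ => (x - q.1) / (p'.1 - q.1) * (p'.2 - q.2) := by fun_prop
    simpa using this.tendsto q.1
  have h1 : ∀ᶠ x in nhds q.1, |(x - q.1) / (p'.1 - q.1) * (p'.2 - q.2)| < ε := by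
    have := hcont.abs
    rw [abs_zero] at this
    exact this.eventually (Iio_mem_nhds hε)
  filter_upwards [self_mem_nhdsWithin, mem_nhdsWithin_of_mem_nhds h1,
    mem_nhdsWithin_of_mem_nhds (Iio_mem_nhds hlt)] with x hx1 hx2 hx3
  refine ⟨q.2 + (x - q.1) / (p'.1 - q.1) * (p'.2 - q.2), by simpa using hx2, p, p', hpp, ?_⟩
  exact (convex_segment p p').segment_subset hqs (right_mem_segment _ _ _)
    (mk_mem_segment hlt hx1 (le_of_lt hx3))

theorem eventually_left (h : IsNetwork S w₀ w₁) {q : ℝ × ℝ} (hq : q ∈ hasseDrawing S)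
    (hq1 : w₀.1 < q.1) {ε : ℝ} (hε : 0 < ε) :
    ∀ᶠ x in nhdsWithin q.1 (Set.Iic q.1), ∃ y, |y - q.2| < ε ∧ (x, y) ∈ hasseDrawing S := by
  have hS : {z : ℝ × ℝ | -z ∈ {z | -z ∈ S}} = S := by ext; simp
  have hq' : -q ∈ hasseDrawing {z | -z ∈ S} :=
    neg_mem_hasseDrawing (S := {z | -z ∈ S}) (by rwa [hS])
  have := h.neg.eventually_right hq' (neg_lt_neg hq1) hε
  have ht : Filter.Tendsto (fun x : ℝ => -x) (nhdsWithin q.1 (Set.Iic q.1))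
      (nhdsWithin (-q).1 (Set.Ici (-q).1)) := by
    refine tendsto_nhdsWithin_iff.2 ⟨(continuous_neg.tendsto q.1).mono_left nhdsWithin_le_nhds, ?_⟩
    filter_upwards [self_mem_nhdsWithin] with x hx using neg_le_neg (Set.mem_Iic.1 hx)
  filter_upwards [ht.eventually this] with x ⟨y, hy, hy'⟩
  refine ⟨-y, ?_, by simpa using neg_mem_hasseDrawing hy'⟩
  rw [← abs_neg]
  convert hy using 2
  simp only [Prod.snd_neg]; ring

theorem eventually_near (h : IsNetwork S w₀ w₁) {q : ℝ × ℝ} (hq : q ∈ hasseDrawing S)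
    (hq0 : w₀.1 < q.1) (hq1 : q.1 < w₁.1) {ε : ℝ} (hε : 0 < ε) :
    ∀ᶠ x in nhds q.1, ∃ y, |y - q.2| < ε ∧ (x, y) ∈ hasseDrawing S := by
  rw [← nhdsLE_sup_nhdsGE, Filter.eventually_sup]
  exact ⟨h.eventually_left hq hq0 hε, h.eventually_right hq hq1 hε⟩

theorem eq_left_of_fst_le (h : IsNetwork S w₀ w₁) {q : ℝ × ℝ} (hq : q ∈ hasseDrawing S)
    (hq0 : q.1 ≤ w₀.1) : q = w₀ := by
  obtain ⟨p, p', hpp, hqs⟩ := hq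
  have h1 := (mem_Icc_of_mem_segment hpp.2.2.1.le hqs).1.1
  have hp : p = w₀ := by
    by_contra hne
    have := h.left_lt hpp.1 hne
    linarith
  subst hp
  exact eq_left_of_fst_eq (h.lt hpp).1 hqs (le_antisymm hq0 h1)

theorem eq_right_of_le_fst (h : IsNetwork S w₀ w₁) {q : ℝ × ℝ} (hq : q ∈ hasseDrawing S)
    (hq0 : w₁.1 ≤ q.1) : q = w₁ := by
  obtain ⟨p, p', hpp, hqs⟩ := hq
  have h1 := (mem_Icc_of_mem_segment hpp.2.2.1.le hqs).2.1
  have hp : p' = w₁ := by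
    by_contra hne
    have := h.lt_right hpp.2.1 hne
    linarith
  subst hp
  exact eq_right_of_fst_eq (h.lt hpp).1 hqs (le_antisymm h1 hq0)

/-- The vertical hull `H` of the drawing is compact. Since the drawing extends to both sides of each
of its points away from the poles, a point of `H` off the drawing is interior to `H`; so a component
of the complement that meets `H` stays inside it and is bounded. -/
theorem not_isBetween_of_mem_unboundedFace (h : IsNetwork S w₀ w₁) {z : ℝ × ℝ}
    (hz : z ∈ unboundedFace S) : ¬ IsBetween S z := by
  rintro ⟨⟨y₁, h1, h1'⟩, ⟨y₂, h2, h2'⟩⟩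
  obtain ⟨hzK, hzb⟩ := hz
  set K := hasseDrawing S with hK
  have hKc : IsCompact K := isCompact_hasseDrawing h.finite
  let H : Set (ℝ × ℝ) := {z | ∃ y₁ y₂, y₁ ≤ z.2 ∧ z.2 ≤ y₂ ∧ (z.1, y₁) ∈ K ∧ (z.1, y₂) ∈ K}
  have hHc : IsCompact H := by
    let f : ((ℝ × ℝ) × (ℝ × ℝ)) × ℝ → ℝ × ℝ := fun r => r.1.1 + r.2 • (r.1.2 - r.1.1)
    have hc : IsCompact (((K ×ˢ K) ∩ {r | r.1.1 = r.2.1}) ×ˢ Set.Icc (0 : ℝ) 1) :=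
      ((hKc.prod hKc).inter_right (isClosed_eq (by fun_prop) (by fun_prop))).prod isCompact_Icc
    have : H = f '' (((K ×ˢ K) ∩ {r | r.1.1 = r.2.1}) ×ˢ Set.Icc (0 : ℝ) 1) := by
      ext ⟨a, b⟩
      constructor
      · rintro ⟨y₁, y₂, h1, h2, h3, h4⟩
        have h5 : b ∈ segment ℝ y₁ y₂ := by
          rw [segment_eq_Icc (h1.trans h2)]; exact ⟨h1, h2⟩
        rw [segment_eq_image'] at h5
        obtain ⟨t, ht, rfl⟩ := h5
        exact ⟨(((a, y₁), (a, y₂)), t), ⟨⟨⟨h3, h4⟩, rfl⟩, ht⟩, by simp [f]⟩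
      · rintro ⟨⟨⟨⟨u1, u2⟩, ⟨v1, v2⟩⟩, t⟩, ⟨⟨⟨h3, h4⟩, h5⟩, ht0, ht1⟩, he⟩
        simp only at h3 h4 ht0 ht1
        replace h5 : u1 = v1 := h5
        subst h5
        simp only [f, Prod.mk_sub_mk, sub_self, Prod.smul_mk, smul_eq_mul, mul_zero,
          Prod.mk_add_mk, add_zero, Prod.mk.injEq] at he
        obtain ⟨rfl, rfl⟩ := he
        rcases le_total u2 v2 with h6 | h6
        · exact ⟨u2, v2, by nlinarith, by nlinarith, h3, h4⟩
        · exact ⟨v2, u2, by nlinarith, by nlinarith, h4, h3⟩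
    rw [this]
    exact hc.image (by fun_prop)
  have hint : ∀ z ∈ H, z ∉ K → H ∈ nhds z := by
    rintro ⟨a, b⟩ ⟨y₁, y₂, h1, h2, h3, h4⟩ hzK
    simp only at h1 h2 h3 h4
    have h1 : y₁ < b := h1.lt_of_ne fun h => hzK (h ▸ h3)
    have h2 : b < y₂ := h2.lt_of_ne fun h => hzK (h ▸ h4)
    -- At the abscissa of a pole, or beyond, the drawing has at most one point, so two distinct
    -- ordinates are impossible.
    have ha0 : w₀.1 < a := by
      by_contra! ha
      have := (h.eq_left_of_fst_le h3 ha).trans (h.eq_left_of_fst_le h4 ha).symm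
      have := congrArg Prod.snd this
      simp only at this
      linarith
    have ha1 : a < w₁.1 := by
      by_contra! ha
      have := (h.eq_right_of_le_fst h3 ha).trans (h.eq_right_of_le_fst h4 ha).symm
      have := congrArg Prod.snd this
      simp only at this
      linarith
    have e1 := h.eventually_near h3 ha0 ha1 (ε := (b - y₁) / 2) (by linarith)
    have e2 := h.eventually_near h4 ha0 ha1 (ε := (y₂ - b) / 2) (by linarith)
    have t1 : Filter.Tendsto Prod.fst (nhds (a, b)) (nhds a) := continuous_fst.tendsto _
    have t2 : Filter.Tendsto Prod.snd (nhds (a, b)) (nhds b) := continuous_snd.tendsto _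
    filter_upwards [t1.eventually e1, t1.eventually e2,
      t2.eventually (Ioo_mem_nhds (show b - (b - y₁) / 2 < b by linarith)
        (show b < b + (y₂ - b) / 2 by linarith))] with z ⟨u, hu, hu'⟩ ⟨v, hv, hv'⟩ ⟨hz1, hz2⟩
    rw [abs_lt] at hu hv
    exact ⟨u, v, by linarith, by linarith, hu', hv'⟩
  have hzH : z ∈ H := ⟨y₁, y₂, h1.le, h2.le, h1', h2'⟩
  refine hzb (hHc.isBounded.subset (subset_trans ?_ (interior_subset (s := H))))
  refine IsPreconnected.subset_left_of_subset_union isOpen_interior hHc.isClosed.isOpen_compl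
    ?_ ?_ ?_ isPreconnected_connectedComponentIn
  · exact disjoint_compl_right.mono_left interior_subset
  · intro w hw
    have hwK : w ∉ K := connectedComponentIn_subset _ _ hw
    by_cases hwH : w ∈ H
    · exact Or.inl (mem_interior_iff_mem_nhds.2 (hint w hwH hwK))
    · exact Or.inr hwH
  · exact ⟨z, mem_connectedComponentIn hzK, mem_interior_iff_mem_nhds.2 (hint z hzH hzK)⟩

/-- Arcs can be followed down and to the left from `p` as far as `w₀`; a minimal counterexample
replaces the induction. -/
theorem exists_drawing_below (h : IsNetwork S w₀ w₁) {p : ℝ × ℝ} (hp : p ∈ S) {x : ℝ}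
    (h0 : w₀.1 ≤ x) (h1 : x ≤ p.1) : ∃ y ≤ p.2, (x, y) ∈ hasseDrawing S := by
  by_contra hbad
  obtain ⟨m, hm⟩ := (h.finite.subset (s := S)
    (t := {p ∈ S | x ≤ p.1 ∧ ¬ ∃ y ≤ p.2, (x, y) ∈ hasseDrawing S})
    fun _ h => h.1).exists_minimal ⟨p, hp, h1, hbad⟩
  obtain ⟨hmS, hmx, hmb⟩ := hm.prop
  apply hmb
  by_cases hm0 : m = w₀
  · obtain ⟨r, hr⟩ := h.above h.mem_left h.ne
    obtain rfl : x = m.1 := le_antisymm hmx (hm0 ▸ h0)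
    exact ⟨m.2, le_rfl, m, r, hm0 ▸ hr, left_mem_segment _ _ _⟩
  · obtain ⟨r, hr⟩ := h.below hmS hm0
    have hlt := h.lt hr
    rcases le_total r.1 x with h2 | h2
    · have h3 := mk_mem_segment hlt.1 h2 hmx
      exact ⟨_, (mem_Icc_of_mem_segment hr.2.2.1.le h3).2.2, r, m, hr, h3⟩
    · by_contra hb
      refine hm.not_lt ⟨hr.1, h2, fun ⟨y, hy, hy'⟩ => hb ⟨y, hy.trans hlt.2.le, hy'⟩⟩ hr.2.2.1

/-- If the unbounded face lies just below an edge, then this edge is on the lower border. -/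
theorem le_of_not_isBetween (h : IsNetwork S w₀ w₁) {a e : ℝ × ℝ} (hae : HasseArc S a e)
    (hb : ∀ᶠ ε : ℝ in nhdsWithin 0 (Set.Ioi 0),
      ¬ IsBetween S (midpoint ℝ a e + ε • ((e - a).2, -(e - a).1)))
    {k : ℝ × ℝ} (hk : k ∈ S) (hek : e.1 < k.1) : e.2 ≤ k.2 := by
  by_contra! hlt
  obtain ⟨hx, hy⟩ := h.lt hae
  have hmid1 : (midpoint ℝ a e).1 = (a.1 + e.1) / 2 := by
    simp [midpoint_eq_smul_add]; ring
  have hmid2 : (midpoint ℝ a e).2 = (a.2 + e.2) / 2 := by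
    simp [midpoint_eq_smul_add]; ring
  have small : ∀ {f : ℝ → ℝ} {c : ℝ}, Continuous f → f 0 < c →
      ∀ᶠ ε : ℝ in nhdsWithin 0 (Set.Ioi 0), f ε < c := fun hf hc =>
    mem_nhdsWithin_of_mem_nhds ((hf.tendsto 0).eventually (Iio_mem_nhds hc))
  have hright : ∀ᶠ ε : ℝ in nhdsWithin 0 (Set.Ioi 0), (a.1 + e.1) / 2 + ε * (e.2 - a.2) < e.1 :=
    small (by fun_prop) (by linarith)
  have habove : ∀ ε : ℝ, 0 < ε → (a.1 + e.1) / 2 + ε * (e.2 - a.2) < e.1 →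
      ∃ y, (a.2 + e.2) / 2 + ε * -(e.1 - a.1) < y ∧
        ((a.1 + e.1) / 2 + ε * (e.2 - a.2), y) ∈ hasseDrawing S := by
    intro ε hε h1
    have h2 : 0 < ε * (e.2 - a.2) := mul_pos hε (by linarith)
    have h3 : 0 < ε * (e.1 - a.1) := mul_pos hε (by linarith)
    refine ⟨_, ?_, a, e, hae, mk_mem_segment hx (by linarith) h1.le⟩
    have h4 : 1 / 2 ≤ ((a.1 + e.1) / 2 + ε * (e.2 - a.2) - a.1) / (e.1 - a.1) := by
      rw [le_div_iff₀ (by linarith)]; linarith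
    have h5 := mul_le_mul_of_nonneg_right h4 (show 0 ≤ e.2 - a.2 by linarith)
    linarith
  have hbelow : ∀ᶠ ε : ℝ in nhdsWithin 0 (Set.Ioi 0),
      ∃ y, y < (a.2 + e.2) / 2 + ε * -(e.1 - a.1) ∧
        ((a.1 + e.1) / 2 + ε * (e.2 - a.2), y) ∈ hasseDrawing S := by
    -- A point of the drawing is needed below the test point. If `a < k`, an arc from `a` to some `f
    -- ≤ k` passes under the edge, as `f` cannot lie between `a` and `e`. Otherwise `k` is lower
    -- than `a`, and the drawing going down leftwards from `k` passes under.
    rcases le_or_gt a.2 k.2 with h1 | h1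
    · have hak : a < k := lt_of_le_of_ne ⟨by linarith, h1⟩ fun h => by rw [← h] at hek; linarith
      obtain ⟨f, hf, hfk⟩ := exists_hasseArc_above h.finite hae.1 hk hak
      obtain ⟨hfx, hfy⟩ := h.lt hf
      have hf2 : f.2 < e.2 := hfk.2.trans_lt hlt
      have hf1 : e.1 < f.1 := by
        by_contra! hfe
        exact hae.2.2.2 f hf.2.1 ⟨hf.2.2.1, lt_of_le_of_ne ⟨hfe, hf2.le⟩ fun h => by
          rw [h] at hf2; exact lt_irrefl _ hf2⟩
      have hs : ∀ᶠ ε : ℝ in nhdsWithin 0 (Set.Ioi 0),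
          a.2 + ((a.1 + e.1) / 2 + ε * (e.2 - a.2) - a.1) / (f.1 - a.1) * (f.2 - a.2) +
            ε * (e.1 - a.1) < (a.2 + e.2) / 2 := by
        refine small (by fun_prop) ?_
        have h3 : ((a.1 + e.1) / 2 + 0 * (e.2 - a.2) - a.1) / (f.1 - a.1) ≤ 1 / 2 := by
          rw [div_le_iff₀ (by linarith)]; linarith
        have h4 := mul_le_mul_of_nonneg_right h3 (show 0 ≤ f.2 - a.2 by linarith)
        linarith
      filter_upwards [self_mem_nhdsWithin, hright, hs] with ε hε h2 h3
      have h5 : 0 < ε * (e.2 - a.2) := mul_pos hε (by linarith)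
      exact ⟨_, by linarith, a, f, hf, mk_mem_segment hfx (by linarith) (by linarith)⟩
    · have hs : ∀ᶠ ε : ℝ in nhdsWithin 0 (Set.Ioi 0), k.2 + ε * (e.1 - a.1) < (a.2 + e.2) / 2 :=
        small (by fun_prop) (by linarith)
      filter_upwards [self_mem_nhdsWithin, hright, hs] with ε hε h2 h3
      have h5 : 0 < ε * (e.2 - a.2) := mul_pos hε (by linarith)
      have h6 : w₀.1 ≤ a.1 := by
        by_cases ha : a = w₀
        · rw [ha]
        · exact (h.left_lt hae.1 ha).le
      obtain ⟨y, hy1, hy2⟩ := h.exists_drawing_below hk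
        (x := (a.1 + e.1) / 2 + ε * (e.2 - a.2)) (by linarith) (by linarith)
      exact ⟨y, by linarith, hy2⟩
  obtain ⟨ε, h1, h2, h3, h4⟩ := (hb.and (hright.and (hbelow.and self_mem_nhdsWithin))).exists
  apply h1
  simp only [IsBetween, Prod.fst_add, Prod.snd_add, hmid1, hmid2, Prod.smul_fst, Prod.smul_snd,
    smul_eq_mul, Prod.fst_sub, Prod.snd_sub]
  exact ⟨h3, habove ε h4 h2⟩

/-- If the unbounded face lies just above an edge, then this edge is on the upper border. -/
theorem ge_of_not_isBetween (h : IsNetwork S w₀ w₁) {a e : ℝ × ℝ} (hae : HasseArc S e a)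
    (hb : ∀ᶠ ε : ℝ in nhdsWithin 0 (Set.Ioi 0),
      ¬ IsBetween S (midpoint ℝ a e + ε • ((e - a).2, -(e - a).1)))
    {k : ℝ × ℝ} (hk : k ∈ S) (hek : k.1 < e.1) : k.2 ≤ e.2 := by
  have := h.neg.le_of_not_isBetween (a := -a) (e := -e) (hasseArc_neg_iff.2 (by simpa using hae))
    (hb.mono fun ε hε hε' => hε ?_) (k := -k) (by simpa using hk) (neg_lt_neg hek)
  · exact neg_le_neg_iff.1 this
  · convert hε'.neg using 1
    ext
    · simp [midpoint_eq_smul_add]; ring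
    · simp [midpoint_eq_smul_add]; ring

end IsNetwork


open Relation

/-! ## Labels from a drawing -/

/-- The properties of the coordinates of the edges and of the vertices, in a drawing of a bipolar
orientation, that determine the prefix order of `T_x`. -/
structure HalfDrawing {V E : Type*} (C : BipolarCore V E) (x y : E → ℕ) (wx wy : V → ℕ) :
    Prop where
  x_injective : Function.Injective x
  x_pos : ∀ e, 1 ≤ x e
  x_surj : ∀ k e, 1 ≤ k → k ≤ x e → ∃ a, x a = k
  y_injective : Function.Injective y
  wx_injective : Function.Injective wx
  wx_s : wx C.s = 0
  src_x : ∀ e, wx (C.src e) < x e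
  src_y : ∀ e, wy (C.src e) < y e
  tgt_x : ∀ e, x e ≤ wx (C.tgt e)
  le_src : ∀ v e, wx v < x e → wy v < y e → wx v ≤ wx (C.src e)
  exists_right : ∀ v, v ≠ C.s → ∃ r, C.tgt r = v ∧ x r = wx v ∧ y r ≤ wy v
  ascent : ∀ e f, x f = x e + 1 → y e < y f → C.tgt e = C.src f ∧ wx (C.tgt e) = x e
  corner : ∀ r k, x r = wx (C.tgt r) → wx (C.tgt r) < x k → y k ≤ wy (C.tgt r) → y k < y r
  nxo_lt : ∀ c d, C.nxo c d → x c < x d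
  nxi_lt : ∀ e e', C.tgt e ≠ C.t → C.nxi e e' → x e < x e'

namespace HalfDrawing

variable {V E : Type*} {C : BipolarCore V E} {x y : E → ℕ} {wx wy : V → ℕ}

/-- Only edges with children in the tree need this, so the order of the edges that enter the sink
never has to be known. -/
theorem isRI (h : HalfDrawing C x y wx wy) {r : E} (hr : x r = wx (C.tgt r))
    (ht : C.tgt r ≠ C.t) : C.IsRI r := by
  intro r' hr'
  have h1 := h.nxi_lt _ _ ht hr'
  have h2 := h.tgt_x r'
  rw [← C.nxi_tgt hr'] at h2
  omega

theorem transGen_nxo (h : HalfDrawing C x y wx wy) {c d : E} (hs : C.src c = C.src d)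
    (hlt : x c < x d) : TransGen C.nxo c d := by
  have mono : ∀ {a b}, TransGen C.nxo a b → x a < x b := by
    intro a b hab
    induction hab with
    | single h' => exact h.nxo_lt _ _ h'
    | tail _ h' ih => exact ih.trans (h.nxo_lt _ _ h')
  rcases C.nxo_total hs with h' | h' | h'
  · rw [h'] at hlt; omega
  · exact h'
  · have := mono h'; omega

theorem pre_succ (h : HalfDrawing C x y wx wy) {e f : E} (hef : x f = x e + 1) : C.Pre e f := by
  rcases lt_trichotomy (y e) (y f) with hy | hy | hy
  · obtain ⟨h1, h2⟩ := h.ascent e f hef hy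
    exact Or.inl (TransGen.single ⟨h1, h.isRI h2.symm (h1 ▸ C.src_ne f)⟩)
  · rw [h.y_injective hy] at hef; omega
  · have hfx := h.src_x f
    have hfy := h.src_y f
    -- Climbs from `b` to an edge with the same origin as `f`. If the origin of `b` is further
    -- right, its ordinate is at least `y f`, since otherwise it would lie below the origin of `f`;
    -- then `corner` shows that the parent `r` of `b` is still above `f`.
    have key : ∀ b, x b ≤ x e → wx (C.src f) < x b → wy (C.src f) < y b →
        ∃ g, C.src g = C.src f ∧ x g ≤ x e ∧ ReflTransGen C.TreeStep g b := by
      intro b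
      induction hk : x b using Nat.strong_induction_on generalizing b with
      | _ k ih =>
        intro h1 h2 h3
        subst hk
        have h4 := h.le_src (C.src f) b h2 h3
        rcases h4.eq_or_lt with h5 | h5
        · exact ⟨b, (h.wx_injective h5).symm, h1, ReflTransGen.refl⟩
        · have hs : C.src b ≠ C.s := fun hs => by rw [hs, h.wx_s] at h5; omega
          obtain ⟨r, hr1, hr2, hr3⟩ := h.exists_right _ hs
          have hb := h.src_x b
          have hyf : y f ≤ wy (C.src b) := by
            by_contra! hlt
            have := h.le_src (C.src b) f (by omega) hlt
            omega
          have hyr := h.corner r f (by rw [hr2, hr1]) (by rw [hr1]; omega) (by rw [hr1]; exact hyf)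
          obtain ⟨g, hg1, hg2, hg3⟩ := ih (x r) (by omega) r rfl (by omega) (by omega) (by omega)
          exact ⟨g, hg1, hg2, hg3.tail ⟨hr1, h.isRI (by rw [hr2, hr1]) (hr1 ▸ C.src_ne b)⟩⟩
    -- Equality would make `e` the rightmost edge entering the origin of `f`, so `y e ≤ wy (C.src f)
    -- < y f`, whereas this is a descent.
    have hlt : wx (C.src f) < x e := by
      rcases (show wx (C.src f) ≤ x e by omega).eq_or_lt with h1 | h1
      · exfalso
        have hs : C.src f ≠ C.s := fun hs => by
          rw [hs, h.wx_s] at h1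
          have := h.x_pos e
          omega
        obtain ⟨r, hr1, hr2, hr3⟩ := h.exists_right _ hs
        rw [h.x_injective (hr2.trans h1)] at hr3
        omega
      · exact h1
    obtain ⟨g, hg1, hg2, hg3⟩ := key e le_rfl hlt (by omega)
    exact Or.inr ⟨g, f, h.transGen_nxo hg1 (by omega), hg3, ReflTransGen.refl⟩

theorem pre_of_lt (h : HalfDrawing C x y wx wy) {e f : E} (hef : x e < x f) : C.Pre e f := by
  induction hk : x f using Nat.strong_induction_on generalizing f with
  | _ k ih =>
    subst hk
    obtain ⟨g, hg⟩ := h.x_surj (x f - 1) f (by have := h.x_pos e; omega) (by omega)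
    have h1 : C.Pre g f := h.pre_succ (by omega)
    rcases (show x e ≤ x g by omega).eq_or_lt with h2 | h2
    · rwa [h.x_injective h2]
    · exact (ih _ (by omega) h2 rfl).trans h1

/-- Increasing `x` is a total order contained in the asymmetric relation `C.Pre`, so the two agree;
and `x` takes every value from 1 to `x e`. -/
theorem label_eq (h : HalfDrawing C x y wx wy) (e : E) : C.label e = x e := by
  have h1 : {a | C.Pre a e} = {a | x a < x e} := by
    ext a
    refine ⟨fun ha => ?_, fun ha => h.pre_of_lt ha⟩
    by_contra hle
    rcases (not_lt.1 (show ¬ x a < x e from hle)).eq_or_lt with h2 | h2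
    · rw [h.x_injective h2] at ha
      exact BipolarCore.Pre.irrefl _ ha
    · exact ha.asymm (h.pre_of_lt h2)
  have h2 : x '' {a | x a < x e} = Set.Ico 1 (x e) := by
    ext k
    constructor
    · rintro ⟨a, ha, rfl⟩
      exact ⟨h.x_pos a, ha⟩
    · rintro ⟨hk1, hk2⟩
      obtain ⟨a, rfl⟩ := h.x_surj k e hk1 hk2.le
      exact ⟨a, hk2, rfl⟩
  rw [BipolarCore.label, h1, ← Set.ncard_image_of_injective _ h.x_injective, h2,
    ← Finset.coe_Ico, Set.ncard_coe_finset, Nat.card_Ico]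
  have := h.x_pos e
  omega

end HalfDrawing

/-! ## Baxter permutations -/

section Baxter

variable {n : ℕ} {π : Equiv.Perm (Fin n)}

theorem permExt_eq_succ {i : ℕ} (h1 : 1 ≤ i) (h2 : i ≤ n) :
    permExt π i = π ⟨i - 1, by omega⟩ + 1 := by
  have := permExt_succ π ⟨i - 1, by omega⟩
  simpa only [Nat.sub_add_cancel h1] using this

theorem permExt_injOn {i j : ℕ} (hi : i ≤ n + 1) (hj : j ≤ n + 1)
    (h : permExt π i = permExt π j) : i = j := by
  have hmid : ∀ {i}, 1 ≤ i → i ≤ n → 1 ≤ permExt π i ∧ permExt π i ≤ n := by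
    intro i h1 h2
    rw [permExt_eq_succ h1 h2]
    have := (π ⟨i - 1, by omega⟩).2
    omega
  have hcases : ∀ {i}, i ≤ n + 1 → i = 0 ∨ (1 ≤ i ∧ i ≤ n) ∨ i = n + 1 := by omega
  rcases hcases hi with rfl | ⟨h1, h2⟩ | rfl <;> rcases hcases hj with rfl | ⟨h3, h4⟩ | rfl
  · rfl
  · have := hmid h3 h4; rw [permExt_zero] at h; omega
  · rw [permExt_zero, permExt_last] at h; omega
  · have := hmid h1 h2; rw [permExt_zero] at h; omega
  · rw [permExt_eq_succ h1 h2, permExt_eq_succ h3 h4] at h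
    have h5 := congrArg Fin.val (π.injective (Fin.ext (Nat.succ_injective h)))
    have h6 : i - 1 = j - 1 := h5
    omega
  · have := hmid h1 h2; rw [permExt_last] at h; omega
  · rw [permExt_zero, permExt_last] at h; omega
  · have := hmid h3 h4; rw [permExt_last] at h; omega
  · rfl

theorem permExt_le {i : ℕ} (h : i ≤ n) : permExt π i ≤ n := by
  rcases Nat.eq_zero_or_pos i with rfl | h1
  · rw [permExt_zero]; exact Nat.zero_le _
  · rw [permExt_eq_succ h1 h]; exact (π _).2

theorem exists_permExt_eq {j : ℕ} (h1 : 1 ≤ j) (h2 : j ≤ n) :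
    ∃ i, 1 ≤ i ∧ i ≤ n ∧ permExt π i = j := by
  refine ⟨π.symm ⟨j - 1, by omega⟩ + 1, by omega, by omega, ?_⟩
  rw [permExt_succ]
  simp only [Equiv.apply_symm_apply]
  omega

theorem IsBaxter.avoids (h : IsBaxter π) {i j k : ℕ} (h1 : 1 ≤ i) (hij : i < j) (hjk : j < k)
    (hk : k ≤ n) : ¬ (permExt π (j + 1) < permExt π i ∧ permExt π i < permExt π k ∧
      permExt π k < permExt π j) ∧
    ¬ (permExt π j < permExt π k ∧ permExt π k < permExt π i ∧
      permExt π i < permExt π (j + 1)) := by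
  have := h ⟨i - 1, by omega⟩ ⟨j - 1, by omega⟩ ⟨j, by omega⟩ ⟨k - 1, by omega⟩
    (Fin.lt_def.2 (by simp only; omega)) (by simp only; omega)
    (Fin.lt_def.2 (by simp only; omega))
  rw [permExt_eq_succ h1 (by omega), permExt_eq_succ (by omega) hk,
    permExt_eq_succ (i := j) (by omega) (by omega), permExt_eq_succ (i := j + 1) (by omega) (by omega)]
  simp only [Fin.lt_def] at this
  simp only [Nat.add_sub_cancel]
  omega

theorem le_ascentLevel {a i : ℕ} (hi : i ≤ a) (h : permExt π i < permExt π (a + 1)) :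
    permExt π i ≤ ascentLevel π a :=
  Finset.le_sup (f := permExt π) (Finset.mem_filter.2 ⟨Finset.mem_range.2 (by omega), h⟩)

theorem exists_ascentLevel {a : ℕ} (h : permExt π a < permExt π (a + 1)) :
    ∃ i ≤ a, permExt π i = ascentLevel π a ∧ ascentLevel π a < permExt π (a + 1) := by
  obtain ⟨i, hi, hi'⟩ := Finset.exists_mem_eq_sup
    ((Finset.range (a + 1)).filter fun i => permExt π i < permExt π (a + 1))
    ⟨a, Finset.mem_filter.2 ⟨Finset.mem_range.2 (by omega), h⟩⟩ (permExt π)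
  simp only [Finset.mem_filter, Finset.mem_range] at hi
  have hi'' : permExt π i = ascentLevel π a := hi'.symm
  exact ⟨i, by omega, hi'', hi'' ▸ hi.2⟩

/-- Between the positions of two consecutive values `b`, `b + 1`, in this order, there is an ascent
of level `b`. -/
theorem IsBaxter.exists_ascent_of_level (h : IsBaxter π) {i k b : ℕ} (hik : i < k)
    (hk : k ≤ n) (hi : permExt π i = b) (hk' : permExt π k = b + 1) :
    ∃ a, i ≤ a ∧ a < k ∧ permExt π a < permExt π (a + 1) ∧ ascentLevel π a = b := by
  have : ∃ a, i ≤ a ∧ a < k ∧ permExt π a ≤ b ∧ b < permExt π (a + 1) := by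
    by_contra! hc
    have hall : ∀ m, i + m ≤ k → permExt π (i + m) ≤ b := by
      intro m
      induction m with
      | zero => intro _; exact hi.le
      | succ m ih => intro hm; exact hc (i + m) (by omega) (by omega) (ih (by omega))
    have := hall (k - i) (by omega)
    rw [show i + (k - i) = k by omega] at this
    omega
  obtain ⟨a, ha1, ha2, ha3, ha4⟩ := this
  refine ⟨a, ha1, ha2, by omega, ascentLevel_eq π ⟨i, ha1, hi⟩ ha4 fun j hj hj' => ?_⟩
  by_contra! hlt
  have hj1 : 1 ≤ j := by
    rcases Nat.eq_zero_or_pos j with rfl | hj0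
    · rw [permExt_zero] at hlt; omega
    · exact hj0
  have hjb : permExt π j ≠ b + 1 := fun h' => by
    have := permExt_injOn (i := j) (j := k) (by omega) (by omega) (h'.trans hk'.symm)
    omega
  have hja : j ≠ a := fun h' => by rw [h'] at hlt; omega
  by_cases hak : a + 1 = k
  · rw [hak, hk'] at hj'; omega
  -- Forbidden pattern at the positions `j`, `a`, `a + 1`, `k`: `π(a) < b + 1 < π(j) < π(a + 1)`.
  · exact (h.avoids hj1 (lt_of_le_of_ne hj hja) ha2 hk).2 ⟨by omega, by omega, hj'⟩

/-- Otherwise, with `i` the position of the value `ℓ_a`, the positions `i`, `a`, `a + 1`, `k` give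
`π(a) < π(k) < π(i) < π(a + 1)`. -/
theorem IsBaxter.corner_right (h : IsBaxter π) {a k : ℕ} (ha : permExt π a < permExt π (a + 1))
    (hk : a < k) (hkn : k ≤ n) (hkl : permExt π k ≤ ascentLevel π a) :
    permExt π k < permExt π a := by
  obtain ⟨i, hi, hi', hlt⟩ := exists_ascentLevel ha
  by_contra! hle
  have hne : permExt π a ≠ permExt π k := fun h' => by
    have := permExt_injOn (i := a) (j := k) (by omega) (by omega) h'; omega
  have hne' : permExt π k ≠ permExt π i := fun h' => by
    have := permExt_injOn (i := k) (j := i) (by omega) (by omega) h'; omega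
  have hia : i ≠ a := fun h' => by rw [h'] at hi' hne'; omega
  have hi1 : 1 ≤ i := by
    rcases Nat.eq_zero_or_pos i with rfl | hi0
    · rw [permExt_zero] at hi'; omega
    · exact hi0
  exact (h.avoids hi1 (lt_of_le_of_ne hi hia) hk hkn).2 ⟨by omega, by omega, by omega⟩

/-- If `k` came after `i`, some descent between `k` and `a` would cross the level `ℓ_a`; with `i`
before it and `a + 1` after it, this is the other forbidden pattern. -/
theorem IsBaxter.corner_left (h : IsBaxter π) {a i k : ℕ} (ha : permExt π a < permExt π (a + 1))
    (han : a ≤ n) (h1 : 1 ≤ i) (hi : permExt π i = ascentLevel π a) (hka : k ≤ a)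
    (hlt : ascentLevel π a < permExt π k) : k < i := by
  by_contra! hik
  obtain ⟨-, -, -, hl⟩ := exists_ascentLevel ha
  have hpa := le_ascentLevel le_rfl ha
  have hik' : i < k := lt_of_le_of_ne hik fun h' => by rw [h'] at hi; omega
  -- By maximality of `ℓ_a`, no value up to position `a` lies strictly between `ℓ_a` and `π(a + 1)`.
  have big : ∀ {m}, m ≤ a → ascentLevel π a < permExt π m → permExt π (a + 1) < permExt π m := by
    intro m hm hm'
    by_contra! hc
    rcases hc.eq_or_lt with h' | h'
    · have := permExt_injOn (i := m) (j := a + 1) (by omega) (by omega) h'; omega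
    · have := le_ascentLevel hm h'; omega
  have han' : a < n := by
    by_contra! hc
    have h3 := big hka hlt
    have h4 := permExt_le (π := π) (hka.trans han)
    rw [show a = n by omega, permExt_last] at h3
    omega
  have : ∃ j, k ≤ j ∧ j < a ∧ ascentLevel π a < permExt π j ∧
      permExt π (j + 1) ≤ ascentLevel π a := by
    by_contra! hc
    have hall : ∀ m, k + m ≤ a → ascentLevel π a < permExt π (k + m) := by
      intro m
      induction m with
      | zero => intro _; exact hlt
      | succ m ih => intro hm; exact hc (k + m) (by omega) (by omega) (ih (by omega))
    have := hall (a - k) (by omega)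
    rw [show k + (a - k) = a by omega] at this
    omega
  obtain ⟨j, hj1, hj2, hj3, hj4⟩ := this
  have hne : permExt π (j + 1) ≠ permExt π i := fun h' => by
    have := permExt_injOn (i := j + 1) (j := i) (by omega) (by omega) h'; omega
  exact (h.avoids h1 (show i < j by omega) (show j < a + 1 by omega) (by omega)).1
    ⟨by omega, by omega, big (by omega) hj3⟩

end Baxter


open Relation

/-! ## The coordinates of a drawing -/

namespace PhiDrawing

variable {n : ℕ} {π : Equiv.Perm (Fin n)} {V E : Type*} [Fintype V] [Fintype E]
  {O : PlaneBipolarOrientation V E} (D : PhiDrawing π O)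

theorem exists_black (e : E) :
    ∃ i : ℕ, 1 ≤ i ∧ i ≤ n ∧ D.black e = ((i : ℝ), (permExt π i : ℝ)) := by
  have := D.black_bijOn.mapsTo (Set.mem_univ e)
  rwa [permDiagram_eq] at this

/-- The abscissa of a black point. -/
noncomputable def x (e : E) : ℕ := (D.exists_black e).choose

/-- The ordinate of a black point. -/
noncomputable def y (e : E) : ℕ := permExt π (D.x e)

theorem x_pos (e : E) : 1 ≤ D.x e := (D.exists_black e).choose_spec.1

theorem x_le (e : E) : D.x e ≤ n := (D.exists_black e).choose_spec.2.1

theorem black_eq (e : E) : D.black e = ((D.x e : ℝ), (D.y e : ℝ)) :=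
  (D.exists_black e).choose_spec.2.2

theorem exists_white (v : V) : ∃ a, a ≤ n ∧ permExt π a < permExt π (a + 1) ∧
    D.white v = whitePoint π a := D.white_bijOn.mapsTo (Set.mem_univ v)

/-- The integral part of the abscissa of a white point. -/
noncomputable def wx (v : V) : ℕ := (D.exists_white v).choose

/-- The integral part of the ordinate of a white point. -/
noncomputable def wy (v : V) : ℕ := ascentLevel π (D.wx v)

theorem wx_le (v : V) : D.wx v ≤ n := (D.exists_white v).choose_spec.1

theorem ascent_wx (v : V) : permExt π (D.wx v) < permExt π (D.wx v + 1) :=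
  (D.exists_white v).choose_spec.2.1

theorem white_eq (v : V) : D.white v = ((D.wx v : ℝ) + 1 / 2, (D.wy v : ℝ) + 1 / 2) :=
  (D.exists_white v).choose_spec.2.2

theorem black_injective : Function.Injective D.black := fun _ _ h =>
  D.black_bijOn.injOn (Set.mem_univ _) (Set.mem_univ _) h

theorem white_injective : Function.Injective D.white := fun _ _ h =>
  D.white_bijOn.injOn (Set.mem_univ _) (Set.mem_univ _) h

theorem x_injective : Function.Injective D.x := fun a b h =>
  D.black_injective (by rw [black_eq, black_eq, y, y, h])

theorem wx_injective : Function.Injective D.wx := fun a b h =>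
  D.white_injective (by rw [white_eq, white_eq, wy, wy, h])

theorem y_injective : Function.Injective D.y := fun a b h =>
  D.x_injective (permExt_injOn ((D.x_le a).trans (Nat.le_succ n)) ((D.x_le b).trans (Nat.le_succ n)) h)

theorem exists_x_eq {i : ℕ} (h1 : 1 ≤ i) (h2 : i ≤ n) : ∃ e, D.x e = i := by
  have : ((i : ℝ), (permExt π i : ℝ)) ∈ permDiagram π := by
    rw [permDiagram_eq]
    exact ⟨i, h1, h2, rfl⟩
  obtain ⟨e, -, he⟩ := D.black_bijOn.surjOn this
  rw [black_eq] at he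
  exact ⟨e, Nat.cast_injective (R := ℝ) (congrArg Prod.fst he)⟩

theorem exists_wx_eq {a : ℕ} (h1 : a ≤ n) (h2 : permExt π a < permExt π (a + 1)) :
    ∃ v, D.wx v = a := by
  obtain ⟨v, -, hv⟩ := D.white_bijOn.surjOn (show whitePoint π a ∈ whitePoints π from ⟨a, h1, h2, rfl⟩)
  rw [white_eq] at hv
  exact ⟨v, by exact_mod_cast add_right_cancel (congrArg Prod.fst hv)⟩

theorem wx_source : D.wx O.source = 0 := by
  have := D.white_source
  rw [white_eq] at this
  exact_mod_cast add_right_cancel (congrArg Prod.fst this)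

theorem wx_sink : D.wx O.sink = n := by
  have := D.white_sink
  rw [white_eq] at this
  exact_mod_cast add_right_cancel (congrArg Prod.fst this)

theorem wy_source : D.wy O.source = 0 := by
  obtain ⟨i, hi, hi', -⟩ := exists_ascentLevel (D.ascent_wx O.source)
  rw [wx_source, Nat.le_zero] at hi
  rw [wy, ← hi', hi, permExt_zero]

theorem white_le_black_iff {v : V} {e : E} :
    D.white v ≤ D.black e ↔ D.wx v < D.x e ∧ D.wy v < D.y e := by
  rw [white_eq, black_eq, Prod.mk_le_mk, half_le_cast_iff, half_le_cast_iff]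

theorem black_le_white_iff {v : V} {e : E} :
    D.black e ≤ D.white v ↔ D.x e ≤ D.wx v ∧ D.y e ≤ D.wy v := by
  rw [white_eq, black_eq, Prod.mk_le_mk, cast_le_half_iff, cast_le_half_iff]

theorem black_le_black_iff {e f : E} :
    D.black e ≤ D.black f ↔ D.x e ≤ D.x f ∧ D.y e ≤ D.y f := by
  rw [black_eq, black_eq, Prod.mk_le_mk, Nat.cast_le, Nat.cast_le]

theorem white_le_white_iff {u v : V} :
    D.white u ≤ D.white v ↔ D.wx u ≤ D.wx v ∧ D.wy u ≤ D.wy v := by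
  rw [white_eq, white_eq, Prod.mk_le_mk, add_le_add_iff_right, add_le_add_iff_right, Nat.cast_le,
    Nat.cast_le]

theorem white_ne_black (v : V) (e : E) : D.white v ≠ D.black e := fun h => by
  have h1 := (D.white_le_black_iff.1 h.le).1
  have h2 := (D.black_le_white_iff.1 h.ge).1
  omega

theorem phiPoints_eq : phiPoints π = Set.range D.black ∪ Set.range D.white := by
  rw [phiPoints, ← D.black_bijOn.image_eq, ← D.white_bijOn.image_eq, Set.image_univ, Set.image_univ]

theorem finite_phiPoints (D : PhiDrawing π O) : (phiPoints π).Finite := by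
  rw [D.phiPoints_eq]
  exact (Set.finite_range _).union (Set.finite_range _)

theorem black_mem (e : E) : D.black e ∈ phiPoints π := by
  rw [D.phiPoints_eq]
  exact Or.inl ⟨e, rfl⟩

theorem white_mem (v : V) : D.white v ∈ phiPoints π := by
  rw [D.phiPoints_eq]
  exact Or.inr ⟨v, rfl⟩

theorem hasseArc_src (e : E) : HasseArc (phiPoints π) (D.white (O.src e)) (D.black e) :=
  (D.hasseArc_iff _ _).2 ⟨e, Or.inl ⟨rfl, rfl⟩⟩

theorem hasseArc_tgt (e : E) : HasseArc (phiPoints π) (D.black e) (D.white (O.tgt e)) :=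
  (D.hasseArc_iff _ _).2 ⟨e, Or.inr ⟨rfl, rfl⟩⟩

theorem src_lt (e : E) : D.wx (O.src e) < D.x e ∧ D.wy (O.src e) < D.y e :=
  D.white_le_black_iff.1 (D.hasseArc_src e).2.2.1.le

theorem le_tgt (e : E) : D.x e ≤ D.wx (O.tgt e) ∧ D.y e ≤ D.wy (O.tgt e) :=
  D.black_le_white_iff.1 (D.hasseArc_tgt e).2.2.1.le

/-- The only arc into a black point comes from its white origin, so everything strictly below the
black point is below this origin. -/
theorem le_white_src {p : ℝ × ℝ} {e : E} (hp : p ∈ phiPoints π) (h : p ≤ D.black e)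
    (hne : p ≠ D.black e) : p ≤ D.white (O.src e) := by
  obtain ⟨r, hr, hpr⟩ := exists_hasseArc_below D.finite_phiPoints hp (D.black_mem e)
    (lt_of_le_of_ne h hne)
  obtain ⟨f, ⟨rfl, hf⟩ | ⟨-, hf⟩⟩ := (D.hasseArc_iff _ _).1 hr
  · rwa [D.black_injective hf]
  · exact absurd hf.symm (D.white_ne_black _ _)

theorem white_tgt_le {p : ℝ × ℝ} {e : E} (hp : p ∈ phiPoints π) (h : D.black e ≤ p)
    (hne : D.black e ≠ p) : D.white (O.tgt e) ≤ p := by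
  obtain ⟨r, hr, hpr⟩ := exists_hasseArc_above D.finite_phiPoints (D.black_mem e) hp
    (lt_of_le_of_ne h hne)
  obtain ⟨f, ⟨hf, -⟩ | ⟨hf, rfl⟩⟩ := (D.hasseArc_iff _ _).1 hr
  · exact absurd hf.symm (D.white_ne_black _ _)
  · rwa [D.black_injective hf]

theorem exists_incoming_ge {p : ℝ × ℝ} {v : V} (hp : p ∈ phiPoints π) (h : p ≤ D.white v)
    (hne : p ≠ D.white v) : ∃ e, O.tgt e = v ∧ p ≤ D.black e := by
  obtain ⟨r, hr, hpr⟩ := exists_hasseArc_below D.finite_phiPoints hp (D.white_mem v)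
    (lt_of_le_of_ne h hne)
  obtain ⟨f, ⟨-, hf⟩ | ⟨rfl, hf⟩⟩ := (D.hasseArc_iff _ _).1 hr
  · exact absurd hf (D.white_ne_black _ _)
  · exact ⟨f, D.white_injective hf.symm, hpr⟩

theorem white_le_src {v : V} {e : E} (hx : D.wx v < D.x e) (hy : D.wy v < D.y e) :
    D.wx v ≤ D.wx (O.src e) ∧ D.wy v ≤ D.wy (O.src e) :=
  D.white_le_white_iff.1 (D.le_white_src (D.white_mem v) (D.white_le_black_iff.2 ⟨hx, hy⟩)
    (D.white_ne_black v e))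

theorem black_le_src {k e : E} (hx : D.x k < D.x e) (hy : D.y k < D.y e) :
    D.x k ≤ D.wx (O.src e) ∧ D.y k ≤ D.wy (O.src e) :=
  D.black_le_white_iff.1 (D.le_white_src (D.black_mem k) (D.black_le_black_iff.2 ⟨hx.le, hy.le⟩)
    fun h => by rw [D.black_injective h] at hx; omega)

theorem tgt_le_white {v : V} {e : E} (hx : D.x e ≤ D.wx v) (hy : D.y e ≤ D.wy v) :
    D.wx (O.tgt e) ≤ D.wx v ∧ D.wy (O.tgt e) ≤ D.wy v :=
  D.white_le_white_iff.1 (D.white_tgt_le (D.white_mem v) (D.black_le_white_iff.2 ⟨hx, hy⟩)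
    (D.white_ne_black v e).symm)

theorem tgt_lt_black {k e : E} (hx : D.x e < D.x k) (hy : D.y e < D.y k) :
    D.wx (O.tgt e) < D.x k ∧ D.wy (O.tgt e) < D.y k :=
  D.white_le_black_iff.1 (D.white_tgt_le (D.black_mem k) (D.black_le_black_iff.2 ⟨hx.le, hy.le⟩)
    fun h => by rw [D.black_injective h] at hx; omega)

theorem exists_tgt_eq {v : V} {k : E} (hx : D.x k ≤ D.wx v) (hy : D.y k ≤ D.wy v) :
    ∃ e, O.tgt e = v ∧ D.x k ≤ D.x e ∧ D.y k ≤ D.y e := by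
  obtain ⟨e, he, h⟩ := D.exists_incoming_ge (D.black_mem k) (D.black_le_white_iff.2 ⟨hx, hy⟩)
    (D.white_ne_black v k).symm
  exact ⟨e, he, D.black_le_black_iff.1 h⟩

/-- Equal ordinates would put `u` below `v`, hence below a black point entering `v`, whose ordinate
would lie strictly above that of `u` and not above that of `v`. -/
theorem wy_ne_of_wx_lt {u v : V} (hx : D.wx u < D.wx v) : D.wy u ≠ D.wy v := fun hy => by
  obtain ⟨e, rfl, h⟩ := D.exists_incoming_ge (D.white_mem u)
    (D.white_le_white_iff.2 ⟨hx.le, hy.le⟩) fun h => by rw [D.white_injective h] at hx; omega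
  have h1 := (D.white_le_black_iff.1 h).2
  have h2 := (D.le_tgt e).2
  omega

theorem wy_injective : Function.Injective D.wy := fun u v h => by
  rcases lt_trichotomy (D.wx u) (D.wx v) with h' | h' | h'
  · exact absurd h (D.wy_ne_of_wx_lt h')
  · exact D.wx_injective h'
  · exact absurd h.symm (D.wy_ne_of_wx_lt h')

theorem exists_right {v : V} (hv : v ≠ O.source) :
    ∃ r, O.tgt r = v ∧ D.x r = D.wx v ∧ D.y r ≤ D.wy v := by
  have h0 : D.wx v ≠ 0 := fun h => hv (D.wx_injective (h.trans D.wx_source.symm))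
  obtain ⟨k, hk⟩ := D.exists_x_eq (Nat.one_le_iff_ne_zero.2 h0) (D.wx_le v)
  have hy : D.y k ≤ D.wy v := by
    rw [y, hk]
    exact le_ascentLevel le_rfl (D.ascent_wx v)
  obtain ⟨e, rfl, hx, -⟩ := D.exists_tgt_eq hk.le hy
  have := D.le_tgt e
  exact ⟨e, rfl, by omega, this.2⟩

theorem exists_left {v : V} (hv : v ≠ O.source) :
    ∃ l, O.tgt l = v ∧ D.y l = D.wy v ∧ D.x l ≤ D.wx v := by
  have h0 : D.wy v ≠ 0 := fun h => hv (D.wy_injective (h.trans D.wy_source.symm))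
  obtain ⟨i, hi, hi', -⟩ := exists_ascentLevel (D.ascent_wx v)
  have h1 : i ≠ 0 := fun h => by
    rw [h, permExt_zero] at hi'
    exact h0 hi'.symm
  obtain ⟨k, rfl⟩ := D.exists_x_eq (Nat.one_le_iff_ne_zero.2 h1) (hi.trans (D.wx_le v))
  have hy : D.y k = D.wy v := hi'
  obtain ⟨e, rfl, -, hy'⟩ := D.exists_tgt_eq hi hy.le
  have := D.le_tgt e
  exact ⟨e, rfl, by omega, this.1⟩

/-- The white point of the ascent lies above `e` and below `f`. As their abscissas are consecutive,
it is both the endpoint of `e` and the origin of `f`. -/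
theorem ascent_x {e f : E} (hx : D.x f = D.x e + 1) (hy : D.y e < D.y f) :
    O.tgt e = O.src f ∧ D.wx (O.tgt e) = D.x e := by
  have ha : permExt π (D.x e) < permExt π (D.x e + 1) := by
    rw [← hx]
    exact hy
  obtain ⟨v, hv⟩ := D.exists_wx_eq (D.x_le e) ha
  obtain ⟨i, -, -, hlt⟩ := exists_ascentLevel ha
  have h1 : D.y e ≤ D.wy v := by
    rw [wy, hv]
    exact le_ascentLevel le_rfl ha
  have h2 : D.wy v < D.y f := by
    rw [wy, hv, y, hx]
    exact hlt
  have h3 := D.white_le_src (v := v) (e := f) (by omega) h2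
  have h4 := D.src_lt f
  have h5 := D.tgt_le_white (v := v) (e := e) (by omega) h1
  have h6 := D.le_tgt e
  exact ⟨D.wx_injective (by omega), by omega⟩

theorem ascent_y (hπ : IsBaxter π) {e f : E} (hy : D.y f = D.y e + 1) (hx : D.x e < D.x f) :
    O.tgt e = O.src f ∧ D.wy (O.tgt e) = D.y e := by
  obtain ⟨a, ha1, ha2, ha, hl⟩ := hπ.exists_ascent_of_level hx (D.x_le f) rfl hy
  obtain ⟨v, rfl⟩ := D.exists_wx_eq (ha2.le.trans (D.x_le f)) ha
  have hl' : D.wy v = D.y e := hl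
  have h3 := D.white_le_src (v := v) (e := f) ha2 (by omega)
  have h4 := D.src_lt f
  have h5 := D.tgt_le_white (v := v) (e := e) ha1 hl'.ge
  have h6 := D.le_tgt e
  exact ⟨D.wy_injective (by omega), by omega⟩

theorem y_lt_of_src_eq {e f : E} (h : O.src e = O.src f) (hx : D.x e < D.x f) : D.y f < D.y e := by
  by_contra! hy
  rcases hy.eq_or_lt with h' | h'
  · rw [D.y_injective h'] at hx; omega
  · have h1 := D.black_le_src hx h'
    have h2 := D.src_lt e
    rw [← h] at h1
    omega

theorem y_lt_of_tgt_eq {e f : E} (h : O.tgt e = O.tgt f) (hx : D.x e < D.x f) : D.y f < D.y e := by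
  by_contra! hy
  rcases hy.eq_or_lt with h' | h'
  · rw [D.y_injective h'] at hx; omega
  · have h1 := D.tgt_lt_black hx h'
    have h2 := D.le_tgt f
    rw [h] at h1
    omega

/-! ### Angles around a vertex -/

/-- The argument of the vector from a white point to a black point. -/
noncomputable def ang (v : V) (e : E) : ℝ := cellArg (D.wx v) (D.wy v) (D.x e) (D.y e)

theorem arg_eq_ang (v : V) (e : E) :
    Complex.arg ⟨(D.black e - D.white v).1, (D.black e - D.white v).2⟩ = D.ang v e := by
  rw [black_eq, white_eq]
  rfl

theorem ang_out (e : E) : 0 < D.ang (O.src e) e ∧ D.ang (O.src e) e < Real.pi / 2 :=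
  cellArg_out (D.src_lt e).1 (D.src_lt e).2

theorem ang_in (e : E) : -Real.pi < D.ang (O.tgt e) e ∧ D.ang (O.tgt e) e < -(Real.pi / 2) :=
  cellArg_in (D.le_tgt e).1 (D.le_tgt e).2

theorem ang_out_lt {e f : E} (h : O.src e = O.src f) (hx : D.x e < D.x f) :
    D.ang (O.src f) f < D.ang (O.src e) e := by
  rw [← h]
  exact cellArg_out_lt (D.src_lt e).1 hx (by rw [h]; exact (D.src_lt f).2) (D.y_lt_of_src_eq h hx)

theorem ang_in_lt {e f : E} (h : O.tgt e = O.tgt f) (hx : D.x e < D.x f) :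
    D.ang (O.tgt e) e < D.ang (O.tgt f) f := by
  rw [← h]
  exact cellArg_in_lt hx (by rw [h]; exact (D.le_tgt f).1) (D.y_lt_of_tgt_eq h hx) (D.le_tgt e).2

theorem clockwiseAngle_rot_le {d d' d'' : E ⊕ E} (h : O.rot d = d') (hv : O.vert d'' = O.vert d) :
    clockwiseAngle (D.black (d.elim id id) - D.white (O.vert d))
        (D.black (d'.elim id id) - D.white (O.vert d)) ≤
      clockwiseAngle (D.black (d.elim id id) - D.white (O.vert d))
        (D.black (d''.elim id id) - D.white (O.vert d)) := by
  have := D.rot_clockwise d d'' hv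
  rw [h] at this
  convert this using 3 <;> cases d <;> cases d' <;> cases d'' <;> rfl

theorem ang_lt_of_rot {d d' d'' : E ⊕ E} (h : O.rot d = d') (hv : O.vert d'' = O.vert d)
    (hlt : D.ang (O.vert d'') (d''.elim id id) < D.ang (O.vert d) (d.elim id id)) :
    D.ang (O.vert d') (d'.elim id id) < D.ang (O.vert d) (d.elim id id) := by
  have := lt_of_clockwiseAngle_le (D.clockwiseAngle_rot_le h hv)
  simp only [arg_eq_ang] at this
  rw [hv] at hlt
  rw [← h, O.vert_rot, h]
  exact this hlt

theorem ang_le_of_rot {d d' d'' : E ⊕ E} (h : O.rot d = d') (hv : O.vert d'' = O.vert d)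
    (hlt : D.ang (O.vert d') (d'.elim id id) < D.ang (O.vert d) (d.elim id id) ↔
      D.ang (O.vert d'') (d''.elim id id) < D.ang (O.vert d) (d.elim id id)) :
    D.ang (O.vert d'') (d''.elim id id) ≤ D.ang (O.vert d') (d'.elim id id) := by
  have := D.clockwiseAngle_rot_le h hv
  have hv' : O.vert d' = O.vert d := by rw [← h, O.vert_rot]
  rw [hv, hv'] at hlt ⊢
  by_cases hc : D.ang (O.vert d) (d'.elim id id) < D.ang (O.vert d) (d.elim id id)
  · rw [clockwiseAngle_of_lt (by simpa only [arg_eq_ang] using hc),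
      clockwiseAngle_of_lt (by simpa only [arg_eq_ang] using hlt.1 hc)] at this
    simp only [arg_eq_ang] at this
    linarith
  · rw [clockwiseAngle_of_le (by simpa only [arg_eq_ang, not_lt] using hc),
      clockwiseAngle_of_le (by simpa only [arg_eq_ang, not_lt] using mt hlt.2 hc)] at this
    simp only [arg_eq_ang] at this
    linarith

/-- If `e'` were to the left of `e`, the clockwise turn from `e'` to `e` would sweep over the
outgoing darts. The sink has none, hence its exclusion. -/
theorem x_lt_of_nxi {e e' : E} (ht : O.tgt e ≠ O.sink) (h : O.NextIncoming e e') :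
    D.x e < D.x e' := by
  have hr := (O.nextIncoming_iff.1 h).1
  have hv := O.nextIncoming_tgt h
  by_contra! hle
  have hlt : D.x e' < D.x e := lt_of_le_of_ne hle fun h' => O.core.nxi_irrefl e (by
    have := TransGen.single (r := O.core.nxi) h
    rwa [D.x_injective h'] at this)
  have h1 := D.ang_in_lt hv.symm hlt
  obtain ⟨o, ho⟩ := O.exists_src ht
  have h2 := D.ang_out o
  have h3 := D.ang_in e
  have h4 := D.ang_in e'
  have h5 := Real.pi_pos
  have := D.ang_le_of_rot (d'' := Sum.inl o) hr (ho.trans hv)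
    ⟨fun h => absurd h h1.not_gt, fun h => absurd h (by
      change ¬ D.ang (O.src o) o < D.ang (O.tgt e') e'
      linarith)⟩
  change D.ang (O.src o) o ≤ D.ang (O.tgt e) e at this
  linarith

/-! ### The border of the outer face -/

theorem isNetwork : IsNetwork (phiPoints π) (D.white O.source) (D.white O.sink) where
  finite := D.finite_phiPoints
  lt := by
    intro p q h
    obtain ⟨e, ⟨rfl, rfl⟩ | ⟨rfl, rfl⟩⟩ := (D.hasseArc_iff _ _).1 h
    · rw [white_eq, black_eq]
      exact ⟨half_lt_cast (D.src_lt e).1, half_lt_cast (D.src_lt e).2⟩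
    · rw [white_eq, black_eq]
      exact ⟨cast_lt_half (D.le_tgt e).1, cast_lt_half (D.le_tgt e).2⟩
  below := by
    intro p hp hne
    rw [D.phiPoints_eq] at hp
    obtain ⟨e, rfl⟩ | ⟨v, rfl⟩ := hp
    · exact ⟨_, D.hasseArc_src e⟩
    · obtain ⟨e, rfl⟩ := O.exists_tgt fun h => hne (congrArg _ h)
      exact ⟨_, D.hasseArc_tgt e⟩
  above := by
    intro p hp hne
    rw [D.phiPoints_eq] at hp
    obtain ⟨e, rfl⟩ | ⟨v, rfl⟩ := hp
    · exact ⟨_, D.hasseArc_tgt e⟩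
    · obtain ⟨e, rfl⟩ := O.exists_src fun h => hne (congrArg _ h)
      exact ⟨_, D.hasseArc_src e⟩
  mem_left := D.white_mem _
  mem_right := D.white_mem _
  left_lt := by
    intro p hp hne
    rw [D.phiPoints_eq] at hp
    obtain ⟨e, rfl⟩ | ⟨v, rfl⟩ := hp
    · rw [white_eq, black_eq, wx_source]
      exact half_lt_cast (D.x_pos e)
    · have h0 : D.wx v ≠ 0 := fun h =>
        hne (congrArg _ (D.wx_injective (h.trans D.wx_source.symm)))
      rw [white_eq, white_eq, wx_source]
      exact add_lt_add_left (Nat.cast_lt.2 (Nat.pos_of_ne_zero h0)) _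
  lt_right := by
    intro p hp hne
    rw [D.phiPoints_eq] at hp
    obtain ⟨e, rfl⟩ | ⟨v, rfl⟩ := hp
    · rw [white_eq, black_eq, wx_sink]
      exact cast_lt_half (D.x_le e)
    · have h0 : D.wx v ≠ n := fun h =>
        hne (congrArg _ (D.wx_injective (h.trans D.wx_sink.symm)))
      rw [white_eq, white_eq, wx_sink]
      exact add_lt_add_left (Nat.cast_lt.2 (lt_of_le_of_ne (D.wx_le v) h0)) _
  ne := fun h => O.source_ne_sink (D.white_injective h)

/-- Descends the lower border. The successor of `e` at its origin is the rightmost ingoing edge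
there, which has the outer face on its right and again nothing below it on its right; the descent
ends at the source. -/
theorem exists_outer_of_lower (e : E) (hf : O.face (Sum.inl e) = O.outer)
    (hL : ∀ k, D.x e < D.x k → D.y e < D.y k) :
    ∃ c, O.src c = O.source ∧ O.face (Sum.inl c) = O.outer ∧
      ∀ f, O.src f = O.source → D.x f ≤ D.x c := by
  induction hm : D.x e using Nat.strong_induction_on generalizing e with
  | _ m ih =>
    subst hm
    by_cases hs : O.src e = O.source
    · refine ⟨e, hs, hf, fun f hfs => ?_⟩
      by_contra! hlt
      have h1 := D.y_lt_of_src_eq (hs.trans hfs.symm) hlt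
      have h2 := hL f hlt
      omega
    obtain ⟨d, hd, -⟩ | ⟨-, ⟨r, hr, -⟩ | ⟨h, -⟩⟩ := O.rot_inl_cases e
    · exact absurd hf (O.nextOutgoing_iff.1 hd).2
    · have hv : O.tgt r = O.src e := by
        have := O.vert_rot (Sum.inl e)
        rwa [hr] at this
      obtain ⟨r', hr'1, hr'2, -⟩ := D.exists_right hs
      have he := D.src_lt e
      have hre := D.le_tgt r
      rw [hv] at hre
      have hxr : D.x r = D.wx (O.src e) := by
        by_contra hne
        have h1 := D.ang_in_lt (hv.trans hr'1.symm) (by omega)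
        have h2 := D.ang_out e
        have h3 := D.ang_in r
        have h4 := D.ang_in r'
        have h5 := Real.pi_pos
        have := D.ang_le_of_rot (d'' := Sum.inr r') hr hr'1
          ⟨fun _ => show D.ang (O.tgt r') r' < D.ang (O.src e) e by linarith,
            fun _ => show D.ang (O.tgt r) r < D.ang (O.src e) e by linarith⟩
        exact absurd h1 (not_lt.2 this)
      refine ih _ (by omega) r ((O.face_inl_of_rot_inl_inr hr).trans hf) (fun k hk => ?_) rfl
      by_contra! hle
      rcases lt_trichotomy (D.x k) (D.x e) with h | h | h
      · have := D.black_le_src (k := k) (e := e) h (by omega)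
        omega
      · rw [D.x_injective h] at hle; omega
      · have := hL k h
        omega
    · exact absurd h hs

/-- Descends the upper border to the leftmost edge leaving the source; the dart before it in
clockwise order is the required one. -/
theorem exists_outer_of_upper (e : E) (hf : O.face (Sum.inr e) = O.outer)
    (hU : ∀ k, D.x k < D.x e → D.y k < D.y e) :
    ∃ c, O.src c = O.source ∧ O.face (Sum.inl c) = O.outer ∧
      ∀ f, O.src f = O.source → D.x f ≤ D.x c := by
  induction hm : D.x e using Nat.strong_induction_on generalizing e with
  | _ m ih =>
    subst hm
    have hrot : O.rot (O.rot.symm (Sum.inl e)) = Sum.inl e := O.rot.apply_symm_apply _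
    have hvr := O.vert_rot (O.rot.symm (Sum.inl e))
    generalize O.rot.symm (Sum.inl e) = d at hrot hvr
    rw [hrot] at hvr
    cases d with
    | inl c =>
      have hc : O.src e = O.src c := hvr
      have hcf := (O.face_inl_of_rot_inl_inl hrot).symm.trans hf
      have hs := O.src_of_source_corner_outer hrot hcf
      refine ⟨c, hs, hcf, fun f hfs => ?_⟩
      by_contra! hlt
      have h1 := D.ang_out_lt (hs.trans hfs.symm) hlt
      have h2 := D.ang_lt_of_rot (d'' := Sum.inl f) hrot (hfs.trans hs.symm) h1
      change D.ang (O.src e) e < D.ang (O.src c) c at h2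
      rcases lt_trichotomy (D.x c) (D.x e) with h | h | h
      · have h3 := D.y_lt_of_src_eq hc.symm h
        have h4 := hU c h
        omega
      · rw [D.x_injective h] at h2; exact lt_irrefl _ h2
      · exact lt_asymm h2 (D.ang_out_lt hc h)
    | inr l =>
      have hv : O.src e = O.tgt l := hvr
      have hs : O.src e ≠ O.source := fun h => O.tgt_ne_source l (hv.symm.trans h)
      obtain ⟨l', hl'1, hl'2, -⟩ := D.exists_left hs
      have he := D.src_lt e
      have hle := D.le_tgt l
      rw [← hv] at hle
      have hyl : D.y l = D.wy (O.src e) := by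
        by_contra hne
        have hx : D.x l' < D.x l := by
          by_contra! h
          rcases h.eq_or_lt with h' | h'
          · rw [D.x_injective h'] at hne; exact hne hl'2
          · have := D.y_lt_of_tgt_eq (hv.symm.trans hl'1.symm) h'
            omega
        have h1 := D.ang_in_lt (hl'1.trans hv) hx
        have h2 := D.ang_lt_of_rot (d'' := Sum.inr l') hrot (hl'1.trans hv) h1
        change D.ang (O.src e) e < D.ang (O.tgt l) l at h2
        have h3 := D.ang_out e
        have h4 := D.ang_in l
        linarith [Real.pi_pos]
      refine ih _ (by omega) l ((O.face_inr_of_rot_inr_inl hrot).symm.trans hf) (fun k hk => ?_) rfl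
      by_contra! hlt
      rcases hlt.eq_or_lt with h | h
      · rw [D.y_injective h] at hk; omega
      · have := D.black_le_src (k := k) (e := e) (by omega) (hU k (by omega))
        omega

/-- The marked face and the unbounded one are only known to agree beside one dart. Following the
border down from it shows that the cyclic order at the source is cut just after the rightmost edge
of the drawing. -/
theorem exists_outer : ∃ c, O.src c = O.source ∧ O.face (Sum.inl c) = O.outer ∧
    ∀ f, O.src f = O.source → D.x f ≤ D.x c := by
  obtain ⟨d, hd, hb⟩ := D.outer_unbounded
  have hb' := hb.mono fun _ h => D.isNetwork.not_isBetween_of_mem_unboundedFace h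
  cases d with
  | inl e =>
    refine D.exists_outer_of_lower e hd fun k hk => ?_
    have := D.isNetwork.le_of_not_isBetween (D.hasseArc_src e) hb' (D.black_mem k)
      (by rw [black_eq, black_eq]; exact Nat.cast_lt.2 hk)
    rw [black_eq, black_eq] at this
    refine lt_of_le_of_ne (Nat.cast_le.1 this) fun h => ?_
    rw [D.y_injective h] at hk
    omega
  | inr e =>
    refine D.exists_outer_of_upper e hd fun k hk => ?_
    have := D.isNetwork.ge_of_not_isBetween (D.hasseArc_tgt e) hb' (D.black_mem k)
      (by rw [black_eq, black_eq]; exact Nat.cast_lt.2 hk)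
    rw [black_eq, black_eq] at this
    refine lt_of_le_of_ne (Nat.cast_le.1 this) fun h => ?_
    rw [D.y_injective h] at hk
    omega

/-- If `d` were to the left of `c`, turning clockwise from `c` to `d` would sweep over every dart of
smaller argument than `c`. There is one: an ingoing dart or, at the source, the rightmost edge,
which is not `c` because `c` is not at the outer corner. -/
theorem x_lt_of_nxo {c d : E} (h : O.NextOutgoing c d) : D.x c < D.x d := by
  obtain ⟨hr, hf⟩ := O.nextOutgoing_iff.1 h
  have hv := O.nextOutgoing_src h
  by_contra! hle
  have hlt : D.x d < D.x c := lt_of_le_of_ne hle fun h' => O.core.nxo_irrefl c (by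
    have := TransGen.single (r := O.core.nxo) h
    rwa [D.x_injective h'] at this)
  have h1 := D.ang_out_lt hv.symm hlt
  suffices ∃ d'', O.vert d'' = O.src c ∧
      D.ang (O.vert d'') (d''.elim id id) < D.ang (O.src c) c by
    obtain ⟨d'', h2, h3⟩ := this
    exact lt_asymm h1 (D.ang_lt_of_rot hr h2 h3)
  by_cases hs : O.src c = O.source
  · obtain ⟨e, hes, hef, he⟩ := D.exists_outer
    exact ⟨Sum.inl e, hes.trans hs.symm, D.ang_out_lt (hs.trans hes.symm)
      (lt_of_le_of_ne (he c hs) fun h' => hf (by rwa [D.x_injective h']))⟩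
  · obtain ⟨w, hw⟩ := O.exists_tgt hs
    refine ⟨Sum.inr w, hw, ?_⟩
    change D.ang (O.tgt w) w < _
    linarith [Real.pi_pos, D.ang_in w, D.ang_out c]

/-! ### The labels of the edges -/

theorem halfDrawing_x (hπ : IsBaxter π) : HalfDrawing O.core D.x D.y D.wx D.wy where
  x_injective := D.x_injective
  x_pos := D.x_pos
  x_surj k e h1 h2 := D.exists_x_eq h1 (h2.trans (D.x_le e))
  y_injective := D.y_injective
  wx_injective := D.wx_injective
  wx_s := D.wx_source
  src_x e := (D.src_lt e).1
  src_y e := (D.src_lt e).2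
  tgt_x e := (D.le_tgt e).1
  le_src v e h1 h2 := (D.white_le_src h1 h2).1
  exists_right v hv := D.exists_right hv
  ascent e f h1 h2 := D.ascent_x h1 h2
  corner r k h1 h2 h3 := by
    have := hπ.corner_right (D.ascent_wx (O.tgt r)) h2 (D.x_le k) h3
    rw [y, y, h1]
    exact this
  nxo_lt c d h := D.x_lt_of_nxo h
  nxi_lt e e' h1 h2 := D.x_lt_of_nxi h1 h2

theorem halfDrawing_y (hπ : IsBaxter π) : HalfDrawing O.core.mirror D.y D.x D.wy D.wx where
  x_injective := D.y_injective
  x_pos e := Nat.one_le_iff_ne_zero.2 fun h => by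
    have := (D.src_lt e).2
    omega
  x_surj k e h1 h2 := by
    obtain ⟨i, hi1, hi2, rfl⟩ :=
      exists_permExt_eq (π := π) h1 (h2.trans (permExt_le (D.x_le e)))
    obtain ⟨f, rfl⟩ := D.exists_x_eq hi1 hi2
    exact ⟨f, rfl⟩
  y_injective := D.x_injective
  wx_injective := D.wy_injective
  wx_s := D.wy_source
  src_x e := (D.src_lt e).2
  src_y e := (D.src_lt e).1
  tgt_x e := (D.le_tgt e).2
  le_src v e h1 h2 := (D.white_le_src h2 h1).2
  exists_right v hv := D.exists_left hv
  ascent e f h1 h2 := D.ascent_y hπ h1 h2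
  corner r k h1 h2 h3 :=
    hπ.corner_left (D.ascent_wx (O.tgt r)) (D.wx_le _) (D.x_pos r) h1 h3 h2
  nxo_lt c d h := D.y_lt_of_src_eq (O.nextOutgoing_src h) (D.x_lt_of_nxo h)
  nxi_lt e e' h1 h2 := by
    have hv := O.nextIncoming_tgt h2
    exact D.y_lt_of_tgt_eq hv (D.x_lt_of_nxi (fun h => h1 (hv.symm.trans h)) h2)

theorem psi_eq (D : PhiDrawing π O) (hπ : IsBaxter π) : O.Psi = permDiagram π := by
  have h : (fun e : E => ((O.xLabel e : ℝ), (O.yLabel e : ℝ))) = D.black := by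
    funext e
    rw [O.xLabel_eq, O.yLabel_eq, (D.halfDrawing_x hπ).label_eq, (D.halfDrawing_y hπ).label_eq,
      black_eq]
  rw [PlaneBipolarOrientation.Psi, h, ← Set.image_univ, D.black_bijOn.image_eq]

end PhiDrawing

/-! ### Conclusion: existence, and uniqueness through the diagram. -/

theorem permDiagram_injective {n : ℕ} :
    Function.Injective (permDiagram : Equiv.Perm (Fin n) → Set (ℝ × ℝ)) := by
  intro π ρ h
  ext i
  have hi : (((i : ℕ) : ℝ) + 1, ((π i : ℕ) : ℝ) + 1) ∈ permDiagram ρ := h ▸ ⟨i, rfl⟩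
  obtain ⟨j, hj⟩ := hi
  have h1 : (j : ℕ) = i := by exact_mod_cast add_right_cancel (congrArg Prod.fst hj)
  have h2 : (ρ j : ℕ) = π i := by exact_mod_cast add_right_cancel (congrArg Prod.snd hj)
  rw [← h2, Fin.ext h1]

theorem mainTheorem4 {V E : Type*} [Fintype V] [Fintype E] (O : PlaneBipolarOrientation V E) :
    (∃! π : Equiv.Perm (Fin (Fintype.card E)), IsBaxter π ∧ IsPhi π O) ∧
      ∀ (n : ℕ) (π : Equiv.Perm (Fin n)), IsBaxter π → IsPhi π O → O.Psi = permDiagram π := by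
  have hpsi : ∀ (n : ℕ) (π : Equiv.Perm (Fin n)), IsBaxter π → IsPhi π O →
      O.Psi = permDiagram π := fun _ _ hπ ⟨D⟩ => D.psi_eq hπ
  obtain ⟨π, hπ, hΦ⟩ := O.exists_isBaxter_isPhi
  exact ⟨⟨π, ⟨hπ, hΦ⟩, fun ρ hρ => permDiagram_injective
    ((hpsi _ ρ hρ.1 hρ.2).symm.trans (hpsi _ π hπ hΦ))⟩, hpsi⟩
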